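/- **Setting and conventions.** Let $(\mathcal M,g_{ab})$ be a smooth 4-dimensional Lorentzian manifold (signature $(-,+,+,+)$, the unphysical space-time) with volume element $\eta_{abcd}$ and Levi-Civita connection $\nabla$, let $\Theta$ be a smooth real function on $\mathcal M$, and let $\tilde{\mathcal M}\subset\mathcal M$ be an open set on which $\Theta\neq0$ (the physical space-time), carrying a smooth Lorentzian metric $\tilde g_{ab}$ with $g_{ab}=\Theta^2\tilde g_{ab}$, with volume element $\tilde\eta_{abcd}$ of the same orientation, and satisfying $\tilde R_{ab}=\lambda\tilde g_{ab}$ for a constant $\lambda\in\mathbb R$. Conventions: $\nabla_a\nabla_b\omega_c-\nabla_b\nabla_a\omega_c=R_{abc}{}^d\omega_d$, $R_{ac}=R_{abc}{}^b$, and $T^*_{abcd}=\frac12\eta_{cdef}T_{ab}{}^{ef}$. Indices are moved with $g_{ab}$ ($\tilde g^{ab}$ denotes the inverse of $\tilde g_{ab}$, and $\tilde\eta,\tilde g$ are used for physical duals). *Physical quantities.* Let $\tilde W_{abcd}$ be the Weyl tensor of $\tilde g$ (fourth index lowered with $\tilde g$) and put $\tilde{\mathcal W}_{abcd}=\frac12(\tilde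 W_{abcd}-i\tilde W^*_{abcd})$, $\tilde{\mathcal G}_{abcd}=\frac12(-i\tilde\eta_{abcd}+\tilde g_{ac}\tilde g_{bd}-\tilde g_{ad}\tilde g_{bc})$, let $\tilde a$ and $\tilde b$ be the full contractions, with $\tilde g^{ab}$, of the forms $\tilde{\mathcal W}_{abcd}\tilde{\mathcal W}^{abcd}$ and $\tilde{\mathcal W}_{ab}{}^{cd}\tilde{\mathcal W}_{cd}{}^{pq}\tilde{\mathcal W}_{pq}{}^{ab}$, and put $$\tilde w=-\frac{\tilde b}{2\tilde a},\qquad \tilde\varphi=\tfrac{27}{2}\tilde w^{11/3},\qquad \tilde\Xi_{ac}=(\tilde{\mathcal W}_{apcq}-\tilde w\,\tilde{\mathcal G}_{apcq})\tilde g^{bp}\tilde g^{dq}\tilde\nabla_b\tilde w\,\tilde\nabla_d\tilde w .$$ *Unphysical quantities (on $\tilde{\mathcal M}$).* Let $d_{abcd}=C_{abcd}/\Theta$ with $C$ the Weyl tensor of $g$, $\mathfrak d_{abcd}=\frac12(d_{abcd}-i\,d^*_{abcd})$, $\mathcal G_{abcd}=\frac12(-i\eta_{abcd}+g_{ac}g_{bd}-g_{ad}g_{bc})$,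 $a=\mathfrak d_{abcd}\mathfrak d^{abcd}$, $b=\mathfrak d_{ab}{}^{cd}\mathfrak d_{cd}{}^{pq}\mathfrak d_{pq}{}^{ab}$, $w=-b/(2a)$, $\varphi=\frac{27}2w^{11/3}$, and $\mathcal D_{abcd}=\mathfrak d_{ab}{}^{pq}\mathfrak d_{pqcd}-\frac a6\mathcal G_{abcd}-\frac ba\mathfrak d_{abcd}$. Here $w^{11/3}$ and $\tilde w^{11/3}$ mean the eleventh powers of cube roots of $w$ and $\tilde w$, chosen arbitrarily at each point of $\tilde{\mathcal S}$ subject to $\tilde w^{1/3}=\Theta\,w^{1/3}$ (principal branches satisfy this when $\Theta>0$). *Splitting.* Let $n^a$ be the smooth unit timelike normal ($n_an^a=-1$) of a foliation of $\mathcal M$ by the spacelike level sets of a smooth function, let $\mathcal S$ be the leaf given by the value $0$, and let $\tilde{\mathcal S}\subset\mathcal S\cap\tilde{\mathcal M}$. Let $h_{ab}=g_{ab}+n_an_b$, $K_{ab}=h_a{}^ch_b{}^d\nabla_cn_d$, $\varepsilon_{abc}=\eta_{dabc}n^d$, let $D_a$ be the spatial (projected) covariant derivative, $\Omega=\Theta|_{\mathcal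 S}$, and define $\sigma$ and the spatial covector $\sigma_a$ by $\nabla_a\Theta=-n_a\sigma+\sigma_a$. Let $\mathcal E_{ab}=\mathfrak d_{apbq}n^pn^q$, $\mathfrak a_{ab}=\mathcal D_{apbq}n^pn^q$, $w^\bot_a=\dfrac{b\,D_aa-a\,D_ab}{2a^2}$ and $$w^\parallel=-\frac{6K^{bc}}{a^3}\bigl(b^2\mathcal E_{bc}+a(b\,\mathfrak a_{bc}-12a\,\mathcal E_b{}^d\mathfrak a_{cd})\bigr)-\frac{a\,b\,K^b{}_b-16i\,\varepsilon_{cde}(b\,\mathcal E^{bc}+3a\,\mathfrak a^{bc})D^e\mathcal E_b{}^d}{2a^2}.$$ **Proposition.** Let $\tilde\eta_a$ be a complex covector field whose orthogonal splitting at the points of $\tilde{\mathcal S}$ is $$\tilde\eta_a=\frac{Y}{\Theta^2}n_a+\frac{Y_a}{\Theta^2},\qquad n^aY_a=0,$$ with $Y$ a complex function and $Y_a$ a complex covector field, and suppose that $a\neq0$, $w\neq0$ and $Y\neq0$ on $\tilde{\mathcal S}$. Then $(\tilde\Xi_{ac}-\tilde\varphi\,\tilde\eta_a\tilde\eta_c)|_{\tilde{\mathcal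 S}}=0$ if and only if the following three conditions hold at all points of $\tilde{\mathcal S}$: $$Y^2=\frac1{2\varphi}\Bigl(w\bigl(3\sigma^bw(6\sigma^d\mathcal E_{bd}+3\sigma_bw+2\Omega w^\bot_b)+\Omega^2w^\bot_bw^{\bot b}\bigr)+2\Omega\,\mathcal E_{bd}(6\sigma^bw+\Omega w^{\bot b})w^{\bot d}\Bigr),$$ $$\begin{aligned}Y_c=-\frac1{2Y\varphi}\Bigl(&(3\sigma w-\Omega w^\parallel)(6\sigma^b\mathcal E_{cb}w+3\sigma_cw^2+2\Omega\,\mathcal E_{cb}w^{\bot b}+\Omega w\,w^\bot_c)+6i\,\Omega\,\varepsilon_{cba}\sigma^b\mathcal E_d{}^aw\,w^{\bot d}\\&+2i\,\varepsilon_{cda}\mathcal E_b{}^a\bigl(\Omega^2w^{\bot b}w^{\bot d}+3\sigma^bw(3\sigma^dw+\Omega w^{\bot d})\bigr)\Bigr),\end{aligned}$$ $$Y_aY_b=\frac{Q_{ab}}{\Omega^4},$$ where $$\begin{aligned}\varphi\,Q_{ac}={}&\tfrac12\Omega^4(2\mathcal E_{ac}+h_{ac}w)(-3\sigma w+\Omega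 w^\parallel)^2\\&-i\,\Omega^4(\varepsilon_{cbd}\mathcal E_a{}^d+\varepsilon_{abd}\mathcal E_c{}^d)(-3\sigma w+\Omega w^\parallel)(3\sigma^bw+\Omega w^{\bot b})\\&+\bigl(h^{bd}\mathcal E_{ac}-h^b{}_c\mathcal E_a{}^d-h_a{}^d\mathcal E^b{}_c+\tfrac12h_a{}^dh^b{}_cw+h_{ac}(\mathcal E^{bd}-\tfrac12h^{bd}w)\bigr)\\&\quad\times(3\Omega^2\sigma_bw+\Omega^3w^\bot_b)(3\Omega^2\sigma_dw+\Omega^3w^\bot_d).\end{aligned}$$ -/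

import Mathlib

open scoped Manifold ContDiff

namespace TypeDData

/-! ### Tensor calculus in a coordinate chart

Indices run over `Fin 4`.  Tensor components are functions of the indices; index slots of a function
`T a b c d` are listed in the order in which the tensor is written.  `G` always denotes the matrix of
covariant components of a metric and `G⁻¹` that of its contravariant components. -/

/-- The coordinate space. -/
abbrev R4 := EuclideanSpace ℝ (Fin 4)

/-- The coordinate partial derivative `∂_i f`. -/
noncomputable def pd {F : Type} [NormedAddCommGroup F] [NormedSpace ℝ F]
    (i : Fin 4) (f : R4 → F) (x : R4) : F :=
  fderiv ℝ f x (EuclideanSpace.single i 1)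

/-- Christoffel symbols `Γ^k_{ij}` of the Levi-Civita connection. -/
noncomputable def christoffel (G : R4 → Matrix (Fin 4) (Fin 4) ℝ) (x : R4)
    (k i j : Fin 4) : ℝ :=
  1 / 2 * ∑ l, (G x)⁻¹ k l *
    (pd i (fun y => G y j l) x + pd j (fun y => G y i l) x - pd l (fun y => G y i j) x)

/-- The Riemann tensor `R_{abc}{}^d`, in the convention
`∇_a ∇_b ω_c - ∇_b ∇_a ω_c = R_{abc}{}^d ω_d`. -/
noncomputable def riemann (G : R4 → Matrix (Fin 4) (Fin 4) ℝ) (x : R4)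
    (a b c d : Fin 4) : ℝ :=
  pd b (fun y => christoffel G y d a c) x - pd a (fun y => christoffel G y d b c) x
    + ∑ e, (christoffel G x e a c * christoffel G x d b e
        - christoffel G x e b c * christoffel G x d a e)

/-- The Ricci tensor `R_{ac} = R_{abc}{}^b`. -/
noncomputable def ricci (G : R4 → Matrix (Fin 4) (Fin 4) ℝ) (x : R4) (a c : Fin 4) : ℝ :=
  ∑ b, riemann G x a b c b

/-- The scalar curvature. -/
noncomputable def scalarCurv (G : R4 → Matrix (Fin 4) (Fin 4) ℝ) (x : R4) : ℝ :=
  ∑ a, ∑ b, (G x)⁻¹ a b * ricci G x a b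

/-- The Schouten tensor `L_{ab} = (R_{ab} - R g_{ab} / 6) / 2`. -/
noncomputable def schouten (G : R4 → Matrix (Fin 4) (Fin 4) ℝ) (x : R4) (a b : Fin 4) : ℝ :=
  1 / 2 * (ricci G x a b - 1 / 6 * scalarCurv G x * G x a b)

/-- The Weyl tensor
`C_{abcd} = R_{abcd} - 2 L_{d[b} g_{a]c} - 2 g_{d[b} L_{a]c}`, all indices down. -/
noncomputable def weyl (G : R4 → Matrix (Fin 4) (Fin 4) ℝ) (x : R4) (a b c d : Fin 4) : ℝ :=
  (∑ k, G x d k * riemann G x a b c k)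
    - (schouten G x d b * G x a c - schouten G x d a * G x b c)
    - (G x d b * schouten G x a c - G x d a * schouten G x b c)

/-- The right Hodge dual `T^*_{abcd} = (1/2) η_{cdef} T_{ab}{}^{ef}`. -/
noncomputable def rightDual (G : Matrix (Fin 4) (Fin 4) ℝ) (vol : Fin 4 → Fin 4 → Fin 4 → Fin 4 → ℝ)
    (T : Fin 4 → Fin 4 → Fin 4 → Fin 4 → ℝ) (a b c d : Fin 4) : ℝ :=
  1 / 2 * ∑ e, ∑ f, ∑ p, ∑ q, vol c d e f * G⁻¹ e p * G⁻¹ f q * T a b p q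

/-- The self-dual part `(1/2) (T_{abcd} - i T^*_{abcd})`. -/
noncomputable def selfDual (G : Matrix (Fin 4) (Fin 4) ℝ) (vol : Fin 4 → Fin 4 → Fin 4 → Fin 4 → ℝ)
    (T : Fin 4 → Fin 4 → Fin 4 → Fin 4 → ℝ) (a b c d : Fin 4) : ℂ :=
  1 / 2 * ((T a b c d : ℂ) - Complex.I * (rightDual G vol T a b c d : ℂ))

/-- `W^{ab}{}_{cd}`: the first two indices raised. -/
noncomputable def raiseFirst (G : Matrix (Fin 4) (Fin 4) ℝ)
    (W : Fin 4 → Fin 4 → Fin 4 → Fin 4 → ℂ) (a b c d : Fin 4) : ℂ :=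
  ∑ p, ∑ q, (G⁻¹ a p : ℂ) * (G⁻¹ b q : ℂ) * W p q c d

/-- `W_{ab}{}^{cd}`: the last two indices raised. -/
noncomputable def raiseLast (G : Matrix (Fin 4) (Fin 4) ℝ)
    (W : Fin 4 → Fin 4 → Fin 4 → Fin 4 → ℂ) (a b c d : Fin 4) : ℂ :=
  ∑ p, ∑ q, (G⁻¹ c p : ℂ) * (G⁻¹ d q : ℂ) * W a b p q

/-- The quadratic scalar `W_{abcd} W^{abcd}`. -/
noncomputable def scalarA (G : Matrix (Fin 4) (Fin 4) ℝ)
    (W : Fin 4 → Fin 4 → Fin 4 → Fin 4 → ℂ) : ℂ :=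
  ∑ a, ∑ b, ∑ c, ∑ d, raiseLast G W a b c d * raiseFirst G W a b c d

/-- The cubic scalar `W_{ab}{}^{cd} W_{cd}{}^{pq} W_{pq}{}^{ab}`. -/
noncomputable def scalarB (G : Matrix (Fin 4) (Fin 4) ℝ)
    (W : Fin 4 → Fin 4 → Fin 4 → Fin 4 → ℂ) : ℂ :=
  ∑ a, ∑ b, ∑ c, ∑ d, ∑ p, ∑ q,
    raiseLast G W a b c d * raiseLast G W c d p q * raiseLast G W p q a b

/-- The scalar `w = - b / (2 a)`. -/
noncomputable def scalarW (G : Matrix (Fin 4) (Fin 4) ℝ)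
    (W : Fin 4 → Fin 4 → Fin 4 → Fin 4 → ℂ) : ℂ :=
  -scalarB G W / (2 * scalarA G W)

/-- `𝒢_{abcd} = (1/2) (- i η_{abcd} + g_{ac} g_{bd} - g_{ad} g_{bc})`. -/
noncomputable def calG (G : Matrix (Fin 4) (Fin 4) ℝ) (vol : Fin 4 → Fin 4 → Fin 4 → Fin 4 → ℝ)
    (a b c d : Fin 4) : ℂ :=
  1 / 2 * (-Complex.I * (vol a b c d : ℂ) + (G a c * G b d - G a d * G b c : ℝ))

/-- `φ = (27/2) w^{11/3}`, where the argument `r` is the chosen cube root of `w`. -/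
noncomputable def phiOfRoot (r : ℂ) : ℂ := 27 / 2 * r ^ 11

/-! ### Physical quantities, built from the physical metric and volume element alone -/

/-- The self-dual Weyl tensor of a metric. -/
noncomputable def physWeyl (G : R4 → Matrix (Fin 4) (Fin 4) ℝ)
    (vol : R4 → Fin 4 → Fin 4 → Fin 4 → Fin 4 → ℝ) (x : R4) : Fin 4 → Fin 4 → Fin 4 → Fin 4 → ℂ :=
  selfDual (G x) (vol x) (weyl G x)

/-- The scalar `w` of the self-dual Weyl tensor of a metric. -/
noncomputable def physW (G : R4 → Matrix (Fin 4) (Fin 4) ℝ)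
    (vol : R4 → Fin 4 → Fin 4 → Fin 4 → Fin 4 → ℝ) (x : R4) : ℂ :=
  scalarW (G x) (physWeyl G vol x)

/-- `Ξ_{ac} = (W_{apcq} - w 𝒢_{apcq}) g^{bp} g^{dq} ∇_b w ∇_d w`. -/
noncomputable def physXi (G : R4 → Matrix (Fin 4) (Fin 4) ℝ)
    (vol : R4 → Fin 4 → Fin 4 → Fin 4 → Fin 4 → ℝ) (x : R4) (a c : Fin 4) : ℂ :=
  ∑ b, ∑ d, ∑ p, ∑ q,
    (physWeyl G vol x a p c q - physW G vol x * calG (G x) (vol x) a p c q)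
      * ((G x)⁻¹ b p : ℂ) * ((G x)⁻¹ d q : ℂ)
      * pd b (physW G vol) x * pd d (physW G vol) x

/-! ### Unphysical quantities and their splitting along the unit normal -/

/-- The coordinate components of the unphysical fields: the metric `g_{ab}`, its volume element
`η_{abcd}`, the conformal factor `Θ` and the unit timelike normal `n_a`. -/
structure LocalFields where
  metric : R4 → Matrix (Fin 4) (Fin 4) ℝ
  vol : R4 → Fin 4 → Fin 4 → Fin 4 → Fin 4 → ℝ
  conf : R4 → ℝ
  normal : R4 → Fin 4 → ℝ

namespace LocalFields

variable (L : LocalFields)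

/-- The rescaled Weyl tensor `d_{abcd} = C_{abcd} / Θ`. -/
noncomputable def resWeyl (x : R4) (a b c d : Fin 4) : ℝ := weyl L.metric x a b c d / L.conf x

/-- `𝔡_{abcd} = (1/2) (d_{abcd} - i d^*_{abcd})`. -/
noncomputable def frakd (x : R4) : Fin 4 → Fin 4 → Fin 4 → Fin 4 → ℂ :=
  selfDual (L.metric x) (L.vol x) (L.resWeyl x)

/-- The scalar `a`. -/
noncomputable def sa (x : R4) : ℂ := scalarA (L.metric x) (L.frakd x)

/-- The scalar `b`. -/
noncomputable def sb (x : R4) : ℂ := scalarB (L.metric x) (L.frakd x)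

/-- The scalar `w = - b / (2 a)`. -/
noncomputable def sw (x : R4) : ℂ := scalarW (L.metric x) (L.frakd x)

/-- `𝒟_{abcd} = 𝔡_{ab}{}^{pq} 𝔡_{pqcd} - (a/6) 𝒢_{abcd} - (b/a) 𝔡_{abcd}`. -/
noncomputable def calD (x : R4) (a b c d : Fin 4) : ℂ :=
  (∑ p, ∑ q, raiseLast (L.metric x) (L.frakd x) a b p q * L.frakd x p q c d)
    - L.sa x / 6 * calG (L.metric x) (L.vol x) a b c d
    - L.sb x / L.sa x * L.frakd x a b c d

/-- `n^a`. -/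
noncomputable def nUp (x : R4) (a : Fin 4) : ℝ := ∑ b, (L.metric x)⁻¹ a b * L.normal x b

/-- The spatial metric `h_{ab} = g_{ab} + n_a n_b`. -/
noncomputable def h (x : R4) (a b : Fin 4) : ℝ := L.metric x a b + L.normal x a * L.normal x b

/-- `h^{ab}`, with which indices of spatial tensors are raised. -/
noncomputable def hUp (x : R4) (a b : Fin 4) : ℝ := (L.metric x)⁻¹ a b + L.nUp x a * L.nUp x b

/-- The projector `h_a{}^b`. -/
noncomputable def hMix (x : R4) (a b : Fin 4) : ℝ :=
  (if a = b then 1 else 0) + L.normal x a * L.nUp x b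

/-- `v^a = h^{ab} v_b`. -/
noncomputable def up (x : R4) (v : Fin 4 → ℂ) (a : Fin 4) : ℂ := ∑ b, (L.hUp x a b : ℂ) * v b

/-- `T_a{}^b = h^{bc} T_{ac}`. -/
noncomputable def mix (x : R4) (T : Fin 4 → Fin 4 → ℂ) (a b : Fin 4) : ℂ :=
  ∑ c, (L.hUp x b c : ℂ) * T a c

/-- `T^{ab} = h^{ac} h^{bd} T_{cd}`. -/
noncomputable def up2 (x : R4) (T : Fin 4 → Fin 4 → ℂ) (a b : Fin 4) : ℂ :=
  ∑ c, ∑ d, (L.hUp x a c : ℂ) * (L.hUp x b d : ℂ) * T c d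

/-- The extrinsic curvature `K_{ab} = h_a{}^c h_b{}^d ∇_c n_d`. -/
noncomputable def extK (x : R4) (a b : Fin 4) : ℝ :=
  ∑ c, ∑ d, L.hMix x a c * L.hMix x b d *
    (pd c (fun y => L.normal y d) x - ∑ e, christoffel L.metric x e c d * L.normal x e)

/-- `K^b{}_b`. -/
noncomputable def trK (x : R4) : ℝ := ∑ a, ∑ b, L.hUp x a b * L.extK x a b

/-- The scalar `σ` in `∇_a Θ = - n_a σ + σ_a`. -/
noncomputable def sig (x : R4) : ℝ := ∑ a, L.nUp x a * pd a L.conf x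

/-- The spatial covector `σ_a` in `∇_a Θ = - n_a σ + σ_a`. -/
noncomputable def sigLow (x : R4) (a : Fin 4) : ℝ := ∑ b, L.hMix x a b * pd b L.conf x

/-- `ℰ_{ab} = 𝔡_{apbq} n^p n^q`. -/
noncomputable def calE (x : R4) (a b : Fin 4) : ℂ :=
  ∑ p, ∑ q, L.frakd x a p b q * (L.nUp x p : ℂ) * (L.nUp x q : ℂ)

/-- `𝔞_{ab} = 𝒟_{apbq} n^p n^q`. -/
noncomputable def frakA (x : R4) (a b : Fin 4) : ℂ :=
  ∑ p, ∑ q, L.calD x a p b q * (L.nUp x p : ℂ) * (L.nUp x q : ℂ)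

/-- `ε_{abc} = η_{dabc} n^d`. -/
noncomputable def eps (x : R4) (a b c : Fin 4) : ℝ := ∑ d, L.vol x d a b c * L.nUp x d

/-- The spatial gradient `D_a f = h_a{}^b ∂_b f` of a scalar. -/
noncomputable def gradD (f : R4 → ℂ) (x : R4) (a : Fin 4) : ℂ :=
  ∑ b, (L.hMix x a b : ℂ) * pd b f x

/-- The space-time covariant derivative `∇_e ℰ_{bd}`. -/
noncomputable def nablaE (x : R4) (e b d : Fin 4) : ℂ :=
  pd e (fun y => L.calE y b d) x
    - ∑ k, ((christoffel L.metric x k e b : ℂ) * L.calE x k d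
        + (christoffel L.metric x k e d : ℂ) * L.calE x b k)

/-- `D_e ℰ_{bd}`: the spatial Levi-Civita derivative, that is, the projection of `∇_e ℰ_{bd}`. -/
noncomputable def covDE (x : R4) (e b d : Fin 4) : ℂ :=
  ∑ i, ∑ j, ∑ k, (L.hMix x e i : ℂ) * (L.hMix x b j : ℂ) * (L.hMix x d k : ℂ) * L.nablaE x i j k

/-- `D^e ℰ_b{}^d`. -/
noncomputable def covDEUp (x : R4) (e b d : Fin 4) : ℂ :=
  ∑ i, ∑ j, (L.hUp x e i : ℂ) * (L.hUp x d j : ℂ) * L.covDE x i b j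

/-- `w^⊥_a = (b D_a a - a D_a b) / (2 a²)`. -/
noncomputable def wPerp (x : R4) (c : Fin 4) : ℂ :=
  (L.sb x * L.gradD L.sa x c - L.sa x * L.gradD L.sb x c) / (2 * L.sa x ^ 2)

/-- The scalar `w^∥`, written through `K_{ab}`, `ℰ_{ab}`, `𝔞_{ab}` and `D_a ℰ_{bc}`:
`- (6 K^{bc} / a³) (b² ℰ_{bc} + a (b 𝔞_{bc} - 12 a ℰ_b{}^d 𝔞_{cd}))
 - (a b K^b{}_b - 16 i ε_{cde} (b ℰ^{bc} + 3 a 𝔞^{bc}) D^e ℰ_b{}^d) / (2 a²)`. -/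
noncomputable def wPar (x : R4) : ℂ :=
  -(6 / L.sa x ^ 3) * (∑ b, ∑ c, L.up2 x (fun i j => (L.extK x i j : ℂ)) b c *
      (L.sb x ^ 2 * L.calE x b c + L.sa x * (L.sb x * L.frakA x b c
        - 12 * L.sa x * ∑ d, L.mix x (L.calE x) b d * L.frakA x c d)))
    - (L.sa x * L.sb x * (L.trK x : ℂ)
        - 16 * Complex.I * ∑ b, ∑ c, ∑ d, ∑ e, (L.eps x c d e : ℂ) *
          (L.sb x * L.up2 x (L.calE x) b c + 3 * L.sa x * L.up2 x (L.frakA x) b c)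
            * L.covDEUp x e b d) / (2 * L.sa x ^ 2)

/-- The right-hand side of the formula for `Y²`. -/
noncomputable def lapseSq (x : R4) (φ : ℂ) : ℂ :=
  let w : ℂ := L.sw x
  let Ω : ℂ := (L.conf x : ℂ)
  let s : Fin 4 → ℂ := fun a => (L.sigLow x a : ℂ)
  let sU : Fin 4 → ℂ := L.up x s
  let wp : Fin 4 → ℂ := L.wPerp x
  let wpU : Fin 4 → ℂ := L.up x wp
  1 / (2 * φ) *
    (w * ((∑ b, 3 * sU b * w *
            (6 * (∑ d, sU d * L.calE x b d) + 3 * s b * w + 2 * Ω * wp b))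
          + Ω ^ 2 * ∑ b, wp b * wpU b)
      + 2 * Ω * ∑ b, ∑ d, L.calE x b d * (6 * sU b * w + Ω * wpU b) * wpU d)

/-- The right-hand side of the formula for `Y_c`. -/
noncomputable def shift (x : R4) (φ Y : ℂ) (c : Fin 4) : ℂ :=
  let w : ℂ := L.sw x
  let Ω : ℂ := (L.conf x : ℂ)
  let σ : ℂ := (L.sig x : ℂ)
  let s : Fin 4 → ℂ := fun a => (L.sigLow x a : ℂ)
  let sU : Fin 4 → ℂ := L.up x s
  let wp : Fin 4 → ℂ := L.wPerp x
  let wpU : Fin 4 → ℂ := L.up x wp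
  let EM : Fin 4 → Fin 4 → ℂ := L.mix x (L.calE x);
  -(1 / (2 * Y * φ)) *
    ((3 * σ * w - Ω * L.wPar x) *
        (6 * (∑ b, sU b * L.calE x c b) * w + 3 * s c * w ^ 2
          + 2 * Ω * (∑ b, L.calE x c b * wpU b) + Ω * w * wp c)
      + 6 * Complex.I * Ω * (∑ b, ∑ a, ∑ d,
          (L.eps x c b a : ℂ) * sU b * EM d a * w * wpU d)
      + 2 * Complex.I * ∑ d, ∑ a, ∑ b, (L.eps x c d a : ℂ) * EM b a *
          (Ω ^ 2 * wpU b * wpU d + 3 * sU b * w * (3 * sU d * w + Ω * wpU d)))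

/-- The tensor `Q_{ac}`, given by the formula for `φ Q_{ac}`. -/
noncomputable def tensorQ (x : R4) (φ : ℂ) (a c : Fin 4) : ℂ :=
  let w : ℂ := L.sw x
  let Ω : ℂ := (L.conf x : ℂ)
  let σ : ℂ := (L.sig x : ℂ)
  let s : Fin 4 → ℂ := fun a => (L.sigLow x a : ℂ)
  let sU : Fin 4 → ℂ := L.up x s
  let wp : Fin 4 → ℂ := L.wPerp x
  let wpU : Fin 4 → ℂ := L.up x wp
  let E : Fin 4 → Fin 4 → ℂ := L.calE x
  let EM : Fin 4 → Fin 4 → ℂ := L.mix x E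
  let EU : Fin 4 → Fin 4 → ℂ := L.up2 x E
  let H : Fin 4 → Fin 4 → ℂ := fun i j => (L.h x i j : ℂ)
  let HM : Fin 4 → Fin 4 → ℂ := fun i j => (L.hMix x i j : ℂ)
  let HU : Fin 4 → Fin 4 → ℂ := fun i j => (L.hUp x i j : ℂ)
  1 / φ *
    (1 / 2 * Ω ^ 4 * (2 * E a c + H a c * w) * (-3 * σ * w + Ω * L.wPar x) ^ 2
      - Complex.I * Ω ^ 4 * (∑ b, ∑ d,
          ((L.eps x c b d : ℂ) * EM a d + (L.eps x a b d : ℂ) * EM c d)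
            * (-3 * σ * w + Ω * L.wPar x) * (3 * sU b * w + Ω * wpU b))
      + ∑ b, ∑ d,
          (HU b d * E a c - HM c b * EM a d - HM a d * EM c b
              + 1 / 2 * HM a d * HM c b * w + H a c * (EU b d - 1 / 2 * HU b d * w))
            * (3 * Ω ^ 2 * s b * w + Ω ^ 3 * wp b)
            * (3 * Ω ^ 2 * s d * w + Ω ^ 3 * wp d))

end LocalFields

/-! ### Fields on a four-dimensional manifold and their components in charts -/

section Manifold

variable {M : Type*} [TopologicalSpace M] [ChartedSpace R4 M]

/-- The point of the manifold with coordinates `x` in the preferred chart at `p`. -/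
noncomputable def pt (p : M) (x : R4) : M := (extChartAt (𝓡 4) p).symm x

/-- The coordinates of `p` in the preferred chart at `p`. -/
noncomputable def coord (p : M) : R4 := extChartAt (𝓡 4) p p

/-- The coordinate vector field `∂_i` of the preferred chart at `p`, at the point with
coordinates `x`. -/
noncomputable def frame (p : M) (x : R4) (i : Fin 4) : TangentSpace (𝓡 4) (pt p x) :=
  mfderiv 𝓘(ℝ, R4) (𝓡 4) (pt p) x
    ((NormedSpace.fromTangentSpace (𝕜 := ℝ) x).symm (EuclideanSpace.single i 1))

/-- The coordinates, in the preferred chart at `p`, of the points of `U`. -/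
def chartDomain (U : Set M) (p : M) : Set R4 :=
  (extChartAt (𝓡 4) p).target ∩ pt p ⁻¹' U

variable (M) in
/-- A field of bilinear forms on the tangent spaces. -/
abbrev BilinField := ∀ x : M, TangentSpace (𝓡 4) x →ₗ[ℝ] TangentSpace (𝓡 4) x →ₗ[ℝ] ℝ

variable (M) in
/-- A field of alternating 4-forms on the tangent spaces. -/
abbrev FourForm := ∀ x : M, TangentSpace (𝓡 4) x [⋀^Fin 4]→ₗ[ℝ] ℝ

variable (M) in
/-- A vector field. -/
abbrev VecField := ∀ x : M, TangentSpace (𝓡 4) x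

variable (M) in
/-- A complex covector field. -/
abbrev CovecField := ∀ x : M, TangentSpace (𝓡 4) x →ₗ[ℝ] ℂ

/-- Components `g_{ij}` in the preferred chart at `p`. -/
noncomputable def metricComp (g : BilinField M) (p : M) (x : R4) : Matrix (Fin 4) (Fin 4) ℝ :=
  Matrix.of fun i j => g (pt p x) (frame p x i) (frame p x j)

/-- Components `η_{ijkl}` in the preferred chart at `p`. -/
noncomputable def volComp (vol : FourForm M) (p : M) (x : R4) (i j k l : Fin 4) : ℝ :=
  vol (pt p x) ![frame p x i, frame p x j, frame p x k, frame p x l]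

/-- Covariant components `n_i = g(n, ∂_i)` in the preferred chart at `p`. -/
noncomputable def normalComp (g : BilinField M) (n : VecField M) (p : M) (x : R4) (i : Fin 4) : ℝ :=
  g (pt p x) (n (pt p x)) (frame p x i)

/-- Components of a covector field, at the point `p`, in the preferred chart at `p`. -/
noncomputable def covecComp (θ : CovecField M) (p : M) (i : Fin 4) : ℂ :=
  θ (pt p (coord p)) (frame p (coord p) i)

/-- `g` is a smooth Lorentzian metric of signature `(-,+,+,+)` on the open set `U`. -/
structure IsLorentzMetricOn (U : Set M) (g : BilinField M) : Prop where
  symm : ∀ x ∈ U, ∀ u v, g x u v = g x v u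
  signature : ∀ x ∈ U, ∃ e : Module.Basis (Fin 4) ℝ (TangentSpace (𝓡 4) x),
    ∀ i j, g x (e i) (e j) = if i = j then (if i = 0 then -1 else 1) else 0
  smooth : ∀ p : M, ∀ i j, ContDiffOn ℝ ∞ (fun x => metricComp g p x i j) (chartDomain U p)

/-- `vol` is a smooth volume element of the Lorentzian metric `g` on `U`: an alternating 4-form whose
value on four vectors squares to minus their Gram determinant (so it is `±1` on orthonormal
frames). -/
structure IsVolumeElementOn (U : Set M) (g : BilinField M) (vol : FourForm M) : Prop where
  sq : ∀ x ∈ U, ∀ v : Fin 4 → TangentSpace (𝓡 4) x,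
    vol x v ^ 2 = -(Matrix.of fun i j => g x (v i) (v j)).det
  smooth : ∀ p : M, ∀ i j k l, ContDiffOn ℝ ∞ (fun x => volComp vol p x i j k l) (chartDomain U p)

/-- `n` is a smooth unit timelike vector field orthogonal to the leaves `{τ = const}` of the foliation
given by the smooth function `τ`.  (The other conditions force `dτ ≠ 0`, and the leaves are
spacelike.) -/
structure IsFoliationNormal (g : BilinField M) (τ : M → ℝ) (n : VecField M) : Prop where
  smooth_fun : ContMDiff (𝓡 4) 𝓘(ℝ, ℝ) ∞ τ
  smooth : ∀ p : M, ∀ i, ContDiffOn ℝ ∞ (fun x => normalComp g n p x i) (chartDomain Set.univ p)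
  unit : ∀ x, g x (n x) (n x) = -1
  orthogonal : ∀ x, ∀ v : TangentSpace (𝓡 4) x,
    mvfderiv (𝓡 4) τ x v = 0 → g x (n x) v = 0

/-- `R_{ab} = lam g_{ab}` on `U`, in every preferred chart. -/
def IsEinsteinOn (U : Set M) (g : BilinField M) (lam : ℝ) : Prop :=
  ∀ p : M, ∀ x ∈ chartDomain U p, ∀ i j,
    ricci (metricComp g p) x i j = lam * metricComp g p x i j

/-- The components of the unphysical fields in the preferred chart at `p`. -/
noncomputable def localFields (g : BilinField M) (vol : FourForm M) (Θ : M → ℝ) (n : VecField M)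
    (p : M) : LocalFields where
  metric := metricComp g p
  vol := volComp vol p
  conf := fun x => Θ (pt p x)
  normal := normalComp g n p

end Manifold

end TypeDData

open TypeDData

/-!
All statements are local and pointwise, so they are proved for the components of the fields in a
coordinate chart, and at one point in an orthonormal frame whose timelike vector is the unit normal
`n` (`OrthFrame`, `AdaptedFrame`, `exists_orthFrame`).  Frames are allowed to be complex, which makes
their existence a matter of diagonalizing a symmetric form; only the orthogonality relations are ever
used.

*Algebra.*  Let `T¹, T², T³` be the self-dual bivectors of such a frame.  The self-dual part of a
tensor of Weyl type is `∑ E_{kl} Tᵏ ⊗ Tˡ` for a symmetric trace-free matrix `E`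
(`OrthFrame.selfDual_bv_eq`), and `𝒢 = -(1/2) ∑ Tᵏ ⊗ Tᵏ` (`OrthFrame.calG_bv_eq`).  In these terms `E`
is the electric part `ℰ`, and the scalars are traces, `a = 16 tr E²` and `b = -64 tr E³`.

*Removal of the conformal factor.*  The Weyl tensor is conformally invariant
(`ConformalPair.weyl_eq`), so the physical scalar is `w̃ = Θ³ w` and
`∇w̃ = Θ² Z` with `Z = 3 w ∇Θ + Θ ∇w`.  Hence `Ξ̃_{ac} = Θ⁷ (𝔡_{apcq} - w 𝒢_{apcq}) Z^p Z^q`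
(`VacuumFields.physXi_eq`), while the choice of the cube roots gives `φ̃ = Θ¹¹ φ`.  The powers of `Θ`
cancel against those in the splitting of `η̃`, and what is left is the equation
`(𝔡_{apcq} - w 𝒢_{apcq}) Z^p Z^q = φ (Y n_a + Y_a) (Y n_c + Y_c)` between unphysical quantities.

*The three conditions.*  With `A = E + w / 2` the left hand side is `∑ A_{kl} (Tᵏ Z) (Tˡ Z)`, and each
covector `Tᵏ Z` splits into a multiple of the normal and a spatial covector
(`AdaptedFrame.sdBiv_contract`).  If the spatial part of `Z` is `3 w σ_a + Ω w^⊥_a` and its normal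
part is `-3 w σ + Ω w^∥`, the normal-normal, normal-spatial and spatial-spatial projections of the
equation, divided by `φ`, by `φ Y` and by `φ`, are the conditions on `Y²`, on `Y_c` and on `Y_a Y_b`
(`AdaptedFrame.xiForm_eq_iff`).

*The normal derivative of `w`.*  That `w^⊥` is the spatial gradient of `w = -b / (2 a)` is the quotient
rule.  The point which is not algebraic is that `w^∥`, an expression in the extrinsic curvature and
the intrinsic derivatives of `ℰ`, is minus the normal derivative of `w` (`AdaptedFrame.wPar_eq`).  It
holds because `d_{abcd} = C_{abcd} / Θ` is divergence-free (`ConformalPair.div31_resWeyl`): the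
contracted Bianchi identity says so for the Weyl tensor of the Einstein metric `g̃`, and the
divergence of a tensor of Weyl type changes under a conformal change of the metric by a term which
the factor `1 / Θ` absorbs.  The volume element being covariantly constant
(`SmoothVolume.nabla4_eq_zero`) and the left and right duals of a tensor of Weyl type being equal
(`OrthFrame.dual_comm`), `𝔡` is divergence-free too, so its normal derivative is a curl of its
derivatives along the leaf (`AdaptedFrame.normal_deriv_eq`).  These differ from the intrinsic
derivatives of `ℰ` by terms with the extrinsic curvature, which come from differentiating the normal
(`VacuumFields.nablaE_eq`, `AdaptedFrame.sum_nablaE`).  That all terms with the extrinsic curvature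
then match is an identity for trace-free symmetric `3 × 3` matrices, in which the Cayley–Hamilton
theorem reduces the powers of `E` (`evolution_identity`).
-/

namespace TypeDData

open Matrix
open scoped Kronecker

/-! ### Levi-Civita symbols and tensors of Weyl type in an orthonormal frame -/

/-- The Levi-Civita symbol on three indices. -/
def lc3 (i j k : Fin 3) : ℤ :=
  Int.sign ((j.val : ℤ) - i.val) * Int.sign ((k.val : ℤ) - i.val) * Int.sign ((k.val : ℤ) - j.val)

/-- The Levi-Civita symbol on four indices. -/
def lc4 (i j k l : Fin 4) : ℤ :=
  Int.sign ((j.val : ℤ) - i.val) * Int.sign ((k.val : ℤ) - i.val) * Int.sign ((l.val : ℤ) - i.val) *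
    (Int.sign ((k.val : ℤ) - j.val) * Int.sign ((l.val : ℤ) - j.val) *
      Int.sign ((l.val : ℤ) - k.val))

/-- A covariant tensor of rank four, over `ℂ`. -/
abbrev Tensor4 := Fin 4 → Fin 4 → Fin 4 → Fin 4 → ℂ

/-- The matrix of a tensor of rank four, its first two and last two slots being paired. -/
def bv (T : Tensor4) : Matrix (Fin 4 × Fin 4) (Fin 4 × Fin 4) ℂ :=
  Matrix.of fun i j => T i.1 i.2 j.1 j.2

/-- The components `diag(-1, 1, 1, 1)` of a Lorentzian metric in an orthonormal frame. -/
def mink : Matrix (Fin 4) (Fin 4) ℂ := Matrix.diagonal ![-1, 1, 1, 1]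

/-- The algebraic symmetries of the Weyl tensor; the trace is taken with the contravariant
metric `Gi`. -/
structure WeylSymm (Gi : Matrix (Fin 4) (Fin 4) ℂ) (T : Tensor4) : Prop where
  antisymm : ∀ a b c d, T b a c d = -T a b c d
  pair : ∀ a b c d, T c d a b = T a b c d
  cyclic : ∀ a b c d, T a b c d + T b c a d + T c a b d = 0
  trace : ∀ a c, ∑ b, ∑ d, Gi b d * T a b c d = 0

lemma WeylSymm.antisymm_right {Gi : Matrix (Fin 4) (Fin 4) ℂ} {T : Tensor4} (h : WeylSymm Gi T)
    (a b c d : Fin 4) : T a b d c = -T a b c d := by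
  rw [← h.pair, h.antisymm, h.pair]

/-- The components of the bivectors `e⁰ ∧ eᵏ` of an orthonormal coframe. -/
def elecZ : Fin 3 → Matrix (Fin 4) (Fin 4) ℤ :=
  ![!![0, 1, 0, 0; -1, 0, 0, 0; 0, 0, 0, 0; 0, 0, 0, 0],
    !![0, 0, 1, 0; 0, 0, 0, 0; -1, 0, 0, 0; 0, 0, 0, 0],
    !![0, 0, 0, 1; 0, 0, 0, 0; 0, 0, 0, 0; -1, 0, 0, 0]]

/-- The components of the bivectors `(1/2) ε_{klm} eˡ ∧ eᵐ` of an orthonormal coframe. -/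
def magZ : Fin 3 → Matrix (Fin 4) (Fin 4) ℤ :=
  ![!![0, 0, 0, 0; 0, 0, 0, 0; 0, 0, 0, 1; 0, 0, -1, 0],
    !![0, 0, 0, 0; 0, 0, 0, -1; 0, 0, 0, 0; 0, 1, 0, 0],
    !![0, 0, 0, 0; 0, 0, 1, 0; 0, -1, 0, 0; 0, 0, 0, 0]]

/-- The matrix whose rows are the bivectors `e⁰ ∧ eᵏ`. -/
def elecBiv : Matrix (Fin 3) (Fin 4 × Fin 4) ℂ := Matrix.of fun k p => (elecZ k p.1 p.2 : ℂ)

/-- The matrix whose rows are the bivectors `(1/2) ε_{klm} eˡ ∧ eᵐ`. -/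
def magBiv : Matrix (Fin 3) (Fin 4 × Fin 4) ℂ := Matrix.of fun k p => (magZ k p.1 p.2 : ℂ)

/-- The index pairs `(2,3), (3,1), (1,2)`. -/
def magIdx : Fin 3 → Fin 4 × Fin 4 := ![(2, 3), (3, 1), (1, 2)]

/-- The bivectors `e⁰ ∧ eᵏ` and `(1/2) ε_{klm} eˡ ∧ eᵐ` span the antisymmetric tensors. -/
lemma antisymm_eq_sum_biv (v : Fin 4 → Fin 4 → ℂ) (h : ∀ a b, v b a = -v a b) (a b : Fin 4) :
    v a b = ∑ k, v 0 k.succ * elecBiv k (a, b)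
      + ∑ k, v (magIdx k).1 (magIdx k).2 * magBiv k (a, b) := by
  have hd : ∀ a, v a a = 0 := fun a => by
    have := h a a
    have h2 : (2 : ℂ) * v a a = 0 := by linear_combination this
    simpa using h2
  fin_cases a <;> fin_cases b <;>
    simp [Fin.sum_univ_three, elecBiv, magBiv, elecZ, magZ, magIdx, hd] <;> exact h _ _

/-- A tensor of Weyl type is determined by its electric part `e` and its magnetic part `b`. -/
lemma WeylSymm.bv_eq {T : Tensor4} (h : WeylSymm mink T) :
    ∃ e b : Matrix (Fin 3) (Fin 3) ℂ, eᵀ = e ∧ bᵀ = b ∧ e.trace = 0 ∧ b.trace = 0 ∧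
      bv T = elecBivᵀ * e * elecBiv + elecBivᵀ * b * magBiv + magBivᵀ * b * elecBiv
        - magBivᵀ * e * magBiv := by
  set e : Matrix (Fin 3) (Fin 3) ℂ := Matrix.of fun i j => T 0 i.succ 0 j.succ with he
  set b : Matrix (Fin 3) (Fin 3) ℂ :=
    Matrix.of fun i j => T 0 i.succ (magIdx j).1 (magIdx j).2 with hb
  have hr := h.antisymm_right
  have hl := h.antisymm
  have hp := h.pair
  have htr : ∀ a c, -T a 0 c 0 + T a 1 c 1 + T a 2 c 2 + T a 3 c 3 = 0 := fun a c => by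
    simpa [mink, Matrix.diagonal_apply, Fin.sum_univ_four] using h.trace a c
  have hz : ∀ a c d, T a a c d = 0 := fun a c d => by
    have := hl a a c d
    have h2 : (2 : ℂ) * T a a c d = 0 := by linear_combination this
    simpa using h2
  have hz' : ∀ a c d, T c d a a = 0 := fun a c d => by rw [← hp, hz]
  have hbs : bᵀ = b := by
    ext i j
    fin_cases i <;> fin_cases j <;> simp [hb, magIdx]
    all_goals grind
  have hc : ∀ i j, T (magIdx i).1 (magIdx i).2 (magIdx j).1 (magIdx j).2 = -e i j := by
    intro i j
    fin_cases i <;> fin_cases j <;> simp [he, magIdx]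
    all_goals grind
  refine ⟨e, b, ?_, hbs, ?_, ?_, ?_⟩
  · ext i j
    simp [he, hp]
  · have := htr 0 0
    simp [hz] at this
    simp [Matrix.trace, Fin.sum_univ_three, he]
    linear_combination this
  · have := h.cyclic 1 2 3 0
    simp [Matrix.trace, Fin.sum_univ_three, hb, magIdx]
    linear_combination -this + hp 3 0 1 2 + hp 1 0 2 3 + hp 2 0 3 1 + hl 0 3 1 2 + hl 0 1 2 3
      + hl 0 2 3 1
  · ext ⟨i, j⟩ ⟨k, l⟩
    have h1 := fun k l => antisymm_eq_sum_biv (fun a b => T a b k l) (fun a b => hl a b k l) i j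
    have h2 := fun i j => antisymm_eq_sum_biv (fun a b => T i j a b) (fun a b => hr i j a b) k l
    have hb' : ∀ i j, T (magIdx i).1 (magIdx i).2 0 (Fin.succ j) = b i j := by
      intro i j
      rw [hp, ← hbs]; rfl
    have h0 : bv T (i, j) (k, l) = T i j k l := rfl
    rw [h0, h1]
    beta_reduce at h2 ⊢
    simp only [h2 0 _, h2 (magIdx _).1 _, hb', hc, Matrix.sub_apply, Matrix.add_apply,
      Matrix.mul_apply, Matrix.transpose_apply]
    simp only [Fin.sum_univ_three, he, hb, of_apply]
    ring

/-- The matrix of the Levi-Civita symbol. -/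
def lcMat : Matrix (Fin 4 × Fin 4) (Fin 4 × Fin 4) ℂ := bv fun a b c d => (lc4 a b c d : ℂ)

lemma lcMat_eq : lcMat = elecBivᵀ * magBiv + magBivᵀ * elecBiv := by
  have h : ∀ a b c d, lc4 a b c d = ∑ k, elecZ k a b * magZ k c d
      + ∑ k, magZ k a b * elecZ k c d := by decide +kernel
  ext ⟨a, b⟩ ⟨c, d⟩
  simp only [lcMat, bv, elecBiv, magBiv, Matrix.add_apply, Matrix.mul_apply, Matrix.transpose_apply,
    Matrix.of_apply]
  exact_mod_cast h a b c d

/-- Integer version of `mink`, for computations. -/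
def minkZ (a b : Fin 4) : ℤ := if a = b then (if a = 0 then -1 else 1) else 0

lemma mink_apply (a b : Fin 4) : mink a b = (minkZ a b : ℂ) := by
  fin_cases a <;> fin_cases b <;> simp [mink, minkZ]

lemma mink_wedge (a b c d : Fin 4) : mink a c * mink b d - mink a d * mink b c =
    (magBivᵀ * magBiv - elecBivᵀ * elecBiv) (a, b) (c, d) := by
  have h : ∀ a b c d, minkZ a c * minkZ b d - minkZ a d * minkZ b c =
      ∑ k, magZ k a b * magZ k c d - ∑ k, elecZ k a b * elecZ k c d := by
    decide +kernel
  simp only [elecBiv, magBiv, Matrix.sub_apply, Matrix.mul_apply, Matrix.transpose_apply,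
    Matrix.of_apply, mink_apply]
  exact_mod_cast h a b c d

lemma mink_kronecker : mink ⊗ₖ mink =
    Matrix.diagonal fun p : Fin 4 × Fin 4 => ((minkZ p.1 p.1 * minkZ p.2 p.2 : ℤ) : ℂ) := by
  have h : mink = Matrix.diagonal fun a => (minkZ a a : ℂ) := by
    ext a b
    fin_cases a <;> fin_cases b <;> simp [mink, minkZ]
  rw [h, Matrix.diagonal_kronecker_diagonal]
  simp

lemma elecBiv_dual : elecBiv * (mink ⊗ₖ mink) * lcMatᵀ = (-2 : ℂ) • magBiv := by
  have h : ∀ k c d, ∑ e, ∑ f, elecZ k e f * (minkZ e e * minkZ f f) * lc4 c d e f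
      = -2 * magZ k c d := by decide +kernel
  ext k ⟨c, d⟩
  rw [mink_kronecker, Matrix.mul_apply, Fintype.sum_prod_type]
  simp only [Matrix.mul_diagonal, lcMat, bv, elecBiv, magBiv, Matrix.transpose_apply,
    Matrix.of_apply, Matrix.smul_apply, smul_eq_mul]
  exact_mod_cast h k c d

lemma magBiv_dual : magBiv * (mink ⊗ₖ mink) * lcMatᵀ = (2 : ℂ) • elecBiv := by
  have h : ∀ k c d, ∑ e, ∑ f, magZ k e f * (minkZ e e * minkZ f f) * lc4 c d e f
      = 2 * elecZ k c d := by decide +kernel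
  ext k ⟨c, d⟩
  rw [mink_kronecker, Matrix.mul_apply, Fintype.sum_prod_type]
  simp only [Matrix.mul_diagonal, lcMat, bv, elecBiv, magBiv, Matrix.transpose_apply,
    Matrix.of_apply, Matrix.smul_apply, smul_eq_mul]
  exact_mod_cast h k c d

/-- The basis `e⁰ ∧ eᵏ + (i s / 2) ε_{klm} eˡ ∧ eᵐ` of the self-dual bivectors of an orthonormal
coframe; the sign `s` is the orientation of the coframe. -/
def sdBivFlat (s : ℂ) : Matrix (Fin 3) (Fin 4 × Fin 4) ℂ := elecBiv + (Complex.I * s) • magBiv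

/-- The self-dual bivectors are orthogonal and of length `-4`, for the metric on all ordered pairs of
indices. -/
lemma sdBivFlat_orthogonal {s : ℂ} (hs : s ^ 2 = 1) :
    sdBivFlat s * (mink ⊗ₖ mink) * (sdBivFlat s)ᵀ = (-4 : ℂ) • (1 : Matrix (Fin 3) (Fin 3) ℂ) := by
  have h : ∀ k l, ∑ e, ∑ f, elecZ k e f * (minkZ e e * minkZ f f) * elecZ l e f
      = -2 * (1 : Matrix (Fin 3) (Fin 3) ℤ) k l := by decide +kernel
  have h' : ∀ k l, ∑ e, ∑ f, elecZ k e f * (minkZ e e * minkZ f f) * magZ l e f = 0 := by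
    decide +kernel
  have h'' : ∀ k l, ∑ e, ∑ f, magZ k e f * (minkZ e e * minkZ f f) * magZ l e f
      = 2 * (1 : Matrix (Fin 3) (Fin 3) ℤ) k l := by decide +kernel
  have key (X Y : Fin 3 → Matrix (Fin 4) (Fin 4) ℤ) :
      (Matrix.of fun k p => (X k p.1 p.2 : ℂ) : Matrix (Fin 3) (Fin 4 × Fin 4) ℂ) * (mink ⊗ₖ mink)
        * (Matrix.of fun k p => (Y k p.1 p.2 : ℂ) : Matrix (Fin 3) (Fin 4 × Fin 4) ℂ)ᵀ
      = (Matrix.of fun k l => ∑ e, ∑ f, X k e f * (minkZ e e * minkZ f f) * Y l e f).map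
          (Int.cast : ℤ → ℂ) := by
    ext k l
    rw [mink_kronecker, Matrix.mul_apply, Fintype.sum_prod_type]
    simp [Matrix.mul_diagonal]
  have h1 : elecBiv * (mink ⊗ₖ mink) * elecBivᵀ = (-2 : ℂ) • 1 := by
    rw [elecBiv, key]; ext k l
    simp [h, Matrix.one_apply]
  have h2 : elecBiv * (mink ⊗ₖ mink) * magBivᵀ = 0 := by
    rw [elecBiv, magBiv, key]; ext k l
    simp only [h']; simp
  have h3 : magBiv * (mink ⊗ₖ mink) * magBivᵀ = (2 : ℂ) • 1 := by
    rw [magBiv, key]; ext k l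
    simp [h'', Matrix.one_apply]
  have h4 : magBiv * (mink ⊗ₖ mink) * elecBivᵀ = 0 := by
    have := congrArg Matrix.transpose h2
    rw [Matrix.transpose_mul, Matrix.transpose_mul, Matrix.transpose_transpose, mink_kronecker,
      Matrix.diagonal_transpose, ← mink_kronecker, ← Matrix.mul_assoc] at this
    simpa using this
  have hI : Complex.I * s * (Complex.I * s) = -1 := by
    linear_combination s ^ 2 * Complex.I_sq - hs
  simp only [sdBivFlat, Matrix.transpose_add, Matrix.transpose_smul, Matrix.add_mul, Matrix.mul_add,
    Matrix.smul_mul, Matrix.mul_smul, h1, h2, h3, h4, smul_zero, smul_smul, zero_add, add_zero,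
    ← mul_assoc]
  rw [← add_smul]
  congr 1
  linear_combination 2 * hI

/-- The self-dual part of a tensor of Weyl type is a symmetric trace-free form in the self-dual
bivectors. -/
lemma WeylSymm.selfDual_bv_eq {T : Tensor4} (h : WeylSymm mink T) {s : ℂ} (hs : s ^ 2 = 1) :
    ∃ E : Matrix (Fin 3) (Fin 3) ℂ, Eᵀ = E ∧ E.trace = 0 ∧
      (1 / 2 : ℂ) • (bv T - (Complex.I / 2 * s) • (bv T * (mink ⊗ₖ mink) * lcMatᵀ))
        = (sdBivFlat s)ᵀ * E * sdBivFlat s := by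
  obtain ⟨e, b, he, hb, he', hb', hT⟩ := h.bv_eq
  refine ⟨(1 / 2 : ℂ) • (e - (Complex.I * s) • b), by simp [he, hb], by simp [he', hb'], ?_⟩
  have hd : bv T * (mink ⊗ₖ mink) * lcMatᵀ = (-2 : ℂ) • (elecBivᵀ * e * magBiv)
      + (2 : ℂ) • (elecBivᵀ * b * elecBiv) - (2 : ℂ) • (magBivᵀ * b * magBiv)
        - (2 : ℂ) • (magBivᵀ * e * elecBiv) := by
    rw [hT]
    simp only [Matrix.add_mul, Matrix.sub_mul, Matrix.mul_assoc]
    simp only [← Matrix.mul_assoc _ _ lcMatᵀ, elecBiv_dual, magBiv_dual, Matrix.mul_smul]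
    module
  have hI : Complex.I * s * (Complex.I * s) = -1 := by
    linear_combination s ^ 2 * Complex.I_sq - hs
  rw [hd, hT, sdBivFlat]
  simp only [Matrix.transpose_add, Matrix.transpose_smul, Matrix.add_mul, Matrix.mul_add,
    Matrix.mul_sub, Matrix.sub_mul, Matrix.smul_mul, Matrix.mul_smul, smul_add, smul_sub, smul_smul]
  have hI' := Complex.I_sq
  match_scalars <;> grind

/-- For a tensor of Weyl type the left and the right dual agree. -/
lemma WeylSymm.dual_comm {T : Tensor4} (h : WeylSymm mink T) :
    bv T * (mink ⊗ₖ mink) * lcMatᵀ = lcMat * (mink ⊗ₖ mink) * bv T := by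
  obtain ⟨e, b, he, hb, he', hb', hT⟩ := h.bv_eq
  have hk : (mink ⊗ₖ mink)ᵀ = mink ⊗ₖ mink := by
    rw [mink_kronecker, Matrix.diagonal_transpose]
  have h1 := congrArg Matrix.transpose elecBiv_dual
  have h2 := congrArg Matrix.transpose magBiv_dual
  simp only [Matrix.transpose_mul, Matrix.transpose_transpose, hk, Matrix.transpose_smul] at h1 h2
  rw [hT]
  simp only [Matrix.add_mul, Matrix.sub_mul, Matrix.mul_add, Matrix.mul_sub, Matrix.mul_assoc]
  simp only [← Matrix.mul_assoc _ _ lcMatᵀ, elecBiv_dual, magBiv_dual, Matrix.mul_smul]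
  simp only [← Matrix.mul_assoc] at h1 h2 ⊢
  simp only [h1, h2, Matrix.smul_mul]
  module

/-! ### Tensors of Weyl type in general coordinates -/

lemma sum_rotate {ι : Type*} [Fintype ι] (f : ι → ι → ι → ℂ) :
    ∑ a, ∑ b, ∑ c, f a b c = ∑ a, ∑ b, ∑ c, f b c a := by
  rw [Finset.sum_comm]
  conv_rhs => rw [Finset.sum_comm]; enter [2, x]; rw [Finset.sum_comm]
  conv_rhs => rw [Finset.sum_comm]

/-- Two square matrices contracted entrywise, under a change of basis. -/
lemma sum_mul_congr {m n : Type} [Fintype m] [Fintype n] (N : Matrix n n ℂ) (P : Matrix m n ℂ)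
    (M : Matrix m m ℂ) :
    ∑ j, ∑ l, N j l * (Pᵀ * M * P) j l = ∑ b, ∑ d, (P * N * Pᵀ) b d * M b d := by
  have h (k : Type) [Fintype k] (A B : Matrix k k ℂ) :
      ∑ j, ∑ l, A j l * B j l = (A * Bᵀ).trace := by
    simp [Matrix.trace, Matrix.mul_apply]
  rw [h, h, Matrix.transpose_mul, Matrix.transpose_mul, Matrix.transpose_transpose,
    Matrix.mul_assoc P, Matrix.mul_assoc P, Matrix.trace_mul_comm P]
  simp only [Matrix.mul_assoc]

/-- Components of a covariant tensor in the frame formed by the columns of `P`. -/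
def toFrame (P : Matrix (Fin 4) (Fin 4) ℂ) (T : Tensor4) : Tensor4 := fun i j k l =>
  ∑ a, ∑ b, ∑ c, ∑ d, P a i * P b j * P c k * P d l * T a b c d

lemma bv_toFrame (P : Matrix (Fin 4) (Fin 4) ℂ) (T : Tensor4) :
    bv (toFrame P T) = (P ⊗ₖ P)ᵀ * bv T * (P ⊗ₖ P) := by
  ext ⟨i, j⟩ ⟨k, l⟩
  simp only [bv, toFrame, Matrix.of_apply, Matrix.mul_apply, Matrix.transpose_apply,
    Matrix.kroneckerMap_apply, Fintype.sum_prod_type, Finset.sum_mul]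
  conv_rhs => enter [2, c]; rw [Finset.sum_comm]; enter [2, a]; rw [Finset.sum_comm]
  rw [Finset.sum_comm]
  conv_rhs => rw [Finset.sum_comm]; enter [2, a]; rw [Finset.sum_comm]
  rw [Finset.sum_comm]
  exact Finset.sum_congr rfl fun a _ => Finset.sum_congr rfl fun b _ =>
    Finset.sum_congr rfl fun c _ => Finset.sum_congr rfl fun d _ => by ring

/-- An orthonormal coframe (the rows of `Q`) and the dual frame (the columns of `P`) for the metric
`G` with inverse `Gi`, in which the volume element is `s` times the Levi-Civita symbol.  The frame
is allowed to be complex, so that one exists for every nondegenerate metric. -/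
structure OrthFrame (G Gi : Matrix (Fin 4) (Fin 4) ℂ) (vol : Tensor4)
    (P Q : Matrix (Fin 4) (Fin 4) ℂ) (s : ℂ) : Prop where
  mul_eq_one : Q * P = 1
  metric : G = Qᵀ * mink * Q
  inv : Gi = P * mink * Pᵀ
  sq : s ^ 2 = 1
  vol_eq : bv vol = s • ((Q ⊗ₖ Q)ᵀ * lcMat * (Q ⊗ₖ Q))

/-- The components of the self-dual bivectors of an orthonormal coframe. -/
def sdBiv (Q : Matrix (Fin 4) (Fin 4) ℂ) (s : ℂ) : Matrix (Fin 3) (Fin 4 × Fin 4) ℂ :=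
  sdBivFlat s * (Q ⊗ₖ Q)

namespace OrthFrame

variable {G Gi : Matrix (Fin 4) (Fin 4) ℂ} {vol : Tensor4} {P Q : Matrix (Fin 4) (Fin 4) ℂ} {s : ℂ}

lemma mul_eq_one' (h : OrthFrame G Gi vol P Q s) : P * Q = 1 :=
  mul_eq_one_comm.mp h.mul_eq_one

lemma kron_mul (h : OrthFrame G Gi vol P Q s) : (P ⊗ₖ P) * (Q ⊗ₖ Q) = 1 := by
  rw [← Matrix.mul_kronecker_mul, h.mul_eq_one', Matrix.one_kronecker_one]

lemma kron_mul' (h : OrthFrame G Gi vol P Q s) : (Q ⊗ₖ Q) * (P ⊗ₖ P) = 1 :=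
  mul_eq_one_comm.mp h.kron_mul

lemma kron_inv (h : OrthFrame G Gi vol P Q s) :
    Gi ⊗ₖ Gi = (P ⊗ₖ P) * (mink ⊗ₖ mink) * (P ⊗ₖ P)ᵀ := by
  rw [h.inv, Matrix.mul_kronecker_mul, Matrix.mul_kronecker_mul, ← Matrix.kroneckerMap_transpose]

lemma inv_transpose (h : OrthFrame G Gi vol P Q s) : Giᵀ = Gi := by
  have : minkᵀ = mink := by rw [mink, Matrix.diagonal_transpose]
  rw [h.inv, Matrix.transpose_mul, Matrix.transpose_mul, Matrix.transpose_transpose, this,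
    Matrix.mul_assoc]

lemma weylSymm_toFrame (h : OrthFrame G Gi vol P Q s) {T : Tensor4} (hT : WeylSymm Gi T) :
    WeylSymm mink (toFrame P T) where
  antisymm i j k l := by
    simp only [toFrame]
    rw [Finset.sum_comm, ← Finset.sum_neg_distrib]
    refine Finset.sum_congr rfl fun a _ => ?_
    rw [← Finset.sum_neg_distrib]
    refine Finset.sum_congr rfl fun b _ => ?_
    simp only [← Finset.sum_neg_distrib]
    refine Finset.sum_congr rfl fun c _ => Finset.sum_congr rfl fun d _ => ?_
    rw [hT.antisymm]; ring
  pair i j k l := by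
    have h1 : bv (toFrame P T) (k, l) (i, j) = bv (toFrame P T) (i, j) (k, l) := by
      have hs : (bv T)ᵀ = bv T := by
        ext ⟨a, b⟩ ⟨c, d⟩
        exact hT.pair _ _ _ _
      have h2 : (bv (toFrame P T))ᵀ = bv (toFrame P T) := by
        rw [bv_toFrame, Matrix.transpose_mul, Matrix.transpose_mul, Matrix.transpose_transpose, hs,
          Matrix.mul_assoc]
      exact congrFun (congrFun h2 (i, j)) (k, l)
    exact h1
  cyclic i j k l := by
    simp only [toFrame]
    rw [sum_rotate fun a b c => ∑ d, P a j * P b k * P c i * P d l * T a b c d,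
      sum_rotate fun a b c => ∑ d, P a k * P b i * P c j * P d l * T a b c d,
      sum_rotate fun a b c => ∑ d, P b k * P c i * P a j * P d l * T b c a d]
    simp only [← Finset.sum_add_distrib]
    refine Finset.sum_eq_zero fun a _ => Finset.sum_eq_zero fun b _ =>
      Finset.sum_eq_zero fun c _ => Finset.sum_eq_zero fun d _ => ?_
    linear_combination P a i * P b j * P c k * P d l * hT.cyclic a b c d
  trace i k := by
    have h1 : ∀ j l, toFrame P T i j k l
        = (Pᵀ * (Matrix.of fun b d => ∑ a, ∑ c, P a i * P c k * T a b c d) * P) j l := by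
      intro j l
      simp only [toFrame, Matrix.mul_apply, Matrix.of_apply, Matrix.transpose_apply,
        Finset.mul_sum, Finset.sum_mul]
      rw [Finset.sum_comm]
      conv_rhs => rw [Finset.sum_comm]
      refine Finset.sum_congr rfl fun b _ => ?_
      conv_rhs => rw [Finset.sum_comm]
      refine Finset.sum_congr rfl fun a _ => ?_
      rw [Finset.sum_comm]
      exact Finset.sum_congr rfl fun d _ => Finset.sum_congr rfl fun c _ => by ring
    simp only [h1]
    rw [sum_mul_congr, ← h.inv]
    simp only [Matrix.of_apply, Finset.mul_sum]
    calc _ = ∑ a, ∑ c, P a i * P c k * ∑ b, ∑ d, Gi b d * T a b c d := by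
          simp only [Finset.mul_sum]
          conv_lhs => enter [2, b]; rw [Finset.sum_comm]; enter [2, a]; rw [Finset.sum_comm]
          rw [Finset.sum_comm]
          refine Finset.sum_congr rfl fun a _ => ?_
          rw [Finset.sum_comm]
          exact Finset.sum_congr rfl fun c _ => Finset.sum_congr rfl fun b _ =>
            Finset.sum_congr rfl fun d _ => by ring
      _ = 0 := by simp [hT.trace]

lemma bv_eq_of_toFrame (h : OrthFrame G Gi vol P Q s) (T : Tensor4) :
    bv T = (Q ⊗ₖ Q)ᵀ * bv (toFrame P T) * (Q ⊗ₖ Q) := by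
  have h1 : (Q ⊗ₖ Q)ᵀ * (P ⊗ₖ P)ᵀ = 1 := by
    rw [← Matrix.transpose_mul, h.kron_mul, Matrix.transpose_one]
  rw [bv_toFrame]
  calc bv T = ((Q ⊗ₖ Q)ᵀ * (P ⊗ₖ P)ᵀ) * bv T * ((P ⊗ₖ P) * (Q ⊗ₖ Q)) := by
        rw [h1, h.kron_mul, Matrix.one_mul, Matrix.mul_one]
    _ = _ := by simp only [Matrix.mul_assoc]

/-- In an orthonormal coframe the inverse metric on bivectors becomes `mink ⊗ₖ mink`. -/
lemma kron_inv_congr (h : OrthFrame G Gi vol P Q s) :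
    (Q ⊗ₖ Q) * (Gi ⊗ₖ Gi) * (Q ⊗ₖ Q)ᵀ = mink ⊗ₖ mink := by
  rw [h.kron_inv]
  calc _ = ((Q ⊗ₖ Q) * (P ⊗ₖ P)) * (mink ⊗ₖ mink) * ((Q ⊗ₖ Q) * (P ⊗ₖ P))ᵀ := by
        rw [Matrix.transpose_mul]; simp only [Matrix.mul_assoc]
    _ = _ := by rw [h.kron_mul', Matrix.transpose_one, Matrix.one_mul, Matrix.mul_one]

lemma dual_eq (h : OrthFrame G Gi vol P Q s) (T : Tensor4) :
    bv T * (Gi ⊗ₖ Gi) * (bv vol)ᵀ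
      = s • ((Q ⊗ₖ Q)ᵀ * (bv (toFrame P T) * (mink ⊗ₖ mink) * lcMatᵀ) * (Q ⊗ₖ Q)) := by
  rw [h.bv_eq_of_toFrame T, h.vol_eq, ← h.kron_inv_congr]
  simp only [Matrix.transpose_smul, Matrix.transpose_mul, Matrix.transpose_transpose,
    Matrix.mul_smul, Matrix.mul_assoc]

lemma dual_eq_left (h : OrthFrame G Gi vol P Q s) (T : Tensor4) :
    bv vol * (Gi ⊗ₖ Gi) * bv T
      = s • ((Q ⊗ₖ Q)ᵀ * (lcMat * (mink ⊗ₖ mink) * bv (toFrame P T)) * (Q ⊗ₖ Q)) := by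
  rw [h.bv_eq_of_toFrame T, h.vol_eq, ← h.kron_inv_congr]
  simp only [Matrix.smul_mul, Matrix.mul_assoc]

/-- For a tensor of Weyl type the left and the right dual agree. -/
lemma dual_comm (h : OrthFrame G Gi vol P Q s) {T : Tensor4} (hT : WeylSymm Gi T) :
    bv T * (Gi ⊗ₖ Gi) * (bv vol)ᵀ = bv vol * (Gi ⊗ₖ Gi) * bv T := by
  rw [h.dual_eq, h.dual_eq_left, (h.weylSymm_toFrame hT).dual_comm]

/-- The self-dual part of a tensor of Weyl type is a symmetric trace-free form in the self-dual
bivectors. -/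
lemma selfDual_bv_eq (h : OrthFrame G Gi vol P Q s) {T : Tensor4} (hT : WeylSymm Gi T) :
    ∃ E : Matrix (Fin 3) (Fin 3) ℂ, Eᵀ = E ∧ E.trace = 0 ∧
      (1 / 2 : ℂ) • (bv T - (Complex.I / 2) • (bv T * (Gi ⊗ₖ Gi) * (bv vol)ᵀ))
        = (sdBiv Q s)ᵀ * E * sdBiv Q s := by
  obtain ⟨E, h1, h2, h3⟩ := (h.weylSymm_toFrame hT).selfDual_bv_eq h.sq
  refine ⟨E, h1, h2, ?_⟩
  calc _ = (Q ⊗ₖ Q)ᵀ * ((1 / 2 : ℂ) • (bv (toFrame P T) - (Complex.I / 2 * s) •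
        (bv (toFrame P T) * (mink ⊗ₖ mink) * lcMatᵀ))) * (Q ⊗ₖ Q) := by
        rw [h.dual_eq, h.bv_eq_of_toFrame T]
        simp only [Matrix.mul_smul, Matrix.smul_mul, Matrix.mul_sub, Matrix.sub_mul, smul_smul]
    _ = _ := by
        rw [h3, sdBiv, Matrix.transpose_mul]
        simp only [Matrix.mul_assoc]

lemma sdBiv_orthogonal (h : OrthFrame G Gi vol P Q s) :
    sdBiv Q s * (Gi ⊗ₖ Gi) * (sdBiv Q s)ᵀ = (-4 : ℂ) • (1 : Matrix (Fin 3) (Fin 3) ℂ) := by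
  rw [← sdBivFlat_orthogonal h.sq, ← h.kron_inv_congr, sdBiv, Matrix.transpose_mul]
  simp only [Matrix.mul_assoc]

/-- The metric on bivectors, in the bivectors of an orthonormal coframe. -/
lemma metric_wedge (h : OrthFrame G Gi vol P Q s) :
    bv (fun a b c d => G a c * G b d - G a d * G b c)
      = (Q ⊗ₖ Q)ᵀ * (magBivᵀ * magBiv - elecBivᵀ * elecBiv) * (Q ⊗ₖ Q) := by
  have h1 : magBivᵀ * magBiv - elecBivᵀ * elecBiv
      = bv (fun a b c d => mink a c * mink b d - mink a d * mink b c) := by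
    ext ⟨a, b⟩ ⟨c, d⟩
    exact (mink_wedge a b c d).symm
  have hsw (A : Matrix (Fin 4) (Fin 4) ℂ) : bv (fun a b c d => A a c * A b d - A a d * A b c)
      = A ⊗ₖ A - (A ⊗ₖ A).submatrix id (Equiv.prodComm _ _) := by
    ext ⟨a, b⟩ ⟨c, d⟩
    simp [bv, Matrix.kroneckerMap_apply]
  have hG : G ⊗ₖ G = (Q ⊗ₖ Q)ᵀ * (mink ⊗ₖ mink) * (Q ⊗ₖ Q) := by
    rw [h.metric, Matrix.mul_kronecker_mul, Matrix.mul_kronecker_mul,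
      ← Matrix.kroneckerMap_transpose]
  have hQ : Q ⊗ₖ Q = (Q ⊗ₖ Q).submatrix (Equiv.prodComm _ _) (Equiv.prodComm _ _) := by
    ext ⟨a, b⟩ ⟨c, d⟩
    simp [Matrix.kroneckerMap_apply, mul_comm]
  have hsub : ((mink ⊗ₖ mink).submatrix id (Equiv.prodComm _ _)) * (Q ⊗ₖ Q)
      = ((mink ⊗ₖ mink) * (Q ⊗ₖ Q)).submatrix id (Equiv.prodComm _ _) := by
    conv_lhs => rw [hQ]
    rw [Matrix.submatrix_mul_equiv]
  rw [h1, hsw, hsw, Matrix.mul_sub, Matrix.sub_mul, hG, Matrix.mul_assoc _ (Matrix.submatrix _ _ _),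
    hsub, Matrix.mul_assoc _ (mink ⊗ₖ mink)]
  congr 1

/-- `𝒢` is `-1/2` times the sum of the squares of the self-dual bivectors. -/
lemma calG_bv_eq (h : OrthFrame G Gi vol P Q s) :
    (1 / 2 : ℂ) • (-Complex.I • bv vol + bv (fun a b c d => G a c * G b d - G a d * G b c))
      = (-1 / 2 : ℂ) • ((sdBiv Q s)ᵀ * sdBiv Q s) := by
  have hI := Complex.I_sq
  have hs := h.sq
  have h1 : (sdBivFlat s)ᵀ * sdBivFlat s = (elecBivᵀ * elecBiv - magBivᵀ * magBiv)
      + (Complex.I * s) • lcMat := by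
    rw [lcMat_eq, sdBivFlat]
    simp only [Matrix.transpose_add, Matrix.transpose_smul, Matrix.add_mul, Matrix.mul_add,
      Matrix.smul_mul, Matrix.mul_smul, smul_add, smul_smul]
    match_scalars <;> grind
  have h2 : (sdBiv Q s)ᵀ * sdBiv Q s
      = (Q ⊗ₖ Q)ᵀ * ((sdBivFlat s)ᵀ * sdBivFlat s) * (Q ⊗ₖ Q) := by
    rw [sdBiv, Matrix.transpose_mul]
    simp only [Matrix.mul_assoc]
  rw [h2, h1, h.metric_wedge, h.vol_eq]
  simp only [Matrix.mul_add, Matrix.add_mul, Matrix.mul_sub, Matrix.sub_mul, Matrix.mul_smul,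
    Matrix.smul_mul]
  module

end OrthFrame

/-! ### Existence of orthonormal frames -/

lemma lc4_eq_zero_of_not_injective : ∀ i j k l : Fin 4,
    (i = j ∨ i = k ∨ i = l ∨ j = k ∨ j = l ∨ k = l) → lc4 i j k l = 0 := by
  decide +kernel

lemma lc4_perm : ∀ σ : Equiv.Perm (Fin 4),
    lc4 (σ 0) (σ 1) (σ 2) (σ 3) = (Equiv.Perm.sign σ : ℤ) := by
  decide +kernel

/-- An alternating 4-form on four of the vectors `f 0, …, f 3` is a multiple of the Levi-Civita
symbol. -/
lemma alternating_eq_lc4 {R V N : Type*} [CommRing R] [AddCommGroup V] [Module R V]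
    [AddCommGroup N] [Module R N] (A : V [⋀^Fin 4]→ₗ[R] N) (f : Fin 4 → V) (i j k l : Fin 4) :
    A ![f i, f j, f k, f l] = lc4 i j k l • A f := by
  have hcomp : ![f i, f j, f k, f l] = f ∘ ![i, j, k, l] := by
    ext m; fin_cases m <;> rfl
  rw [hcomp]
  by_cases hinj : Function.Injective ![i, j, k, l]
  · set σ : Equiv.Perm (Fin 4) := Equiv.ofBijective _ (Finite.injective_iff_bijective.mp hinj)
    have h1 : lc4 i j k l = (Equiv.Perm.sign σ : ℤ) := lc4_perm σ
    have h2 : f ∘ ![i, j, k, l] = f ∘ σ := rfl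
    rw [h2, A.map_perm, h1]
    rfl
  · have h0 : lc4 i j k l = 0 := by
      apply lc4_eq_zero_of_not_injective
      by_contra hne
      push Not at hne
      apply hinj
      intro a b hab
      obtain ⟨h1, h2, h3, h4, h5, h6⟩ := hne
      fin_cases a <;> fin_cases b <;> simp_all
    rw [h0, zero_smul]
    refine A.map_eq_zero_of_not_injective _ fun h => hinj h.of_comp

lemma det_eq_sum_lc4 (A : Matrix (Fin 4) (Fin 4) ℂ) :
    A.det = ∑ a, ∑ b, ∑ c, ∑ d, A 0 a * A 1 b * A 2 c * A 3 d * (lc4 a b c d : ℂ) := by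
  have h : ∀ a b c d, lc4 a b c d = ∑ σ : Equiv.Perm (Fin 4), (Equiv.Perm.sign σ : ℤ) *
      (if σ 0 = a then 1 else 0) * (if σ 1 = b then 1 else 0) * (if σ 2 = c then 1 else 0) *
        (if σ 3 = d then 1 else 0) := by
    decide +kernel
  rw [← Matrix.det_transpose, Matrix.det_apply']
  simp only [h, Int.cast_sum, Int.cast_mul, Int.cast_ite, Int.cast_one, Int.cast_zero,
    Finset.mul_sum]
  conv_rhs => enter [2, a, 2, b, 2, c]; rw [Finset.sum_comm]
  conv_rhs => enter [2, a, 2, b]; rw [Finset.sum_comm]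
  conv_rhs => enter [2, a]; rw [Finset.sum_comm]
  rw [Finset.sum_comm]
  refine Finset.sum_congr rfl fun σ _ => ?_
  simp [Fin.prod_univ_four]
  ring

/-- Under a change of basis the Levi-Civita symbol is multiplied by the determinant. -/
lemma lcMat_congr (Q : Matrix (Fin 4) (Fin 4) ℂ) :
    (Q ⊗ₖ Q)ᵀ * lcMat * (Q ⊗ₖ Q) = Q.det • lcMat := by
  rw [lcMat, ← bv_toFrame]
  ext ⟨i, j⟩ ⟨k, l⟩
  have h1 := alternating_eq_lc4 (Matrix.detRowAlternating (n := Fin 4) (R := ℂ)) Qᵀ i j k l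
  have h2 := det_eq_sum_lc4 ![Qᵀ i, Qᵀ j, Qᵀ k, Qᵀ l]
  simp only [bv, toFrame, Matrix.of_apply, Matrix.smul_apply, smul_eq_mul]
  calc _ = _ := h2.symm
    _ = _ := h1
    _ = _ := by
      rw [zsmul_eq_mul, mul_comm]
      congr 1
      exact Matrix.det_transpose Q

/-- Every unit timelike vector belongs to a (complex) orthonormal frame. -/
lemma exists_frame {G : Matrix (Fin 4) (Fin 4) ℂ} (hG : Gᵀ = G) (hdet : IsUnit G.det)
    (n : Fin 4 → ℂ) (hn : n ⬝ᵥ G *ᵥ n = -1) :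
    ∃ P Q : Matrix (Fin 4) (Fin 4) ℂ, Q * P = 1 ∧ G = Qᵀ * mink * Q ∧ (∀ a, P a 0 = n a) := by
  -- it suffices to find vectors with the right scalar products
  suffices h : ∃ P : Matrix (Fin 4) (Fin 4) ℂ, Pᵀ * G * P = mink ∧ ∀ a, P a 0 = n a by
    obtain ⟨P, hP, hP0⟩ := h
    have hm : mink * mink = 1 := by
      rw [mink, Matrix.diagonal_mul_diagonal, ← Matrix.diagonal_one]
      congr 1; ext i; fin_cases i <;> simp
    have hQP : (mink * Pᵀ * G) * P = 1 := by
      rw [Matrix.mul_assoc, Matrix.mul_assoc, ← Matrix.mul_assoc Pᵀ, hP, hm]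
    have hPQ := mul_eq_one_comm.mp hQP
    refine ⟨P, mink * Pᵀ * G, hQP, ?_, hP0⟩
    have hmt : minkᵀ = mink := by rw [mink, Matrix.diagonal_transpose]
    rw [Matrix.transpose_mul, Matrix.transpose_mul, Matrix.transpose_transpose, hG, hmt]
    calc G = G * (P * (mink * Pᵀ * G)) := by rw [hPQ, Matrix.mul_one]
      _ = G * (P * (mink * (mink * mink) * Pᵀ * G)) := by rw [hm, Matrix.mul_one]
      _ = _ := by simp only [Matrix.mul_assoc]
  set B : LinearMap.BilinForm ℂ (Fin 4 → ℂ) := Matrix.toBilin' G with hB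
  have hBs : B.IsSymm := Matrix.isSymm_toBilin'_iff_isSymm.mpr hG
  have hBn : B.Nondegenerate :=
    LinearMap.BilinForm.nondegenerate_toBilin'_of_det_ne_zero' G hdet.ne_zero
  have hBapp : ∀ x y, B x y = x ⬝ᵥ G *ᵥ y := fun x y => Matrix.toBilin'_apply' G x y
  have hnn : B n n = -1 := by rw [hBapp, hn]
  have hnn' : B n n ≠ 0 := by rw [hnn]; norm_num
  have hn0 : n ≠ 0 := by rintro rfl; simp at hnn
  set W := B.orthogonal (ℂ ∙ n)
  have hWs : LinearMap.IsSymm (B.restrict W) := ⟨fun x y => hBs.eq x y⟩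
  have hWn : (B.restrict W).Nondegenerate :=
    LinearMap.BilinForm.restrict_nondegenerate_orthogonal_spanSingleton B hBn hBs.isRefl hnn'
  have hrank : Module.finrank ℂ W = 3 := by
    rw [LinearMap.BilinForm.finrank_orthogonal hBn, finrank_span_singleton hn0]
    simp
  obtain ⟨v', hv'⟩ := LinearMap.BilinForm.exists_orthogonal_basis hWs
  obtain ⟨v, hv⟩ : ∃ v : Module.Basis (Fin 3) ℂ W, (B.restrict W).IsOrthoᵢ v := by
    refine ⟨v'.reindex (finCongr hrank), fun i j hij => ?_⟩
    have := hv' (i := (finCongr hrank).symm i) (j := (finCongr hrank).symm j)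
      (fun h => hij ((finCongr hrank).symm.injective h))
    simpa [Function.onFun] using this
  have hvv : ∀ i, B (v i) (v i) ≠ 0 := fun i =>
    hv.not_isOrtho_basis_self_of_separatingLeft hWn.1 i
  choose c hc using fun i => IsAlgClosed.exists_pow_nat_eq (B (v i) (v i)) (n := 2) (by norm_num)
  have hc0 : ∀ i, c i ≠ 0 := fun i h => hvv i (by rw [← hc, h]; simp)
  -- the columns of the matrix are `n` and the normalized vectors of the orthogonal basis
  set f : Fin 4 → Fin 4 → ℂ := Fin.cons n fun k => (c k)⁻¹ • (v k : Fin 4 → ℂ) with hf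
  refine ⟨(Matrix.of f)ᵀ, ?_, fun a => rfl⟩
  have hent : ∀ i j, ((Matrix.of f)ᵀᵀ * G * (Matrix.of f)ᵀ) i j = B (f i) (f j) := by
    intro i j
    rw [hBapp, Matrix.transpose_transpose, Matrix.mul_assoc]
    simp [Matrix.mul_apply, dotProduct, Matrix.mulVec]
  have hnv : ∀ k, B n (v k) = 0 := fun k => (v k).2 n (Submodule.mem_span_singleton_self n)
  ext i j
  rw [hent]
  refine Fin.cases ?_ (fun k => ?_) i <;> refine Fin.cases ?_ (fun l => ?_) j
  · simp [hf, hnn, mink]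
  · simp [hf, hnv, mink, (Fin.succ_ne_zero l).symm]
  · have : B (v k) n = 0 := by rw [← hBs.eq]; exact hnv k
    simp [hf, this, mink]
  · by_cases hkl : k = l
    · subst hkl
      simp only [hf, Fin.cons_succ, map_smul, LinearMap.smul_apply, smul_eq_mul, ← hc]
      have : mink k.succ k.succ = 1 := by fin_cases k <;> simp [mink]
      rw [this]
      have := hc0 k
      field_simp
    · have h0 : B (v k) (v l) = 0 := hv hkl
      simp [hf, h0, mink, hkl]

/-- Orthonormal frames adapted to a unit timelike vector `n`, for a metric with a volume element. -/
lemma exists_orthFrame {G : Matrix (Fin 4) (Fin 4) ℂ} (hG : Gᵀ = G) (hdet : IsUnit G.det)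
    (n : Fin 4 → ℂ) (hn : n ⬝ᵥ G *ᵥ n = -1) (v : ℂ) (hv : v ^ 2 = -G.det) :
    ∃ (P Q : Matrix (Fin 4) (Fin 4) ℂ) (s : ℂ),
      OrthFrame G G⁻¹ (fun a b c d => v * lc4 a b c d) P Q s ∧ (∀ a, P a 0 = n a) := by
  obtain ⟨P, Q, hQP, hGQ, hP0⟩ := exists_frame hG hdet n hn
  have hm : mink * mink = 1 := by
    rw [mink, Matrix.diagonal_mul_diagonal, ← Matrix.diagonal_one]
    congr 1; ext i; fin_cases i <;> simp
  have hmd : mink.det = -1 := by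
    simp [mink, Matrix.det_diagonal, Fin.prod_univ_four]
  have hPQ := mul_eq_one_comm.mp hQP
  have hQd : Q.det ≠ 0 := by
    have := congrArg Matrix.det hQP
    rw [Matrix.det_mul, Matrix.det_one] at this
    exact left_ne_zero_of_mul_eq_one this
  refine ⟨P, Q, v / Q.det, ⟨hQP, hGQ, ?_, ?_, ?_⟩, hP0⟩
  · refine Matrix.inv_eq_right_inv ?_
    rw [hGQ]
    calc _ = Qᵀ * mink * (Q * P) * mink * Pᵀ := by simp only [Matrix.mul_assoc]
      _ = Qᵀ * (mink * mink) * Pᵀ := by rw [hQP]; simp only [Matrix.mul_assoc, Matrix.one_mul]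
      _ = _ := by rw [hm, Matrix.mul_one, ← Matrix.transpose_mul, hPQ, Matrix.transpose_one]
  · rw [div_pow, hv, hGQ, Matrix.det_mul, Matrix.det_mul, Matrix.det_transpose, hmd]
    field_simp
  · rw [lcMat_congr, smul_smul, div_mul_cancel₀ _ hQd]
    ext ⟨a, b⟩ ⟨c, d⟩
    simp [bv, lcMat]

/-! ### The evolution of the scalar `w` along the normal: algebra in three dimensions -/

lemma lc3_table (i j k : Fin 3) : lc3 i j k = (![!![0, 0, 0; 0, 0, 1; 0, -1, 0],
    !![0, 0, -1; 0, 0, 0; 1, 0, 0], !![0, 1, 0; -1, 0, 0; 0, 0, 0]] :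
      Fin 3 → Matrix (Fin 3) (Fin 3) ℤ) i j k := by
  fin_cases i <;> fin_cases j <;> fin_cases k <;> rfl

/-- Distributivity for a curl of `F - i s (…)`; since `(i s)² = -1` the subtracted terms, which carry
`K`, lose their imaginary factor. -/
lemma sum_lc3_sub {s : ℂ} (hs : s ^ 2 = 1) (X K : Fin 3 → Fin 3 → ℂ)
    (F Z : Fin 3 → Fin 3 → Fin 3 → ℂ) :
    Complex.I * (s * ∑ k, ∑ l, ∑ m, ∑ q, (lc3 q m k : ℂ) * X l q *
        (F k l m - Complex.I * s * ∑ p, K k p * Z l m p))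
      = Complex.I * s * ∑ k, ∑ l, ∑ m, ∑ q, (lc3 q m k : ℂ) * X l q * F k l m
        + ∑ k, ∑ p, K k p * ∑ l, ∑ m, ∑ q, (lc3 q m k : ℂ) * X l q * Z l m p := by
  have hI : Complex.I * s * (Complex.I * s) = -1 := by
    linear_combination s ^ 2 * Complex.I_sq - hs
  have h1 : ∀ k, ∑ p, K k p * ∑ l, ∑ m, ∑ q, (lc3 q m k : ℂ) * X l q * Z l m p
      = ∑ l, ∑ m, ∑ q, (lc3 q m k : ℂ) * X l q * ∑ p, K k p * Z l m p := by
    intro k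
    simp only [Finset.mul_sum]
    rw [Finset.sum_comm]
    refine Finset.sum_congr rfl fun l _ => ?_
    rw [Finset.sum_comm]
    refine Finset.sum_congr rfl fun m _ => ?_
    rw [Finset.sum_comm]
    exact Finset.sum_congr rfl fun q _ => Finset.sum_congr rfl fun p _ => by ring
  simp only [h1]
  have h2 : ∀ W : Fin 3 → Fin 3 → Fin 3 → ℂ, ∑ k, ∑ l, ∑ m, ∑ q, (lc3 q m k : ℂ) * X l q *
      (F k l m - Complex.I * s * W k l m) = ∑ k, ∑ l, ∑ m, ∑ q, (lc3 q m k : ℂ) * X l q * F k l m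
        - Complex.I * s * ∑ k, ∑ l, ∑ m, ∑ q, (lc3 q m k : ℂ) * X l q * W k l m := by
    intro W
    simp only [Finset.mul_sum, ← Finset.sum_sub_distrib]
    exact Finset.sum_congr rfl fun k _ => Finset.sum_congr rfl fun l _ =>
      Finset.sum_congr rfl fun m _ => Finset.sum_congr rfl fun q _ => by ring
  rw [h2 fun k l m => ∑ p, K k p * Z l m p]
  linear_combination (-∑ k, ∑ l, ∑ m, ∑ q, (lc3 q m k : ℂ) * X l q * ∑ p, K k p * Z l m p) * hI

/-- If the derivatives `F` along the leaf and `Fn` along the normal are related by the vacuum Bianchi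
identity, the normal derivative of `-b / (2 a)` is expressed through the extrinsic curvature `K` and
the intrinsic derivative `F - i s (…)` of the electric part `E`. -/
lemma evolution_identity {E A K Fn : Matrix (Fin 3) (Fin 3) ℂ}
    {F Fh : Fin 3 → Matrix (Fin 3) (Fin 3) ℂ}
    {s a b : ℂ} (hs : s ^ 2 = 1) (hE : Eᵀ = E) (htr : E.trace = 0)
    (hF : ∀ m, (F m)ᵀ = F m)
    (hFn : ∀ k j, Fn k j = -(Complex.I * s * ∑ l, ∑ m, (lc3 l j m : ℂ) * F m k l))
    (hFh : ∀ k l m, Fh k l m = F k l m - Complex.I * s *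
      ∑ p, K k p * ∑ u, (E u m * (lc3 u l p : ℂ) + E l u * (lc3 u m p : ℂ)))
    (ha : a = 16 * (E * E).trace) (hb : b = -64 * (E * E * E).trace) (ha0 : a ≠ 0)
    (hA : A = (-4 : ℂ) • (E * E) + (a / 12) • 1 - (b / a) • E) :
    -((b * (32 * (Fn * E).trace) - a * (-192 * (Fn * (E * E)).trace)) / (2 * a ^ 2)) =
      -(6 / a ^ 3) * (∑ k, ∑ l, K k l * (b ^ 2 * E k l + a * (b * A k l
          - 12 * a * (E * Aᵀ) k l)))
        - (a * b * K.trace - 16 * Complex.I * (s * ∑ k, ∑ l, ∑ m, ∑ q, (lc3 q m k : ℂ) *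
          (b * E l q + 3 * a * A l q) * Fh k l m)) / (2 * a ^ 2) := by
  have e10 : E 1 0 = E 0 1 := congrFun (congrFun hE 0) 1
  have e20 : E 2 0 = E 0 2 := congrFun (congrFun hE 0) 2
  have e21 : E 2 1 = E 1 2 := congrFun (congrFun hE 1) 2
  have e22 : E 2 2 = -E 0 0 - E 1 1 := by
    simp only [Matrix.trace, Fin.sum_univ_three, Matrix.diag_apply] at htr
    linear_combination htr
  have hAt : Aᵀ = A := by
    rw [hA]; simp [hE]
  have hEA : ∀ k l, b ^ 2 * E k l + a * (b * A k l - 12 * a * (E * Aᵀ) k l)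
      = 8 * a * b * (E * E) k l + 1 / 2 * a ^ 3 * E k l
        - 1 / 6 * a ^ 2 * b * (1 : Matrix (Fin 3) (Fin 3) ℂ) k l := by
    -- the Cayley–Hamilton theorem for a trace-free matrix
    have hCH : E * (E * E) = (a / 32) • E - (b / 192) • (1 : Matrix (Fin 3) (Fin 3) ℂ) := by
      rw [ha, hb]
      ext k l
      fin_cases k <;> fin_cases l <;>
        simp [Matrix.trace, Matrix.mul_apply, Fin.sum_univ_three, e10, e20, e21, e22] <;> ring
    have : E * A = (-4 : ℂ) • (E * (E * E)) + (a / 12) • E - (b / a) • (E * E) := by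
      rw [hA]
      simp [Matrix.mul_add, Matrix.mul_sub]
    intro k l
    rw [hAt, this, hCH, hA]
    simp only [Matrix.add_apply, Matrix.sub_apply, Matrix.smul_apply, smul_eq_mul]
    field_simp
    ring
  have hX : ∀ l q, b * E l q + 3 * a * A l q = -2 * b * E l q - 12 * a * (E * E) l q
      + a ^ 2 / 4 * (1 : Matrix (Fin 3) (Fin 3) ℂ) l q := by
    intro l q
    rw [hA]
    simp only [Matrix.add_apply, Matrix.sub_apply, Matrix.smul_apply, smul_eq_mul]
    field_simp
    ring
  -- the coefficient of each component of `K` in the asserted identity vanishes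
  have hK : ∀ k p, -6 * (8 * b * (E * E) k p + 1 / 2 * a ^ 2 * E k p
        - 1 / 6 * a * b * (1 : Matrix (Fin 3) (Fin 3) ℂ) k p)
      - a * b / 2 * (1 : Matrix (Fin 3) (Fin 3) ℂ) k p
      + 8 * ∑ l, ∑ m, ∑ q, (lc3 q m k : ℂ) * (-2 * b * E l q - 12 * a * (E * E) l q
      + a ^ 2 / 4 * (1 : Matrix (Fin 3) (Fin 3) ℂ) l q) *
        ∑ u, (E u m * (lc3 u l p : ℂ) + E l u * (lc3 u m p : ℂ)) = 0 := by
    intro k p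
    rw [ha, hb]
    fin_cases k <;> fin_cases p <;>
      simp [Matrix.trace, Matrix.mul_apply, Fin.sum_univ_three, lc3_table, e10, e20, e21, e22] <;>
      ring
  -- the curl of `F`, which is the normal derivative `Fn`, gives the two traces on the left
  have hF' : ∀ m, F m 1 0 = F m 0 1 ∧ F m 2 0 = F m 0 2 ∧ F m 2 1 = F m 1 2 := fun m =>
    ⟨congrFun (congrFun (hF m) 0) 1, congrFun (congrFun (hF m) 0) 2, congrFun (congrFun (hF m) 1) 2⟩
  have hS : Complex.I * s * ∑ k, ∑ l, ∑ m, ∑ q, (lc3 q m k : ℂ) *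
      (-2 * b * E l q - 12 * a * (E * E) l q
        + a ^ 2 / 4 * (1 : Matrix (Fin 3) (Fin 3) ℂ) l q) * F k l m
      = -2 * b * (Fn * E).trace - 12 * a * (Fn * (E * E)).trace := by
    simp [Matrix.trace, Matrix.mul_apply, Fin.sum_univ_three, hFn, lc3_table, e10, e20, e21, hF']
    ring
  have hsplit : Complex.I * (s * ∑ k, ∑ l, ∑ m, ∑ q, (lc3 q m k : ℂ) *
      (-2 * b * E l q - 12 * a * (E * E) l q
        + a ^ 2 / 4 * (1 : Matrix (Fin 3) (Fin 3) ℂ) l q) * Fh k l m)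
      = -2 * b * (Fn * E).trace - 12 * a * (Fn * (E * E)).trace
        + ∑ k, ∑ p, K k p * ∑ l, ∑ m, ∑ q, (lc3 q m k : ℂ) *
          (-2 * b * E l q - 12 * a * (E * E) l q
            + a ^ 2 / 4 * (1 : Matrix (Fin 3) (Fin 3) ℂ) l q) *
          ∑ u, (E u m * (lc3 u l p : ℂ) + E l u * (lc3 u m p : ℂ)) := by
    rw [← hS]
    simp only [hFh]
    exact sum_lc3_sub hs _ _ _ fun l m p => ∑ u, (E u m * (lc3 u l p : ℂ) + E l u * (lc3 u m p : ℂ))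
  simp only [hEA, hX]
  have hdist : -(6 / a ^ 3) * (∑ k, ∑ l, K k l * (8 * a * b * (E * E) k l + 1 / 2 * a ^ 3 * E k l
        - 1 / 6 * a ^ 2 * b * (1 : Matrix (Fin 3) (Fin 3) ℂ) k l))
      - a * b * K.trace / (2 * a ^ 2) + 8 / a ^ 2 * ∑ k, ∑ p, K k p * ∑ l, ∑ m, ∑ q,
          (lc3 q m k : ℂ) * (-2 * b * E l q - 12 * a * (E * E) l q
            + a ^ 2 / 4 * (1 : Matrix (Fin 3) (Fin 3) ℂ) l q) *
          ∑ u, (E u m * (lc3 u l p : ℂ) + E l u * (lc3 u m p : ℂ)) = 0 := by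
    have htrK : K.trace = ∑ k, ∑ p, K k p * (1 : Matrix (Fin 3) (Fin 3) ℂ) k p := by
      simp [Matrix.trace, Matrix.one_apply]
    rw [htrK, mul_div_right_comm, Finset.mul_sum, Finset.mul_sum, Finset.mul_sum,
      ← Finset.sum_sub_distrib, ← Finset.sum_add_distrib]
    refine Finset.sum_eq_zero fun k _ => ?_
    rw [Finset.mul_sum, Finset.mul_sum, Finset.mul_sum,
      ← Finset.sum_sub_distrib, ← Finset.sum_add_distrib]
    refine Finset.sum_eq_zero fun p _ => ?_
    have := hK k p
    generalize (∑ l, ∑ m, ∑ q, (lc3 q m k : ℂ) * (-2 * b * E l q - 12 * a * (E * E) l q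
      + a ^ 2 / 4 * (1 : Matrix (Fin 3) (Fin 3) ℂ) l q) *
        ∑ u, (E u m * (lc3 u l p : ℂ) + E l u * (lc3 u m p : ℂ))) = Z at this ⊢
    field_simp
    linear_combination 2 * K k p * this
  rw [mul_assoc 16 Complex.I, hsplit]
  linear_combination (-1 : ℂ) * hdist

/-! ### Orthonormal components of the fields at a point -/

/-- A real matrix, regarded as a complex one. -/
abbrev toC {m n : Type} (A : Matrix m n ℝ) : Matrix m n ℂ := A.map Complex.ofReal

lemma sdBiv_apply (Q : Matrix (Fin 4) (Fin 4) ℂ) (s : ℂ) (k : Fin 3) (a p : Fin 4) :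
    sdBiv Q s k (a, p) = Q 0 a * Q k.succ p - Q k.succ a * Q 0 p
      + Complex.I * s * ∑ l, ∑ m, (lc3 k l m : ℂ) * Q (Fin.succ l) a * Q (Fin.succ m) p := by
  fin_cases k <;>
  simp [sdBiv, sdBivFlat, Matrix.mul_apply, Fintype.sum_prod_type, Fin.sum_univ_four,
    Fin.sum_univ_three, elecBiv, magBiv, elecZ, magZ, lc3_table, Matrix.kroneckerMap_apply] <;> ring

/-- The spatial part of a coframe. -/
def spatial (Q : Matrix (Fin 4) (Fin 4) ℂ) : Matrix (Fin 3) (Fin 4) ℂ :=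
  Matrix.of fun k a => Q k.succ a

section Frame

variable {G Gi : Matrix (Fin 4) (Fin 4) ℂ} {vol : Tensor4} {P Q : Matrix (Fin 4) (Fin 4) ℂ} {s : ℂ}

lemma OrthFrame.dual_apply (h : OrthFrame G Gi vol P Q s) (i j : Fin 4) :
    ∑ a, Q i a * P a j = if i = j then 1 else 0 := by
  have := congrFun (congrFun h.mul_eq_one i) j
  rwa [Matrix.mul_apply, Matrix.one_apply] at this

lemma OrthFrame.dual_apply' (h : OrthFrame G Gi vol P Q s) (a b : Fin 4) :
    ∑ i, P a i * Q i b = if a = b then 1 else 0 := by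
  have := congrFun (congrFun h.mul_eq_one' a) b
  rwa [Matrix.mul_apply, Matrix.one_apply] at this

/-- One contraction of a self-dual bivector with the timelike vector of the frame gives the spatial
covectors of the coframe. -/
lemma OrthFrame.sdBiv_normal (h : OrthFrame G Gi vol P Q s) (k : Fin 3) (a : Fin 4) :
    ∑ p, sdBiv Q s k (a, p) * P p 0 = -Q k.succ a := by
  have h1 : ∀ p, sdBiv Q s k (a, p) * P p 0 = Q 0 a * (Q k.succ p * P p 0)
      - Q k.succ a * (Q 0 p * P p 0) + ∑ m, (Complex.I * s *
        ∑ l, (lc3 k l m : ℂ) * Q (Fin.succ l) a) * (Q (Fin.succ m) p * P p 0) := by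
    intro p
    rw [sdBiv_apply]
    simp only [Fin.sum_univ_three]
    ring
  simp only [h1, Finset.sum_add_distrib, Finset.sum_sub_distrib, ← Finset.mul_sum, h.dual_apply]
  rw [Finset.sum_comm]
  simp [← Finset.mul_sum, h.dual_apply]

/-- The part of a double bivector that is normal in its second and fourth slots. -/
lemma OrthFrame.sum_normal_normal (h : OrthFrame G Gi vol P Q s) {W : Tensor4}
    {M : Matrix (Fin 3) (Fin 3) ℂ} (hW : bv W = (sdBiv Q s)ᵀ * M * sdBiv Q s) (a b : Fin 4) :
    ∑ p, ∑ q, W a p b q * P p 0 * P q 0 = ((spatial Q)ᵀ * M * spatial Q) a b := by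
  have h0 : ∀ p q, W a p b q = ∑ l, (∑ k, sdBiv Q s k (a, p) * M k l) * sdBiv Q s l (b, q) := by
    intro p q
    have := congrFun (congrFun hW (a, p)) (b, q)
    simpa [bv, Matrix.mul_apply] using this
  calc _ = ∑ l, (∑ k, (∑ p, sdBiv Q s k (a, p) * P p 0) * M k l)
        * ∑ q, sdBiv Q s l (b, q) * P q 0 := by
        simp only [h0, Fin.sum_univ_three, Fin.sum_univ_four]
        ring
    _ = _ := by
        simp only [h.sdBiv_normal, Matrix.mul_apply, spatial, Matrix.transpose_apply,
          Matrix.of_apply, Fin.sum_univ_three]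
        ring

/-- Traces of double bivectors are traces of `3 × 3` matrices, as the self-dual bivectors are
orthogonal. -/
lemma trace_sdBiv_mul (h : OrthFrame G Gi vol P Q s) (M N : Matrix (Fin 3) (Fin 3) ℂ) :
    ((sdBiv Q s)ᵀ * M * sdBiv Q s * (Gi ⊗ₖ Gi) * ((sdBiv Q s)ᵀ * N * sdBiv Q s * (Gi ⊗ₖ Gi))).trace
      = 16 * (M * N).trace := by
  have : (sdBiv Q s)ᵀ * M * sdBiv Q s * (Gi ⊗ₖ Gi) * ((sdBiv Q s)ᵀ * N * sdBiv Q s * (Gi ⊗ₖ Gi))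
      = (sdBiv Q s)ᵀ * (M * (sdBiv Q s * (Gi ⊗ₖ Gi) * (sdBiv Q s)ᵀ) * N * sdBiv Q s * (Gi ⊗ₖ Gi)) := by
    simp only [Matrix.mul_assoc]
  rw [this, Matrix.trace_mul_comm, h.sdBiv_orthogonal]
  simp only [Matrix.mul_assoc]
  rw [← Matrix.mul_assoc (sdBiv Q s), h.sdBiv_orthogonal]
  simp
  ring

/-- The product of double bivectors corresponds to the product of `3 × 3` matrices. -/
lemma sdBiv_mul_mul (h : OrthFrame G Gi vol P Q s) (M N : Matrix (Fin 3) (Fin 3) ℂ) :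
    (sdBiv Q s)ᵀ * M * sdBiv Q s * (Gi ⊗ₖ Gi) * ((sdBiv Q s)ᵀ * N * sdBiv Q s)
      = (sdBiv Q s)ᵀ * ((-4 : ℂ) • (M * N)) * sdBiv Q s := by
  have : (sdBiv Q s)ᵀ * M * sdBiv Q s * (Gi ⊗ₖ Gi) * ((sdBiv Q s)ᵀ * N * sdBiv Q s)
      = (sdBiv Q s)ᵀ * M * (sdBiv Q s * (Gi ⊗ₖ Gi) * (sdBiv Q s)ᵀ) * N * sdBiv Q s := by
    simp only [Matrix.mul_assoc]
  rw [this, h.sdBiv_orthogonal]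
  simp [Matrix.mul_assoc]

end Frame

/-! ### Contractions as products of matrices -/

lemma bv_raiseLast (G : Matrix (Fin 4) (Fin 4) ℝ) (W : Tensor4) :
    bv (raiseLast G W) = bv W * (toC G⁻¹ ⊗ₖ toC G⁻¹)ᵀ := by
  ext ⟨a, b⟩ ⟨c, d⟩
  simp only [bv, raiseLast, Matrix.of_apply, Matrix.mul_apply, Fintype.sum_prod_type,
    Matrix.transpose_apply, Matrix.kroneckerMap_apply, Matrix.map_apply]
  exact Finset.sum_congr rfl fun p _ => Finset.sum_congr rfl fun q _ => by ring

lemma bv_raiseFirst (G : Matrix (Fin 4) (Fin 4) ℝ) (W : Tensor4) :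
    bv (raiseFirst G W) = (toC G⁻¹ ⊗ₖ toC G⁻¹) * bv W := by
  ext ⟨a, b⟩ ⟨c, d⟩
  simp only [bv, raiseFirst, Matrix.of_apply, Matrix.mul_apply, Fintype.sum_prod_type,
    Matrix.kroneckerMap_apply, Matrix.map_apply]

lemma scalarA_eq_trace (G : Matrix (Fin 4) (Fin 4) ℝ) (W : Tensor4) :
    scalarA G W = (bv (raiseLast G W) * (bv (raiseFirst G W))ᵀ).trace := by
  simp only [scalarA, Matrix.trace, Matrix.diag_apply, Matrix.mul_apply, Fintype.sum_prod_type,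
    Matrix.transpose_apply, bv, Matrix.of_apply]

lemma scalarB_eq_trace (G : Matrix (Fin 4) (Fin 4) ℝ) (W : Tensor4) :
    scalarB G W
      = (bv (raiseLast G W) * (bv (raiseLast G W) * bv (raiseLast G W))).trace := by
  simp only [scalarB, Matrix.trace, Matrix.diag_apply, Matrix.mul_apply, Fintype.sum_prod_type,
    bv, Matrix.of_apply, Finset.mul_sum, mul_assoc]

lemma bv_selfDual (G : Matrix (Fin 4) (Fin 4) ℝ) (vol T : Fin 4 → Fin 4 → Fin 4 → Fin 4 → ℝ) :
    bv (selfDual G vol T) = (1 / 2 : ℂ) • (bv (fun a b c d => (T a b c d : ℂ))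
      - (Complex.I / 2) • (bv (fun a b c d => (T a b c d : ℂ)) * (toC G⁻¹ ⊗ₖ toC G⁻¹)ᵀ
        * (bv fun a b c d => (vol a b c d : ℂ))ᵀ)) := by
  ext ⟨a, b⟩ ⟨c, d⟩
  simp only [bv, selfDual, rightDual, Matrix.of_apply, Matrix.mul_apply, Fintype.sum_prod_type,
    Matrix.transpose_apply, Matrix.kroneckerMap_apply, Matrix.map_apply, Matrix.sub_apply,
    Matrix.smul_apply, smul_eq_mul, Finset.sum_mul]
  push_cast
  congr 1
  rw [sub_right_inj, ← mul_assoc, mul_one_div]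
  congr 1
  exact Finset.sum_congr rfl fun e _ => Finset.sum_congr rfl fun f _ =>
    Finset.sum_congr rfl fun p _ => Finset.sum_congr rfl fun q _ => by ring

/-! ### Splitting of the background fields in an adapted frame -/

lemma lc4_zero_succ : ∀ j k l : Fin 3, lc4 0 j.succ k.succ l.succ = lc3 j k l := by
  decide +kernel

lemma lc4_zero_zero : ∀ k l : Fin 4, lc4 0 0 k l = 0 ∧ lc4 0 k 0 l = 0 ∧ lc4 0 k l 0 = 0 := by
  decide +kernel

/-- An orthonormal frame for the metric at `x` whose timelike vector is the normal `n`. -/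
structure AdaptedFrame (L : LocalFields) (x : R4) (P Q : Matrix (Fin 4) (Fin 4) ℂ) (s : ℂ) :
    Prop where
  orth : OrthFrame (toC (L.metric x)) (toC (L.metric x)⁻¹)
    (fun a b c d => (L.vol x a b c d : ℂ)) P Q s
  timelike : ∀ a, P a 0 = (L.nUp x a : ℂ)

namespace AdaptedFrame

variable {L : LocalFields} {x : R4} {P Q : Matrix (Fin 4) (Fin 4) ℂ} {s : ℂ}

/-- The covector `n_a` is minus the timelike covector of the dual coframe, as `n` has length `-1`. -/
lemma normal_eq (h : AdaptedFrame L x P Q s) (a : Fin 4) : (L.normal x a : ℂ) = -Q 0 a := by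
  have hGi : toC (L.metric x) * toC (L.metric x)⁻¹ = 1 := by
    have hm : mink * mink = 1 := by
      rw [mink, Matrix.diagonal_mul_diagonal, ← Matrix.diagonal_one]
      congr 1; ext i; fin_cases i <;> simp
    rw [h.orth.inv, h.orth.metric]
    calc _ = Qᵀ * mink * (Q * P) * mink * Pᵀ := by simp only [Matrix.mul_assoc]
      _ = Qᵀ * (mink * mink) * Pᵀ := by
        rw [h.orth.mul_eq_one]; simp only [Matrix.mul_assoc, Matrix.one_mul]
      _ = _ := by
        rw [hm, Matrix.mul_one, ← Matrix.transpose_mul, h.orth.mul_eq_one', Matrix.transpose_one]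
  have h1 : (fun a => P a 0) = toC (L.metric x)⁻¹ *ᵥ fun a => (L.normal x a : ℂ) := by
    ext a
    rw [h.timelike, LocalFields.nUp]
    simp [Matrix.mulVec, dotProduct]
  have h2 : (fun a => (L.normal x a : ℂ)) = toC (L.metric x) *ᵥ fun a => P a 0 := by
    rw [h1, Matrix.mulVec_mulVec, hGi, Matrix.one_mulVec]
  have h3 : (Q *ᵥ fun a => P a 0) = Pi.single 0 1 := by
    ext i
    simp only [Matrix.mulVec, dotProduct, h.orth.dual_apply]
    fin_cases i <;> simp
  rw [congrFun h2 a, h.orth.metric, ← Matrix.mulVec_mulVec, h3]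
  simp [mink, Matrix.mul_diagonal]

lemma hUp_eq (h : AdaptedFrame L x P Q s) (a b : Fin 4) :
    (L.hUp x a b : ℂ) = ∑ k : Fin 3, P a k.succ * P b k.succ := by
  have h1 : (((L.metric x)⁻¹ a b : ℝ) : ℂ) = (P * mink * Pᵀ) a b := by
    rw [← h.orth.inv]; rfl
  rw [LocalFields.hUp]
  push_cast
  rw [h1, ← h.timelike, ← h.timelike]
  simp [mink, Matrix.mul_apply, Fin.sum_univ_succ]

lemma hMix_eq (h : AdaptedFrame L x P Q s) (a b : Fin 4) :
    (L.hMix x a b : ℂ) = ∑ k : Fin 3, Q k.succ a * P b k.succ := by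
  have h1 := h.orth.dual_apply' b a
  rw [Fin.sum_univ_succ] at h1
  rw [LocalFields.hMix]
  have h2 : ((if a = b then 1 else 0 : ℝ) : ℂ) = if b = a then 1 else 0 := by
    rcases eq_or_ne a b with rfl | hab
    · simp
    · simp [hab, hab.symm]
  rw [Complex.ofReal_add, Complex.ofReal_mul, h2, ← h1, h.normal_eq, ← h.timelike]
  simp only [mul_comm (Q (Fin.succ _) a)]
  ring

lemma h_eq (h : AdaptedFrame L x P Q s) (a b : Fin 4) :
    (L.h x a b : ℂ) = ∑ k : Fin 3, Q k.succ a * Q k.succ b := by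
  have h1 : ((L.metric x a b : ℝ) : ℂ) = (Qᵀ * mink * Q) a b := by
    rw [← h.orth.metric]; rfl
  rw [LocalFields.h]
  push_cast
  rw [h1, h.normal_eq, h.normal_eq]
  simp [mink, Matrix.mul_apply, Fin.sum_univ_succ]

/-- The volume element of the leaf is `s` times the Levi-Civita symbol of the spatial coframe. -/
lemma eps_eq (h : AdaptedFrame L x P Q s) (a b c : Fin 4) :
    (L.eps x a b c : ℂ) = s * ∑ k : Fin 3, ∑ l : Fin 3, ∑ m : Fin 3,
      (lc3 k l m : ℂ) * Q k.succ a * Q l.succ b * Q m.succ c := by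
  have h1 : ∀ d, (L.vol x d a b c : ℂ) = s * ∑ i, ∑ j, ∑ k, ∑ l,
      Q i d * Q j a * Q k b * Q l c * (lc4 i j k l : ℂ) := by
    intro d
    have h2 := h.orth.vol_eq
    rw [lcMat, ← bv_toFrame] at h2
    exact congrFun (congrFun h2 (d, a)) (b, c)
  rw [LocalFields.eps]
  push_cast
  calc _ = s * ∑ i, (∑ d, Q i d * P d 0) *
        ∑ j, ∑ k, ∑ l, Q j a * Q k b * Q l c * (lc4 i j k l : ℂ) := by
        simp only [h1, ← h.timelike, Finset.mul_sum, Finset.sum_mul]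
        rw [Finset.sum_comm]
        refine Finset.sum_congr rfl fun i _ => ?_
        rw [Finset.sum_comm]
        refine Finset.sum_congr rfl fun j _ => ?_
        rw [Finset.sum_comm]
        refine Finset.sum_congr rfl fun k _ => ?_
        rw [Finset.sum_comm]
        exact Finset.sum_congr rfl fun l _ => Finset.sum_congr rfl fun d _ => by ring
    _ = _ := by
        simp only [h.orth.dual_apply, ite_mul, one_mul, zero_mul, Finset.sum_ite_eq',
          Finset.mem_univ, if_true]
        simp only [Fin.sum_univ_succ (n := 3), lc4_zero_succ, (lc4_zero_zero _ _).1,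
          (lc4_zero_zero _ _).2.1, (lc4_zero_zero _ _).2.2, Int.cast_zero, mul_zero, zero_add,
          Finset.sum_const_zero]
        congr 1
        exact Finset.sum_congr rfl fun k _ => Finset.sum_congr rfl fun l _ =>
          Finset.sum_congr rfl fun m _ => by ring

section Weyl

variable {E : Matrix (Fin 3) (Fin 3) ℂ}

lemma calE_eq (h : AdaptedFrame L x P Q s)
    (hW : bv (L.frakd x) = (sdBiv Q s)ᵀ * E * sdBiv Q s) (a b : Fin 4) :
    L.calE x a b = ((spatial Q)ᵀ * E * spatial Q) a b := by
  rw [← h.orth.sum_normal_normal hW, LocalFields.calE]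
  simp only [h.timelike]

lemma sa_eq (h : AdaptedFrame L x P Q s) (hE : Eᵀ = E)
    (hW : bv (L.frakd x) = (sdBiv Q s)ᵀ * E * sdBiv Q s) :
    L.sa x = 16 * (E * E).trace := by
  have hK : (toC (L.metric x)⁻¹ ⊗ₖ toC (L.metric x)⁻¹)ᵀ
      = toC (L.metric x)⁻¹ ⊗ₖ toC (L.metric x)⁻¹ := by
    rw [← Matrix.kroneckerMap_transpose, h.orth.inv_transpose]
  rw [LocalFields.sa, scalarA_eq_trace, bv_raiseLast, bv_raiseFirst, hK, Matrix.transpose_mul, hK,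
    hW]
  simp only [Matrix.transpose_mul, Matrix.transpose_transpose, hE]
  rw [← trace_sdBiv_mul h.orth]
  simp only [Matrix.mul_assoc]

lemma sb_eq (h : AdaptedFrame L x P Q s)
    (hW : bv (L.frakd x) = (sdBiv Q s)ᵀ * E * sdBiv Q s) :
    L.sb x = -64 * (E * E * E).trace := by
  have hK : (toC (L.metric x)⁻¹ ⊗ₖ toC (L.metric x)⁻¹)ᵀ
      = toC (L.metric x)⁻¹ ⊗ₖ toC (L.metric x)⁻¹ := by
    rw [← Matrix.kroneckerMap_transpose, h.orth.inv_transpose]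
  rw [LocalFields.sb, scalarB_eq_trace, bv_raiseLast, hK, hW]
  rw [← Matrix.mul_assoc ((sdBiv Q s)ᵀ * E * sdBiv Q s * _) ((sdBiv Q s)ᵀ * E * sdBiv Q s),
    sdBiv_mul_mul h.orth, trace_sdBiv_mul h.orth, Matrix.mul_smul, Matrix.trace_smul,
    smul_eq_mul, ← Matrix.mul_assoc]
  ring

lemma bv_calG (h : AdaptedFrame L x P Q s) :
    bv (calG (L.metric x) (L.vol x)) = (-1 / 2 : ℂ) • ((sdBiv Q s)ᵀ * sdBiv Q s) := by
  rw [← h.orth.calG_bv_eq]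
  ext ⟨a, b⟩ ⟨c, d⟩
  simp [bv, calG]

lemma bv_calD (h : AdaptedFrame L x P Q s)
    (hW : bv (L.frakd x) = (sdBiv Q s)ᵀ * E * sdBiv Q s) :
    bv (L.calD x) = (sdBiv Q s)ᵀ *
      ((-4 : ℂ) • (E * E) + (L.sa x / 12) • 1 - (L.sb x / L.sa x) • E) * sdBiv Q s := by
  have hK : (toC (L.metric x)⁻¹ ⊗ₖ toC (L.metric x)⁻¹)ᵀ
      = toC (L.metric x)⁻¹ ⊗ₖ toC (L.metric x)⁻¹ := by
    rw [← Matrix.kroneckerMap_transpose, h.orth.inv_transpose]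
  have h1 : bv (L.calD x) = bv (raiseLast (L.metric x) (L.frakd x)) * bv (L.frakd x)
      - (L.sa x / 6) • bv (calG (L.metric x) (L.vol x)) - (L.sb x / L.sa x) • bv (L.frakd x) := by
    ext ⟨a, b⟩ ⟨c, d⟩
    simp [bv, LocalFields.calD, Matrix.mul_apply, Fintype.sum_prod_type]
  rw [h1, bv_raiseLast, hK, h.bv_calG, hW, sdBiv_mul_mul h.orth]
  simp only [Matrix.mul_sub, Matrix.mul_add, Matrix.add_mul, Matrix.sub_mul, Matrix.mul_smul,
    Matrix.smul_mul, Matrix.mul_one]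
  module

lemma frakA_eq (h : AdaptedFrame L x P Q s)
    (hW : bv (L.frakd x) = (sdBiv Q s)ᵀ * E * sdBiv Q s) (a b : Fin 4) :
    L.frakA x a b = ((spatial Q)ᵀ * ((-4 : ℂ) • (E * E)
      + (L.sa x / 12) • (1 : Matrix (Fin 3) (Fin 3) ℂ) - (L.sb x / L.sa x) • E) * spatial Q) a b := by
  rw [← h.orth.sum_normal_normal (h.bv_calD hW), LocalFields.frakA]
  simp only [h.timelike]

end Weyl

end AdaptedFrame

/-! ### The orthogonal splitting in orthonormal components -/

/-- The spatial covector with the given components in an orthonormal coframe. -/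
def lower (Q : Matrix (Fin 4) (Fin 4) ℂ) (x : Fin 3 → ℂ) (a : Fin 4) : ℂ := ∑ k, Q k.succ a * x k

/-- The spatial vector with the given components in an orthonormal frame. -/
def raise (P : Matrix (Fin 4) (Fin 4) ℂ) (x : Fin 3 → ℂ) (a : Fin 4) : ℂ := ∑ k, P a k.succ * x k

/-- The vector product. -/
def cross (x y : Fin 3 → ℂ) (k : Fin 3) : ℂ := ∑ l, ∑ m, (lc3 k l m : ℂ) * x l * y m

namespace AdaptedFrame

variable {L : LocalFields} {x : R4} {P Q : Matrix (Fin 4) (Fin 4) ℂ} {s : ℂ}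

lemma dual_spatial (h : AdaptedFrame L x P Q s) (k l : Fin 3) :
    ∑ a, Q k.succ a * P a l.succ = if k = l then 1 else 0 := by
  rw [h.orth.dual_apply]; simp

lemma sum_raise (h : AdaptedFrame L x P Q s) (y : Fin 3 → ℂ) (k : Fin 3) :
    ∑ a, Q k.succ a * raise P y a = y k := by
  simp only [raise, Finset.mul_sum, ← mul_assoc]
  rw [Finset.sum_comm]
  simp [← Finset.sum_mul, h.dual_spatial]

lemma sum_lower (h : AdaptedFrame L x P Q s) (y : Fin 3 → ℂ) (k : Fin 3) :
    ∑ a, P a k.succ * lower Q y a = y k := by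
  simp only [lower, Finset.mul_sum, ← mul_assoc]
  rw [Finset.sum_comm]
  simp [← Finset.sum_mul, mul_comm (P _ _), h.dual_spatial]

lemma sum_raise_mul_lower (h : AdaptedFrame L x P Q s) (y z : Fin 3 → ℂ) :
    ∑ a, raise P y a * lower Q z a = ∑ k, y k * z k := by
  simp only [lower, Finset.mul_sum]
  rw [Finset.sum_comm]
  simp only [mul_left_comm (raise P y _), ← mul_assoc, ← Finset.sum_mul, h.sum_raise]

lemma lower_normal (h : AdaptedFrame L x P Q s) (y : Fin 3 → ℂ) :
    ∑ a, P a 0 * lower Q y a = 0 := by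
  simp only [lower, Finset.mul_sum]
  rw [Finset.sum_comm]
  refine Finset.sum_eq_zero fun k _ => ?_
  have := h.orth.dual_apply k.succ 0
  simp only [Fin.succ_ne_zero, if_false] at this
  calc _ = (∑ a, Q k.succ a * P a 0) * y k := by
        rw [Finset.sum_mul]; exact Finset.sum_congr rfl fun a _ => by ring
    _ = 0 := by rw [this, zero_mul]

lemma up_lower (h : AdaptedFrame L x P Q s) (y : Fin 3 → ℂ) (a : Fin 4) :
    L.up x (lower Q y) a = raise P y a := by
  simp only [LocalFields.up, h.hUp_eq, Finset.sum_mul]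
  rw [Finset.sum_comm]
  simp only [mul_assoc, ← Finset.mul_sum, h.sum_lower]
  rfl

lemma mix_eq (h : AdaptedFrame L x P Q s) {T : Fin 4 → Fin 4 → ℂ} {E : Matrix (Fin 3) (Fin 3) ℂ}
    (hT : ∀ a b, T a b = ((spatial Q)ᵀ * E * spatial Q) a b) (a b : Fin 4) :
    L.mix x T a b = raise P (fun l => ∑ k, Q k.succ a * E k l) b := by
  have h1 : T a = lower Q fun l => ∑ k, Q k.succ a * E k l := by
    ext b
    rw [hT]
    simp only [Matrix.mul_apply, spatial, lower, Matrix.transpose_apply, Matrix.of_apply]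
    exact Finset.sum_congr rfl fun k _ => mul_comm _ _
  rw [← h.up_lower, LocalFields.mix, LocalFields.up, h1]

lemma up2_eq (h : AdaptedFrame L x P Q s) {T : Fin 4 → Fin 4 → ℂ} {E : Matrix (Fin 3) (Fin 3) ℂ}
    (hT : ∀ a b, T a b = ((spatial Q)ᵀ * E * spatial Q) a b) (a b : Fin 4) :
    L.up2 x T a b = ∑ k, ∑ l, P a k.succ * P b l.succ * E k l := by
  have h1 : L.up2 x T a b = ∑ c, (L.hUp x a c : ℂ) * L.mix x T c b := by
    simp only [LocalFields.up2, LocalFields.mix, Finset.mul_sum, mul_assoc]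
  have h2 : (fun c => L.mix x T c b) = lower Q fun k => raise P (E k) b := by
    ext c
    rw [h.mix_eq hT]
    simp only [raise, lower, Finset.mul_sum]
    rw [Finset.sum_comm]
    exact Finset.sum_congr rfl fun k _ => Finset.sum_congr rfl fun l _ => by ring
  have h3 := h.up_lower (fun k => raise P (E k) b) a
  rw [h1]
  simp only [LocalFields.up] at h3
  have h4 : ∀ c, L.mix x T c b = lower Q (fun k => raise P (E k) b) c := congrFun h2
  simp only [h4, h3]
  simp only [raise, Finset.mul_sum, mul_assoc]

lemma eps_raise (h : AdaptedFrame L x P Q s) (y z : Fin 3 → ℂ) (c : Fin 4) :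
    ∑ b, ∑ a, (L.eps x c b a : ℂ) * raise P y b * raise P z a = s * lower Q (cross y z) c := by
  calc _ = s * ∑ k : Fin 3, Q k.succ c * ∑ l : Fin 3, ∑ m : Fin 3, (lc3 k l m : ℂ) *
        (∑ b, Q l.succ b * raise P y b) * ∑ a, Q m.succ a * raise P z a := by
        simp only [h.eps_eq, Finset.mul_sum, Finset.sum_mul]
        conv_lhs => enter [2, b]; rw [Finset.sum_comm]
        rw [Finset.sum_comm]
        refine Finset.sum_congr rfl fun k _ => ?_
        conv_lhs => enter [2, b]; rw [Finset.sum_comm]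
        rw [Finset.sum_comm]
        refine Finset.sum_congr rfl fun l _ => ?_
        conv_lhs => enter [2, b]; rw [Finset.sum_comm]
        rw [Finset.sum_comm]
        refine Finset.sum_congr rfl fun m _ => ?_
        rw [Finset.sum_comm]
        exact Finset.sum_congr rfl fun a _ => Finset.sum_congr rfl fun b _ => by ring
    _ = _ := by simp only [h.sum_raise, lower, cross]

lemma sum_raise_calE (h : AdaptedFrame L x P Q s) {E : Matrix (Fin 3) (Fin 3) ℂ}
    (hW : bv (L.frakd x) = (sdBiv Q s)ᵀ * E * sdBiv Q s) (y : Fin 3 → ℂ) (b : Fin 4) :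
    ∑ d, raise P y d * L.calE x b d = lower Q (fun k => ∑ l, E k l * y l) b := by
  have h1 : L.calE x b = lower Q fun l => ∑ k, Q k.succ b * E k l := by
    ext b
    rw [h.calE_eq hW]
    simp only [Matrix.mul_apply, spatial, lower, Matrix.transpose_apply, Matrix.of_apply]
    exact Finset.sum_congr rfl fun k _ => mul_comm _ _
  rw [h1, h.sum_raise_mul_lower]
  simp only [lower, Fin.sum_univ_three]
  ring

section Split

variable {E : Matrix (Fin 3) (Fin 3) ℂ} {σ' υ : Fin 3 → ℂ}

/-- The orthonormal components of `3 w σ_a + Ω w^⊥_a`. -/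
noncomputable def gradComp (L : LocalFields) (x : R4) (σ' υ : Fin 3 → ℂ) (k : Fin 3) : ℂ :=
  3 * L.sw x * σ' k + L.conf x * υ k

/-- The right hand side of the condition on `Y²` is the quadratic form `E + w / 2` evaluated on the
spatial gradient. -/
lemma lapseSq_eq (h : AdaptedFrame L x P Q s) (hE : Eᵀ = E)
    (hW : bv (L.frakd x) = (sdBiv Q s)ᵀ * E * sdBiv Q s)
    (hσ : (fun a => (L.sigLow x a : ℂ)) = lower Q σ') (hυ : L.wPerp x = lower Q υ) (φ : ℂ) :
    L.lapseSq x φ = 1 / φ * ∑ k, ∑ l, (E + (L.sw x / 2) • (1 : Matrix (Fin 3) (Fin 3) ℂ)) k l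
      * gradComp L x σ' υ k * gradComp L x σ' υ l := by
  have e10 : E 1 0 = E 0 1 := congrFun (congrFun hE 0) 1
  have e20 : E 2 0 = E 0 2 := congrFun (congrFun hE 0) 2
  have e21 : E 2 1 = E 1 2 := congrFun (congrFun hE 1) 2
  have hE' := h.sum_raise_calE hW
  simp only [LocalFields.lapseSq]
  simp only [congrFun hσ, hυ, h.up_lower]
  have h1 : ∑ b, 3 * raise P σ' b * L.sw x * (6 * (∑ d, raise P σ' d * L.calE x b d)
      + 3 * lower Q σ' b * L.sw x + 2 * (L.conf x : ℂ) * lower Q υ b)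
      = 3 * L.sw x * ∑ k, σ' k * (6 * (∑ l, E k l * σ' l) + 3 * σ' k * L.sw x
        + 2 * (L.conf x : ℂ) * υ k) := by
    rw [← h.sum_raise_mul_lower, Finset.mul_sum]
    refine Finset.sum_congr rfl fun b _ => ?_
    rw [hE']
    simp only [lower, Fin.sum_univ_three]
    ring
  have h2 : ∑ b, lower Q υ b * raise P υ b = ∑ k, υ k * υ k := by
    rw [← h.sum_raise_mul_lower]
    exact Finset.sum_congr rfl fun b _ => mul_comm _ _
  have h3 : ∑ b, ∑ d, L.calE x b d * (6 * raise P σ' b * L.sw x + (L.conf x : ℂ) * raise P υ b)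
      * raise P υ d = ∑ k, (6 * σ' k * L.sw x + L.conf x * υ k) * ∑ l, E k l * υ l := by
    rw [← h.sum_raise_mul_lower]
    refine Finset.sum_congr rfl fun b _ => ?_
    rw [← hE', Finset.mul_sum]
    refine Finset.sum_congr rfl fun d _ => ?_
    simp only [raise, Fin.sum_univ_three]
    ring
  rw [h1, h2, h3, one_div_mul_eq_div, one_div_mul_eq_div, mul_comm 2 φ, ← div_div,
    div_right_comm]
  congr 1
  simp only [gradComp, Fin.sum_univ_three, Matrix.add_apply, Matrix.smul_apply, smul_eq_mul,
    Matrix.one_apply, Fin.isValue, if_true, e10, e20, e21]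
  simp
  ring

/-- The orthonormal components of `(ℰ_{ab} + w h_{ab} / 2) (3 w σ^b + Ω w^{⊥ b})`. -/
noncomputable def gradImage (L : LocalFields) (x : R4) (E : Matrix (Fin 3) (Fin 3) ℂ)
    (σ' υ : Fin 3 → ℂ)
    (k : Fin 3) : ℂ :=
  ∑ l, (E + (L.sw x / 2) • (1 : Matrix (Fin 3) (Fin 3) ℂ)) k l * gradComp L x σ' υ l

/-- The normal component `-3 w σ + Ω w^∥` of `3 w ∇_a Θ + Θ ∇_a w`. -/
noncomputable def normalGrad (L : LocalFields) (x : R4) : ℂ :=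
  -3 * L.sig x * L.sw x + L.conf x * L.wPar x

/-- The right hand side of the condition on `Y_c`, as the image of the spatial gradient under
`E + w / 2` and its vector product with that gradient. -/
lemma shift_eq (h : AdaptedFrame L x P Q s) (hE : Eᵀ = E)
    (hW : bv (L.frakd x) = (sdBiv Q s)ᵀ * E * sdBiv Q s)
    (hσ : (fun a => (L.sigLow x a : ℂ)) = lower Q σ') (hυ : L.wPerp x = lower Q υ) (φ Y : ℂ)
    (c : Fin 4) :
    L.shift x φ Y c = lower Q (fun j => 1 / (Y * φ) * (normalGrad L x * gradImage L x E σ' υ j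
      - Complex.I * s * cross (gradComp L x σ' υ) (gradImage L x E σ' υ) j)) c := by
  have e10 : E 1 0 = E 0 1 := congrFun (congrFun hE 0) 1
  have e20 : E 2 0 = E 0 2 := congrFun (congrFun hE 0) 2
  have e21 : E 2 1 = E 1 2 := congrFun (congrFun hE 1) 2
  have hE' := h.sum_raise_calE hW
  have hmix : ∀ (y : Fin 3 → ℂ) a, ∑ d, L.mix x (L.calE x) d a * raise P y d
      = raise P (fun k => ∑ l, E k l * y l) a := by
    intro y a
    have h1 : ∀ d, L.mix x (L.calE x) d a = lower Q (fun k => raise P (E k) a) d := by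
      intro d
      rw [h.mix_eq (h.calE_eq hW)]
      simp only [raise, lower, Fin.sum_univ_three]
      ring
    simp only [h1, mul_comm _ (raise P y _)]
    rw [h.sum_raise_mul_lower]
    simp only [raise, Fin.sum_univ_three, e10, e20, e21]
    ring
  simp only [LocalFields.shift]
  simp only [congrFun hσ, hυ, h.up_lower]
  have h1 : ∑ b, raise P σ' b * L.calE x c b = lower Q (fun k => ∑ l, E k l * σ' l) c := hE' _ _
  have h2 : ∑ b, L.calE x c b * raise P υ b = lower Q (fun k => ∑ l, E k l * υ l) c := by
    rw [← hE']
    exact Finset.sum_congr rfl fun b _ => mul_comm _ _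
  have h3 : ∑ b, ∑ a, ∑ d, (L.eps x c b a : ℂ) * raise P σ' b * L.mix x (L.calE x) d a * L.sw x
      * raise P υ d = L.sw x * (s * lower Q (cross σ' fun k => ∑ l, E k l * υ l) c) := by
    rw [← h.eps_raise, Finset.mul_sum]
    refine Finset.sum_congr rfl fun b _ => ?_
    rw [Finset.mul_sum]
    refine Finset.sum_congr rfl fun a _ => ?_
    rw [← hmix, Finset.mul_sum, Finset.mul_sum]
    exact Finset.sum_congr rfl fun d _ => by ring
  have h4 : ∑ d, ∑ a, ∑ b, (L.eps x c d a : ℂ) * L.mix x (L.calE x) b a *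
      ((L.conf x : ℂ) ^ 2 * raise P υ b * raise P υ d + 3 * raise P σ' b * L.sw x *
        (3 * raise P σ' d * L.sw x + L.conf x * raise P υ d))
      = (L.conf x : ℂ) ^ 2 * (s * lower Q (cross υ fun k => ∑ l, E k l * υ l) c)
        + 3 * L.sw x * (s * lower Q (cross (gradComp L x σ' υ) fun k => ∑ l, E k l * σ' l) c) := by
    rw [← h.eps_raise, ← h.eps_raise, Finset.mul_sum, Finset.mul_sum, ← Finset.sum_add_distrib]
    refine Finset.sum_congr rfl fun d _ => ?_
    rw [Finset.mul_sum, Finset.mul_sum, ← Finset.sum_add_distrib]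
    refine Finset.sum_congr rfl fun a _ => ?_
    rw [← hmix, ← hmix, Finset.mul_sum, Finset.mul_sum, Finset.mul_sum, Finset.mul_sum,
      ← Finset.sum_add_distrib]
    refine Finset.sum_congr rfl fun b _ => ?_
    simp only [raise, gradComp, Fin.sum_univ_three]
    ring
  rw [h1, h2, h3, h4]
  have h5 : -(1 / (2 * Y * φ)) = 1 / (Y * φ) * (-1 / 2 : ℂ) := by
    rw [mul_assoc, ← one_div_mul_one_div]; ring
  rw [h5]
  simp only [lower, gradImage, gradComp, normalGrad, cross, Fin.sum_univ_three, Matrix.add_apply,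
    Matrix.smul_apply, smul_eq_mul, Matrix.one_apply, lc3_table, e10, e20, e21]
  simp
  ring

/-- The tensor `Q` is the form `E + w / 2` on the spatial parts of the contractions of the self-dual
bivectors with `3 w ∇Θ + Θ ∇w`. -/
lemma tensorQ_eq (h : AdaptedFrame L x P Q s) (hE : Eᵀ = E) (htr : E.trace = 0)
    (hW : bv (L.frakd x) = (sdBiv Q s)ᵀ * E * sdBiv Q s)
    (hσ : (fun a => (L.sigLow x a : ℂ)) = lower Q σ') (hυ : L.wPerp x = lower Q υ) (φ : ℂ)
    (a c : Fin 4) :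
    L.tensorQ x φ a c = (L.conf x : ℂ) ^ 4 / φ * ∑ k, ∑ l,
      (E + (L.sw x / 2) • (1 : Matrix (Fin 3) (Fin 3) ℂ)) k l
        * (-normalGrad L x * Q k.succ a + Complex.I * s *
          lower Q (fun i => ∑ m, (lc3 k i m : ℂ) * gradComp L x σ' υ m) a)
        * (-normalGrad L x * Q l.succ c + Complex.I * s *
          lower Q (fun i => ∑ m, (lc3 l i m : ℂ) * gradComp L x σ' υ m) c) := by
  have e10 : E 1 0 = E 0 1 := congrFun (congrFun hE 0) 1
  have e20 : E 2 0 = E 0 2 := congrFun (congrFun hE 0) 2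
  have e21 : E 2 1 = E 1 2 := congrFun (congrFun hE 1) 2
  have hI : Complex.I * s * (Complex.I * s) = -1 := by
    linear_combination s ^ 2 * Complex.I_sq - h.orth.sq
  have e22 : E 2 2 = -E 0 0 - E 1 1 := by
    simp only [Matrix.trace, Fin.sum_univ_three, Matrix.diag_apply] at htr
    linear_combination htr
  set ζ := gradComp L x σ' υ with hζ
  have hgrad : ∀ b, 3 * (L.conf x : ℂ) ^ 2 * lower Q σ' b * L.sw x + (L.conf x : ℂ) ^ 3 * lower Q υ b
      = (L.conf x : ℂ) ^ 2 * lower Q ζ b := by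
    intro b
    simp only [lower, hζ, gradComp, Fin.sum_univ_three]
    ring
  have hgrad' : ∀ b, 3 * raise P σ' b * L.sw x + L.conf x * raise P υ b = raise P ζ b := by
    intro b
    simp only [raise, hζ, gradComp, Fin.sum_univ_three]
    ring
  have c1 : ∑ b, ∑ d, (L.hUp x b d : ℂ) * lower Q ζ b * lower Q ζ d = ∑ k, ζ k * ζ k := by
    rw [← h.sum_raise_mul_lower]
    refine Finset.sum_congr rfl fun b _ => ?_
    rw [← h.up_lower, LocalFields.up, Finset.sum_mul]
    exact Finset.sum_congr rfl fun d _ => by ring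
  have c2 : ∀ c, ∑ b, (L.hMix x c b : ℂ) * lower Q ζ b = lower Q ζ c := by
    intro c
    simp only [h.hMix_eq, Finset.sum_mul]
    rw [Finset.sum_comm]
    simp only [mul_assoc, ← Finset.mul_sum, h.sum_lower]
    rfl
  have c3 : ∀ a, ∑ d, L.mix x (L.calE x) a d * lower Q ζ d =
      ∑ l, (∑ k, Q k.succ a * E k l) * ζ l := by
    intro a
    simp only [h.mix_eq (h.calE_eq hW), h.sum_raise_mul_lower]
  have c4 : ∑ b, ∑ d, L.up2 x (L.calE x) b d * lower Q ζ b * lower Q ζ d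
      = ∑ k, ∑ l, E k l * ζ k * ζ l := by
    simp only [h.up2_eq (h.calE_eq hW)]
    calc _ = ∑ k, ∑ l, E k l * (∑ b, P b k.succ * lower Q ζ b) * ∑ d, P d l.succ * lower Q ζ d := by
          simp only [Fin.sum_univ_three, Fin.sum_univ_four]
          ring
      _ = _ := by simp only [h.sum_lower]
  have s1 : ∑ b, ∑ d, ((L.eps x c b d : ℂ) * L.mix x (L.calE x) a d
      + (L.eps x a b d : ℂ) * L.mix x (L.calE x) c d) * normalGrad L x * raise P ζ b
      = normalGrad L x * (s * lower Q (cross ζ fun l => ∑ k, Q k.succ a * E k l) c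
        + s * lower Q (cross ζ fun l => ∑ k, Q k.succ c * E k l) a) := by
    rw [← h.eps_raise, ← h.eps_raise, ← Finset.sum_add_distrib, Finset.mul_sum]
    refine Finset.sum_congr rfl fun b _ => ?_
    rw [← Finset.sum_add_distrib, Finset.mul_sum]
    refine Finset.sum_congr rfl fun d _ => ?_
    rw [h.mix_eq (h.calE_eq hW), h.mix_eq (h.calE_eq hW)]
    ring
  have s2 : ∑ b, ∑ d, ((L.hUp x b d : ℂ) * L.calE x a c - L.hMix x c b * L.mix x (L.calE x) a d
      - L.hMix x a d * L.mix x (L.calE x) c b + 1 / 2 * L.hMix x a d * L.hMix x c b * L.sw x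
      + L.h x a c * (L.up2 x (L.calE x) b d - 1 / 2 * L.hUp x b d * L.sw x))
        * ((L.conf x : ℂ) ^ 2 * lower Q ζ b) * ((L.conf x : ℂ) ^ 2 * lower Q ζ d)
      = (L.conf x : ℂ) ^ 4 * (L.calE x a c * (∑ k, ζ k * ζ k)
        - lower Q ζ c * (∑ l, (∑ k, Q k.succ a * E k l) * ζ l)
        - lower Q ζ a * (∑ l, (∑ k, Q k.succ c * E k l) * ζ l)
        + 1 / 2 * lower Q ζ a * lower Q ζ c * L.sw x
        + L.h x a c * (∑ k, ∑ l, E k l * ζ k * ζ l - 1 / 2 * L.sw x * ∑ k, ζ k * ζ k)) := by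
    have m1 := c2 c
    have m2 := c2 a
    have m3 := c3 a
    have m4 := c3 c
    have d1 : lower Q ζ c * (∑ l, (∑ k, Q k.succ a * E k l) * ζ l) = ∑ b, ∑ d,
        (L.hMix x c b * lower Q ζ b) * (L.mix x (L.calE x) a d * lower Q ζ d) := by
      rw [← Finset.sum_mul_sum, m1, m3]
    have d2 : lower Q ζ a * (∑ l, (∑ k, Q k.succ c * E k l) * ζ l) = ∑ b, ∑ d,
        (L.mix x (L.calE x) c b * lower Q ζ b) * (L.hMix x a d * lower Q ζ d) := by
      rw [← Finset.sum_mul_sum, m2, m4, mul_comm]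
    have d3 : lower Q ζ a * lower Q ζ c = ∑ b, ∑ d,
        (L.hMix x c b * lower Q ζ b) * (L.hMix x a d * lower Q ζ d) := by
      rw [← Finset.sum_mul_sum, m1, m2, mul_comm]
    rw [mul_assoc (1 / 2 : ℂ) (lower Q ζ a), d1, d2, d3, ← c1, ← c4]
    simp only [Finset.mul_sum, Finset.sum_mul, ← Finset.sum_add_distrib, ← Finset.sum_sub_distrib]
    exact Finset.sum_congr rfl fun b _ => Finset.sum_congr rfl fun d _ => by ring
  have hng : -3 * (L.sig x : ℂ) * L.sw x + L.conf x * L.wPar x = normalGrad L x := rfl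
  simp only [LocalFields.tensorQ]
  simp only [congrFun hσ, hυ, h.up_lower, hgrad, hgrad', hng]
  rw [s1, s2, h.calE_eq hW, h.h_eq]
  generalize normalGrad L x = z
  clear_value ζ
  have hX : ∀ X, (L.conf x : ℂ) ^ 4 / φ * X = 1 / φ * ((L.conf x : ℂ) ^ 4 * X) := fun X => by ring
  rw [hX]
  congr 1
  simp only [Matrix.mul_apply, spatial, Matrix.transpose_apply, Matrix.of_apply, lower, cross,
    Fin.sum_univ_three, Matrix.add_apply, Matrix.smul_apply, smul_eq_mul, Matrix.one_apply,
    lc3_table, e10, e20, e21, e22]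
  simp
  -- the square of `i s` enters through the product of two vector products
  set u : Fin 3 → ℂ := fun k => Q k.succ a with hu
  set v : Fin 3 → ℂ := fun k => Q k.succ c with hv
  have hu1 : Q 1 a = u 0 := rfl
  have hu2 : Q 2 a = u 1 := rfl
  have hv1 : Q 1 c = v 0 := rfl
  have hv2 : Q 2 c = v 1 := rfl
  have hu4 : Q 3 a = u 2 := rfl
  have hv4 : Q 3 c = v 2 := rfl
  simp only [hu1, hu2, hu4, hv1, hv2, hv4]
  clear_value u v
  linear_combination (-(L.conf x : ℂ) ^ 4 * (
    (E 0 0 + L.sw x / 2) * (u 1 * ζ 2 - u 2 * ζ 1) * (v 1 * ζ 2 - v 2 * ζ 1)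
    + (E 1 1 + L.sw x / 2) * (u 2 * ζ 0 - u 0 * ζ 2) * (v 2 * ζ 0 - v 0 * ζ 2)
    + (-E 0 0 - E 1 1 + L.sw x / 2) * (u 0 * ζ 1 - u 1 * ζ 0) * (v 0 * ζ 1 - v 1 * ζ 0)
    + E 0 1 * ((u 1 * ζ 2 - u 2 * ζ 1) * (v 2 * ζ 0 - v 0 * ζ 2)
      + (u 2 * ζ 0 - u 0 * ζ 2) * (v 1 * ζ 2 - v 2 * ζ 1))
    + E 0 2 * ((u 1 * ζ 2 - u 2 * ζ 1) * (v 0 * ζ 1 - v 1 * ζ 0)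
      + (u 0 * ζ 1 - u 1 * ζ 0) * (v 1 * ζ 2 - v 2 * ζ 1))
    + E 1 2 * ((u 2 * ζ 0 - u 0 * ζ 2) * (v 0 * ζ 1 - v 1 * ζ 0)
      + (u 0 * ζ 1 - u 1 * ζ 0) * (v 2 * ζ 0 - v 0 * ζ 2)))) * hI

end Split
end AdaptedFrame

/-! ### The contraction of `𝔡 - w 𝒢` with a vector and its projections -/

/-- The contraction `(𝔡_{apcq} - w 𝒢_{apcq}) Z^p Z^q`. -/
noncomputable def xiForm (L : LocalFields) (x : R4) (Z : Fin 4 → ℂ) (a c : Fin 4) : ℂ :=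
  ∑ b, ∑ d, ∑ p, ∑ q,
    (L.frakd x a p c q - L.sw x * calG (L.metric x) (L.vol x) a p c q)
      * ((L.metric x)⁻¹ b p : ℂ) * ((L.metric x)⁻¹ d q : ℂ) * Z b * Z d

lemma sum_contract₂ (W g : Fin 4 → Fin 4 → ℂ) (Z : Fin 4 → ℂ) :
    ∑ b, ∑ d, ∑ p, ∑ q, W p q * g b p * g d q * Z b * Z d
      = ∑ p, ∑ q, W p q * (∑ b, g b p * Z b) * ∑ d, g d q * Z d := by
  have h : ∀ p q, W p q * (∑ b, g b p * Z b) * ∑ d, g d q * Z d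
      = ∑ b, ∑ d, W p q * g b p * g d q * Z b * Z d := by
    intro p q
    rw [mul_assoc, Finset.sum_mul_sum, Finset.mul_sum]
    refine Finset.sum_congr rfl fun b _ => ?_
    rw [Finset.mul_sum]
    exact Finset.sum_congr rfl fun d _ => by ring
  simp only [h]
  conv_lhs => enter [2, b]; rw [Finset.sum_comm]; enter [2, p]; rw [Finset.sum_comm]
  rw [Finset.sum_comm]
  exact Finset.sum_congr rfl fun p _ => Finset.sum_comm

lemma sum_quadratic (A : Matrix (Fin 3) (Fin 3) ℂ) (S S' : Fin 3 → Fin 4 → ℂ) (U : Fin 4 → ℂ) :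
    ∑ p, ∑ q, (∑ k, ∑ l, A k l * S k p * S' l q) * U p * U q
      = ∑ k, ∑ l, A k l * (∑ p, S k p * U p) * ∑ q, S' l q * U q := by
  simp only [Fin.sum_univ_three, Fin.sum_univ_four]
  ring

namespace AdaptedFrame

variable {L : LocalFields} {x : R4} {P Q : Matrix (Fin 4) (Fin 4) ℂ} {s : ℂ}
  {E : Matrix (Fin 3) (Fin 3) ℂ} {σ' υ : Fin 3 → ℂ}

/-- Raising the index of a covector given by its normal and its spatial part. -/
lemma sum_inv_mul (h : AdaptedFrame L x P Q s) (z : ℂ) (y : Fin 3 → ℂ) (p : Fin 4) :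
    ∑ b, ((L.metric x)⁻¹ b p : ℂ) * (-Q 0 b * z + lower Q y b) = P p 0 * z + raise P y p := by
  have h1 : ∀ b, (((L.metric x)⁻¹ b p : ℝ) : ℂ) = ∑ k : Fin 3, P b k.succ * P p k.succ
      - P b 0 * P p 0 := by
    intro b
    rw [← h.hUp_eq, LocalFields.hUp, h.timelike, h.timelike]
    push_cast; ring
  have h2 : ∀ k : Fin 3, ∑ b, Q 0 b * P b k.succ = 0 := fun k => by
    rw [h.orth.dual_apply]; simp [(Fin.succ_ne_zero k).symm]
  have h3 : ∑ b, Q 0 b * P b 0 = 1 := by rw [h.orth.dual_apply]; simp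
  calc _ = -z * (∑ k : Fin 3, (∑ b, Q 0 b * P b k.succ) * P p k.succ)
        + z * (∑ b, Q 0 b * P b 0) * P p 0
        + ∑ k : Fin 3, (∑ b, P b k.succ * lower Q y b) * P p k.succ
        - (∑ b, P b 0 * lower Q y b) * P p 0 := by
        simp only [h1, Fin.sum_univ_three, Fin.sum_univ_four]
        ring
    _ = _ := by
        simp only [h2, h3, h.sum_lower, h.lower_normal, raise]
        simp [mul_comm]

/-- The contraction of a self-dual bivector with a vector, split into a multiple of the normal and a
spatial covector. -/
lemma sdBiv_contract (h : AdaptedFrame L x P Q s) (z : ℂ) (y : Fin 3 → ℂ) (k : Fin 3) (a : Fin 4) :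
    ∑ p, sdBiv Q s k (a, p) * (P p 0 * z + raise P y p)
      = Q 0 a * y k + (-z * Q k.succ a + Complex.I * s *
          lower Q (fun i => ∑ m, (lc3 k i m : ℂ) * y m) a) := by
  have h0 : ∑ p, Q 0 p * raise P y p = 0 := by
    simp only [raise, Finset.mul_sum]
    rw [Finset.sum_comm]
    refine Finset.sum_eq_zero fun l _ => ?_
    simp only [← mul_assoc, ← Finset.sum_mul, h.orth.dual_apply]
    simp [(Fin.succ_ne_zero l).symm]
  calc _ = (∑ p, sdBiv Q s k (a, p) * P p 0) * z + (Q 0 a * (∑ p, Q k.succ p * raise P y p)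
        - Q k.succ a * (∑ p, Q 0 p * raise P y p) + Complex.I * s * ∑ l : Fin 3, ∑ m : Fin 3,
          (lc3 k l m : ℂ) * Q l.succ a * (∑ p, Q m.succ p * raise P y p)) := by
        simp only [sdBiv_apply, Fin.sum_univ_three, Fin.sum_univ_four]
        ring
    _ = _ := by
        simp only [h.orth.sdBiv_normal, h.sum_raise, h0, lower, Finset.mul_sum]
        have : ∀ l m, Complex.I * s * ((lc3 k l m : ℂ) * Q (Fin.succ l) a * y m)
          = Complex.I * s * (Q (Fin.succ l) a * ((lc3 k l m : ℂ) * y m)) := fun l m => by ring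
        simp only [this]
        ring

/-- The contraction `(𝔡_{apcq} - w 𝒢_{apcq}) Z^p Z^q`, with `𝔡` and `𝒢` expanded in the self-dual
bivectors. -/
lemma xiForm_eq (h : AdaptedFrame L x P Q s)
    (hW : bv (L.frakd x) = (sdBiv Q s)ᵀ * E * sdBiv Q s) (z : ℂ) (y : Fin 3 → ℂ) (a c : Fin 4) :
    xiForm L x (fun b => -Q 0 b * z + lower Q y b) a c = ∑ k, ∑ l,
      (E + (L.sw x / 2) • (1 : Matrix (Fin 3) (Fin 3) ℂ)) k l
        * (Q 0 a * y k + (-z * Q k.succ a + Complex.I * s *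
          lower Q (fun i => ∑ m, (lc3 k i m : ℂ) * y m) a))
        * (Q 0 c * y l + (-z * Q l.succ c + Complex.I * s *
          lower Q (fun i => ∑ m, (lc3 l i m : ℂ) * y m) c)) := by
  have h1 : bv (L.frakd x) - L.sw x • bv (calG (L.metric x) (L.vol x))
      = (sdBiv Q s)ᵀ * (E + (L.sw x / 2) • (1 : Matrix (Fin 3) (Fin 3) ℂ)) * sdBiv Q s := by
    rw [h.bv_calG, hW]
    simp only [Matrix.mul_add, Matrix.add_mul, Matrix.mul_smul, Matrix.smul_mul, Matrix.mul_one]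
    module
  have h2 : ∀ p q, L.frakd x a p c q - L.sw x * calG (L.metric x) (L.vol x) a p c q
      = ∑ k, ∑ l, (E + (L.sw x / 2) • (1 : Matrix (Fin 3) (Fin 3) ℂ)) k l
        * sdBiv Q s k (a, p) * sdBiv Q s l (c, q) := by
    intro p q
    have h3 := congrFun (congrFun h1 (a, p)) (c, q)
    have h4 : L.frakd x a p c q - L.sw x * calG (L.metric x) (L.vol x) a p c q
      = (bv (L.frakd x) - L.sw x • bv (calG (L.metric x) (L.vol x))) (a, p) (c, q) := rfl
    rw [h4, h3]
    simp only [Matrix.mul_apply, Matrix.transpose_apply, Fin.sum_univ_three]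
    ring
  set Z : Fin 4 → ℂ := fun b => -Q 0 b * z + lower Q y b with hZ
  simp only [← h.sdBiv_contract z y]
  simp only [← h.sum_inv_mul z y]
  simp only [xiForm, h2]
  have hZb : ∀ b, -Q 0 b * z + lower Q y b = Z b := fun b => rfl
  simp only [hZb]
  generalize E + (L.sw x / 2) • (1 : Matrix (Fin 3) (Fin 3) ℂ) = A
  rw [sum_contract₂ (fun p q => ∑ k, ∑ l, A k l * sdBiv Q s k (a, p) * sdBiv Q s l (c, q))
    (fun b p => ((L.metric x)⁻¹ b p : ℂ)) Z]
  exact sum_quadratic A (fun k p => sdBiv Q s k (a, p)) (fun l q => sdBiv Q s l (c, q))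
    fun p => ∑ b, ((L.metric x)⁻¹ b p : ℂ) * Z b

/-- The orthogonal splitting of `(𝔡_{apcq} - w 𝒢_{apcq}) Z^p Z^q`, where
`Z = 3 w ∇Θ + Θ ∇w`. -/
lemma xiForm_split (h : AdaptedFrame L x P Q s) (hE : Eᵀ = E) (htr : E.trace = 0)
    (hW : bv (L.frakd x) = (sdBiv Q s)ᵀ * E * sdBiv Q s)
    (hσ : (fun a => (L.sigLow x a : ℂ)) = lower Q σ') (hυ : L.wPerp x = lower Q υ) {φ Y : ℂ}
    (hφ : φ ≠ 0) (hY : Y ≠ 0) (hΩ : L.conf x ≠ 0) (a c : Fin 4) :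
    xiForm L x (fun b => -Q 0 b * normalGrad L x + lower Q (gradComp L x σ' υ) b) a c
      = Q 0 a * Q 0 c * (φ * L.lapseSq x φ)
        - φ * Y * (Q 0 a * L.shift x φ Y c + Q 0 c * L.shift x φ Y a)
        + φ * (L.tensorQ x φ a c / (L.conf x : ℂ) ^ 4) := by
  have e10 : E 1 0 = E 0 1 := congrFun (congrFun hE 0) 1
  have e20 : E 2 0 = E 0 2 := congrFun (congrFun hE 0) 2
  have e21 : E 2 1 = E 1 2 := congrFun (congrFun hE 1) 2
  have hΩ' : (L.conf x : ℂ) ≠ 0 := by exact_mod_cast hΩ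
  rw [h.xiForm_eq hW, h.lapseSq_eq hE hW hσ hυ, h.shift_eq hE hW hσ hυ, h.shift_eq hE hW hσ hυ,
    h.tensorQ_eq hE htr hW hσ hυ]
  have h1 : ∀ X : ℂ, φ * ((L.conf x : ℂ) ^ 4 / φ * X / (L.conf x : ℂ) ^ 4) = X := by
    intro X; field_simp
  have h2 : ∀ X : ℂ, φ * (1 / φ * X) = X := by
    intro X; field_simp
  have h3 : ∀ y d, lower Q (fun j => 1 / (Y * φ) * y j) d = 1 / (Y * φ) * lower Q y d := by
    intro y d
    simp only [lower, Fin.sum_univ_three]; ring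
  have h4 : ∀ X X' : ℂ, φ * Y * (Q 0 a * (1 / (Y * φ) * X) + Q 0 c * (1 / (Y * φ) * X'))
      = Q 0 a * X + Q 0 c * X' := by
    intro X X'; field_simp
  rw [h1, h2, h3, h3, h4]
  generalize hζ : gradComp L x σ' υ = ζ
  simp only [gradImage, hζ, lower, cross, Fin.sum_univ_three, Matrix.add_apply, Matrix.smul_apply,
    smul_eq_mul, Matrix.one_apply, lc3_table, e10, e20, e21]
  simp
  ring

/-- The equation `(𝔡_{apcq} - w 𝒢_{apcq}) Z^p Z^q = φ η_a η_c` for a covector `η` with normal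
component `Y` is equivalent to its three orthogonal projections. -/
lemma xiForm_eq_iff (h : AdaptedFrame L x P Q s) (hE : Eᵀ = E) (htr : E.trace = 0)
    (hW : bv (L.frakd x) = (sdBiv Q s)ᵀ * E * sdBiv Q s)
    (hσ : (fun a => (L.sigLow x a : ℂ)) = lower Q σ') (hυ : L.wPerp x = lower Q υ) {φ Y : ℂ}
    (hφ : φ ≠ 0) (hY : Y ≠ 0) (hΩ : L.conf x ≠ 0) (y : Fin 4 → ℂ) (hy : ∑ a, P a 0 * y a = 0) :
    (∀ a c, xiForm L x (fun b => -Q 0 b * normalGrad L x + lower Q (gradComp L x σ' υ) b) a c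
        - φ * (Y * L.normal x a + y a) * (Y * L.normal x c + y c) = 0) ↔
      (Y ^ 2 = L.lapseSq x φ ∧ (∀ c, y c = L.shift x φ Y c) ∧
        ∀ a b, y a * y b = L.tensorQ x φ a b / (L.conf x : ℂ) ^ 4) := by
  have hn0 : ∑ a, P a 0 * Q 0 a = 1 := by
    have := h.orth.dual_apply 0 0
    simpa [mul_comm] using this
  have hsh : ∑ a, P a 0 * L.shift x φ Y a = 0 := by
    simp only [h.shift_eq hE hW hσ hυ, h.lower_normal]
  have hQn : ∀ k : Fin 3, ∑ a, P a 0 * Q k.succ a = 0 := fun k => by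
    have := h.orth.dual_apply k.succ 0
    simpa [mul_comm] using this
  have hten : ∀ c, ∑ a, P a 0 * (L.tensorQ x φ a c / (L.conf x : ℂ) ^ 4) = 0 := by
    intro c
    have h1 : ∀ (k : Fin 3) (y' : Fin 3 → ℂ), ∑ a, P a 0 * (-normalGrad L x * Q k.succ a
        + Complex.I * s * lower Q y' a) = 0 := by
      intro k y'
      have : ∀ a, P a 0 * (-normalGrad L x * Q k.succ a + Complex.I * s * lower Q y' a)
          = -normalGrad L x * (P a 0 * Q k.succ a)
            + Complex.I * s * (P a 0 * lower Q y' a) := fun a => by ring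
      simp only [this, Finset.sum_add_distrib, ← Finset.mul_sum, hQn, h.lower_normal]
      simp
    have h2 : ∀ a, P a 0 * (L.tensorQ x φ a c / (L.conf x : ℂ) ^ 4) = 1 / (L.conf x : ℂ) ^ 4 *
        (P a 0 * L.tensorQ x φ a c) := fun a => by ring
    rw [Finset.sum_congr rfl fun a _ => h2 a, ← Finset.mul_sum]
    simp only [h.tensorQ_eq hE htr hW hσ hυ]
    generalize E + (L.sw x / 2) • (1 : Matrix (Fin 3) (Fin 3) ℂ) = A
    generalize gradComp L x σ' υ = ζ at *
    have h3 : ∀ τ τ' : Fin 3 → Fin 4 → ℂ, (∀ k, ∑ a, P a 0 * τ k a = 0) →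
        ∑ a, P a 0 * ((L.conf x : ℂ) ^ 4 / φ * ∑ k, ∑ l, A k l * τ k a * τ' l c) = 0 := by
      intro τ τ' hτ
      calc _ = (L.conf x : ℂ) ^ 4 / φ * ∑ k, ∑ l, A k l * (∑ a, P a 0 * τ k a) * τ' l c := by
            simp only [Fin.sum_univ_three, Fin.sum_univ_four]; ring
        _ = 0 := by simp [hτ]
    rw [h3 (fun l a => -normalGrad L x * Q l.succ a + Complex.I * s *
          lower Q (fun i => ∑ m, (lc3 l i m : ℂ) * ζ m) a)
      (fun l a => -normalGrad L x * Q l.succ a + Complex.I * s *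
          lower Q (fun i => ∑ m, (lc3 l i m : ℂ) * ζ m) a) fun k => h1 k _, mul_zero]
  have hD : ∀ a c, xiForm L x (fun b => -Q 0 b * normalGrad L x + lower Q (gradComp L x σ' υ) b) a c
      - φ * (Y * L.normal x a + y a) * (Y * L.normal x c + y c)
      = Q 0 a * Q 0 c * (φ * (L.lapseSq x φ - Y ^ 2))
        - φ * Y * (Q 0 a * (L.shift x φ Y c - y c) + Q 0 c * (L.shift x φ Y a - y a))
        + φ * (L.tensorQ x φ a c / (L.conf x : ℂ) ^ 4 - y a * y c) := by
    intro a c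
    rw [h.xiForm_split hE htr hW hσ hυ hφ hY hΩ, h.normal_eq, h.normal_eq]
    ring
  simp only [hD]
  constructor
  · intro h0
    -- one contraction with the normal leaves the lapse and the shift
    have h1 : ∀ c, Q 0 c * (φ * (L.lapseSq x φ - Y ^ 2)) - φ * Y * (L.shift x φ Y c - y c) = 0 := by
      intro c
      have h2 : ∑ a, P a 0 * (Q 0 a * Q 0 c * (φ * (L.lapseSq x φ - Y ^ 2))
          - φ * Y * (Q 0 a * (L.shift x φ Y c - y c) + Q 0 c * (L.shift x φ Y a - y a))
          + φ * (L.tensorQ x φ a c / (L.conf x : ℂ) ^ 4 - y a * y c)) = 0 :=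
        Finset.sum_eq_zero fun a _ => by rw [h0, mul_zero]
      calc _ = (∑ a, P a 0 * Q 0 a) * (Q 0 c * (φ * (L.lapseSq x φ - Y ^ 2)))
            - φ * Y * ((∑ a, P a 0 * Q 0 a) * (L.shift x φ Y c - y c)
              + Q 0 c * (∑ a, P a 0 * L.shift x φ Y a - ∑ a, P a 0 * y a))
            + φ * (∑ a, P a 0 * (L.tensorQ x φ a c / (L.conf x : ℂ) ^ 4)
              - (∑ a, P a 0 * y a) * y c) := by
            rw [hn0, hsh, hy, hten]; ring
        _ = 0 := by
            rw [← h2]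
            simp only [Fin.sum_univ_four]
            ring
    have h3 : φ * (L.lapseSq x φ - Y ^ 2) = 0 := by
      have h4 : ∑ c, P c 0 * (Q 0 c * (φ * (L.lapseSq x φ - Y ^ 2))
          - φ * Y * (L.shift x φ Y c - y c)) = 0 :=
        Finset.sum_eq_zero fun a _ => by rw [h1, mul_zero]
      calc _ = (∑ a, P a 0 * Q 0 a) * (φ * (L.lapseSq x φ - Y ^ 2))
            - φ * Y * (∑ a, P a 0 * L.shift x φ Y a - ∑ a, P a 0 * y a) := by
            rw [hn0, hsh, hy]; ring
        _ = 0 := by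
            rw [← h4]
            simp only [Fin.sum_univ_four]
            ring
    have h5 : ∀ c, L.shift x φ Y c - y c = 0 := by
      intro c
      have := h1 c
      rw [h3, mul_zero, zero_sub, neg_eq_zero] at this
      exact (mul_eq_zero.mp this).resolve_left (mul_ne_zero hφ hY)
    refine ⟨(sub_eq_zero.mp ((mul_eq_zero.mp h3).resolve_left hφ)).symm,
      fun c => (sub_eq_zero.mp (h5 c)).symm, fun a b => ?_⟩
    have h6 := h0 a b
    rw [h3, h5, h5] at h6
    have h7 : φ * (L.tensorQ x φ a b / (L.conf x : ℂ) ^ 4 - y a * y b) = 0 := by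
      linear_combination h6
    exact (sub_eq_zero.mp ((mul_eq_zero.mp h7).resolve_left hφ)).symm
  · rintro ⟨h1, h2, h3⟩ a c
    rw [← h1, ← h2, ← h2, ← h3]
    ring

end AdaptedFrame

/-! ### The scalar `w^∥` as a normal derivative -/

namespace AdaptedFrame

variable {L : LocalFields} {x : R4} {P Q : Matrix (Fin 4) (Fin 4) ℂ} {s : ℂ}
  {E : Matrix (Fin 3) (Fin 3) ℂ}

/-- The self-dual bivectors with both indices along the leaf. -/
lemma sdBiv_spatial (h : AdaptedFrame L x P Q s) (k l r : Fin 3) :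
    ∑ a, ∑ p, sdBiv Q s k (a, p) * P a l.succ * P p r.succ = Complex.I * s * lc3 k l r := by
  have h0 : ∀ j : Fin 3, ∑ a, Q 0 a * P a j.succ = 0 := fun j => by
    rw [h.orth.dual_apply]; simp [(Fin.succ_ne_zero j).symm]
  calc _ = (∑ a, Q 0 a * P a l.succ) * (∑ p, Q k.succ p * P p r.succ)
      - (∑ a, Q k.succ a * P a l.succ) * (∑ p, Q 0 p * P p r.succ)
      + Complex.I * s * ∑ i : Fin 3, ∑ m : Fin 3, (lc3 k i m : ℂ) *
        (∑ a, Q i.succ a * P a l.succ) * ∑ p, Q m.succ p * P p r.succ := by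
        simp only [sdBiv_apply, Fin.sum_univ_three, Fin.sum_univ_four]
        ring
    _ = _ := by
        simp [h0, h.dual_spatial]

/-- The self-dual bivectors with one index along the leaf and one along the normal. -/
lemma sdBiv_spatial_normal (h : AdaptedFrame L x P Q s) (k l : Fin 3) :
    ∑ a, ∑ p, sdBiv Q s k (a, p) * P a l.succ * P p 0 = if k = l then -1 else 0 := by
  have : ∀ a, ∑ p, sdBiv Q s k (a, p) * P a l.succ * P p 0
      = -(Q k.succ a * P a l.succ) := by
    intro a
    have h1 := h.orth.sdBiv_normal k a
    calc _ = P a l.succ * ∑ p, sdBiv Q s k (a, p) * P p 0 := by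
          rw [Finset.mul_sum]; exact Finset.sum_congr rfl fun _ _ => by ring
      _ = _ := by rw [h1]; ring
  simp only [this, Finset.sum_neg_distrib, h.dual_spatial]
  split_ifs <;> simp

lemma sum_spatial (h : AdaptedFrame L x P Q s) (M : Matrix (Fin 3) (Fin 3) ℂ) (l m : Fin 3) :
    ∑ b, ∑ d, P b l.succ * P d m.succ * ((spatial Q)ᵀ * M * spatial Q) b d = M l m := by
  calc _ = ∑ k : Fin 3, ∑ r : Fin 3, (∑ b, Q k.succ b * P b l.succ) * M k r *
        ∑ d, Q r.succ d * P d m.succ := by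
        simp only [Matrix.mul_apply, spatial, Matrix.transpose_apply, Matrix.of_apply,
          Fin.sum_univ_three, Fin.sum_univ_four]
        ring
    _ = _ := by simp [h.dual_spatial]

lemma sum_up2_mul (h : AdaptedFrame L x P Q s) (M N : Matrix (Fin 3) (Fin 3) ℂ) :
    ∑ b, ∑ d, (∑ k, ∑ l, P b (Fin.succ k) * P d (Fin.succ l) * N k l)
        * ((spatial Q)ᵀ * M * spatial Q) b d = ∑ k, ∑ l, N k l * M k l := by
  calc _ = ∑ k : Fin 3, ∑ l : Fin 3, N k l * ∑ b, ∑ d, P b k.succ * P d l.succ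
        * ((spatial Q)ᵀ * M * spatial Q) b d := by
        generalize (spatial Q)ᵀ * M * spatial Q = X
        simp only [Finset.mul_sum, Finset.sum_mul]
        conv_lhs => enter [2, b]; rw [Finset.sum_comm]; enter [2, k]; rw [Finset.sum_comm]
        rw [Finset.sum_comm]
        refine Finset.sum_congr rfl fun k _ => ?_
        rw [Finset.sum_comm]
        exact Finset.sum_congr rfl fun l _ => Finset.sum_congr rfl fun b _ =>
          Finset.sum_congr rfl fun d _ => by ring
    _ = _ := by simp only [h.sum_spatial]

lemma sum_mul_sum_swap {ι κ : Type} [Fintype ι] [Fintype κ] (w : κ → ℂ) (p : ι → κ → ℂ)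
    (Z : ι → ℂ) :
    ∑ r, (∑ m, w m * p r m) * Z r = ∑ m, w m * ∑ r, p r m * Z r := by
  simp only [Finset.sum_mul, Finset.mul_sum]
  rw [Finset.sum_comm]
  exact Finset.sum_congr rfl fun _ _ => Finset.sum_congr rfl fun _ _ => by ring

lemma sum_factor₃ {ι κ : Type} [Fintype ι] [Fintype κ] (u v w : κ → ℂ) (p p' p'' : ι → κ → ℂ)
    (X : ι → ι → ι → ℂ) :
    ∑ i, ∑ j, ∑ r, (∑ k, u k * p i k) * (∑ l, v l * p' j l) * (∑ m, w m * p'' r m) * X i j r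
      = ∑ k, ∑ l, ∑ m, u k * v l * w m * ∑ i, ∑ j, ∑ r, p i k * p' j l * p'' r m * X i j r := by
  have h2 : ∀ k, ∑ i, p i k * ∑ l, v l * ∑ j, p' j l * ∑ m, w m * ∑ r, p'' r m * X i j r
      = ∑ l, v l * ∑ m, w m * ∑ i, p i k * ∑ j, p' j l * ∑ r, p'' r m * X i j r := by
    intro k
    have h3 : ∀ i l, ∑ j, p' j l * ∑ m, w m * ∑ r, p'' r m * X i j r
        = ∑ m, w m * ∑ j, p' j l * ∑ r, p'' r m * X i j r := by
      intro i l
      simp only [Finset.mul_sum, mul_left_comm (p' _ _)]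
      exact Finset.sum_comm
    simp only [h3]
    have h4 : ∀ (f : κ → ℂ) (g : ι → ℂ) (Y : ι → κ → ℂ), ∑ i, g i * ∑ l, f l * Y i l
        = ∑ l, f l * ∑ i, g i * Y i l := by
      intro f g Y
      simp only [Finset.mul_sum, mul_left_comm (g _)]
      exact Finset.sum_comm
    rw [h4]
    simp only [h4]
  simp only [mul_assoc, ← Finset.mul_sum]
  simp only [sum_mul_sum_swap, h2]

lemma sum_comm₃ {ι κ : Type} [Fintype ι] [Fintype κ] (f : ι → κ → κ → κ → ℂ) :
    ∑ i, ∑ k, ∑ l, ∑ m, f i k l m = ∑ k, ∑ l, ∑ m, ∑ i, f i k l m := by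
  rw [Finset.sum_comm]
  refine Finset.sum_congr rfl fun k _ => ?_
  rw [Finset.sum_comm]
  exact Finset.sum_congr rfl fun l _ => Finset.sum_comm

/-- The components of a spatial derivative of a symmetric form on the leaf, from its four-dimensional
covariant derivative. -/
lemma covDEUp_eq (h : AdaptedFrame L x P Q s) (e b d : Fin 4) :
    L.covDEUp x e b d = ∑ k : Fin 3, ∑ l : Fin 3, ∑ m : Fin 3,
      P e k.succ * Q l.succ b * P d m.succ *
        ∑ i, ∑ j, ∑ r, P i k.succ * P j l.succ * P r m.succ * L.nablaE x i j r := by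
  have h1 : ∀ i b j, L.covDE x i b j = ∑ k : Fin 3, ∑ l : Fin 3, ∑ m : Fin 3,
      Q k.succ i * Q l.succ b * Q m.succ j *
        ∑ i, ∑ j, ∑ r, P i k.succ * P j l.succ * P r m.succ * L.nablaE x i j r := by
    intro i b j
    simp only [LocalFields.covDE, h.hMix_eq]
    exact sum_factor₃ (fun k => Q (Fin.succ k) i) (fun k => Q (Fin.succ k) b)
      (fun k => Q (Fin.succ k) j) (fun a k => P a (Fin.succ k)) (fun a k => P a (Fin.succ k))
      (fun a k => P a (Fin.succ k)) (L.nablaE x)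
  have hU : ∀ (e : Fin 4) (k : Fin 3), ∑ i, (L.hUp x e i : ℂ) * Q k.succ i = P e k.succ := by
    intro e k
    simp only [h.hUp_eq, Finset.sum_mul]
    rw [Finset.sum_comm]
    simp only [mul_assoc, mul_comm (P _ _) (Q _ _), ← Finset.mul_sum, h.dual_spatial]
    simp
  simp only [LocalFields.covDEUp, h1, Finset.mul_sum (ι := Fin 3)]
  simp only [sum_comm₃]
  refine Finset.sum_congr rfl fun k _ => Finset.sum_congr rfl fun l _ =>
    Finset.sum_congr rfl fun m _ => ?_
  generalize ∑ i, ∑ j, ∑ r, P i k.succ * P j l.succ * P r m.succ * L.nablaE x i j r = X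
  rw [← hU, ← hU, Finset.sum_mul, Finset.sum_mul, Finset.sum_mul]
  refine Finset.sum_congr rfl fun i _ => ?_
  rw [Finset.mul_sum, Finset.sum_mul]
  exact Finset.sum_congr rfl fun j _ => by ring

/-- The contracted Bianchi identity expresses the normal derivative of the self-dual Weyl tensor
through its derivatives along the leaf. -/
lemma normal_deriv_eq (h : AdaptedFrame L x P Q s) {F : Fin 4 → Matrix (Fin 3) (Fin 3) ℂ}
    {N : Fin 4 → Tensor4} (hN : ∀ e, bv (N e) = (sdBiv Q s)ᵀ * F e * sdBiv Q s)
    (hdiv : ∀ a b c, ∑ e, ∑ d, ((L.metric x)⁻¹ e d : ℂ) * N e a b c d = 0) (k j : Fin 3) :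
    ∑ e, P e 0 * F e k j = -(Complex.I * s * ∑ l, ∑ m : Fin 3, (lc3 l j m : ℂ) *
      ∑ e, P e m.succ * F e k l) := by
  set X : Matrix (Fin 3) (Fin 4) ℂ := Matrix.of fun k c =>
    ∑ e, ∑ d, ((L.metric x)⁻¹ e d : ℂ) * ∑ l, F e k l * sdBiv Q s l (c, d) with hX
  have hTX : (sdBiv Q s)ᵀ * X = 0 := by
    ext ⟨a, b⟩ c
    rw [Matrix.zero_apply, ← hdiv a b c]
    have : ∀ e d, N e a b c d = ∑ k, sdBiv Q s k (a, b) * ∑ l, F e k l * sdBiv Q s l (c, d) := by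
      intro e d
      have := congrFun (congrFun (hN e) (a, b)) (c, d)
      rw [Matrix.mul_assoc] at this
      simpa [bv, Matrix.mul_apply] using this
    simp only [this, Matrix.mul_apply, Matrix.transpose_apply, hX, Matrix.of_apply, Finset.mul_sum]
    rw [Finset.sum_comm]
    refine Finset.sum_congr rfl fun e _ => ?_
    rw [Finset.sum_comm]
    refine Finset.sum_congr rfl fun d _ => Finset.sum_congr rfl fun k _ =>
      Finset.sum_congr rfl fun l _ => by ring
  have hX0 : X = 0 := by
    have h1 : sdBiv Q s * (toC (L.metric x)⁻¹ ⊗ₖ toC (L.metric x)⁻¹) * (sdBiv Q s)ᵀ * X = 0 := by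
      rw [Matrix.mul_assoc, hTX, Matrix.mul_zero]
    rw [h.orth.sdBiv_orthogonal, Matrix.smul_mul, Matrix.one_mul] at h1
    simpa using h1
  have h2 : ∑ c, P c j.succ * X k c = 0 := by simp [hX0]
  have hGi : ∀ e d, (((L.metric x)⁻¹ e d : ℝ) : ℂ) = ∑ i : Fin 3, P e i.succ * P d i.succ
      - P e 0 * P d 0 := by
    intro e d
    rw [← h.hUp_eq, LocalFields.hUp, h.timelike, h.timelike]
    push_cast; ring
  have h3 : ∑ c, P c j.succ * X k c = ∑ l, (∑ i : Fin 3, (∑ e, P e i.succ * F e k l) *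
      (∑ c, ∑ d, sdBiv Q s l (c, d) * P c j.succ * P d i.succ)
      - (∑ e, P e 0 * F e k l) * ∑ c, ∑ d, sdBiv Q s l (c, d) * P c j.succ * P d 0) := by
    simp only [hX, Matrix.of_apply, hGi, Fin.sum_univ_three, Fin.sum_univ_four]
    ring
  rw [h3] at h2
  simp only [h.sdBiv_spatial, h.sdBiv_spatial_normal] at h2
  simp only [Finset.sum_sub_distrib, mul_ite, mul_neg, mul_one, mul_zero, Finset.sum_ite_eq',
    Finset.mem_univ, if_true] at h2
  have h4 : ∑ l, ∑ i : Fin 3, (∑ e, P e i.succ * F e k l) * (Complex.I * s * (lc3 l j i : ℂ))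
      = Complex.I * s * ∑ l, ∑ m : Fin 3, (lc3 l j m : ℂ) * ∑ e, P e m.succ * F e k l := by
    rw [Finset.mul_sum]
    refine Finset.sum_congr rfl fun l _ => ?_
    rw [Finset.mul_sum]
    exact Finset.sum_congr rfl fun i _ => by ring
  rw [h4] at h2
  linear_combination h2

lemma sum_prod_split (S S' : Fin 4 → Fin 4 → ℂ) (u v n κ : Fin 4 → ℂ) :
    ∑ j, ∑ r, u j * v r * ∑ p, ∑ q, S j p * S' r q * (κ p * n q + n p * κ q)
      = (∑ j, ∑ p, S j p * u j * κ p) * (∑ r, ∑ q, S' r q * v r * n q)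
        + (∑ j, ∑ p, S j p * u j * n p) * ∑ r, ∑ q, S' r q * v r * κ q := by
  rw [Finset.sum_mul_sum, Finset.sum_mul_sum, ← Finset.sum_add_distrib]
  refine Finset.sum_congr rfl fun j _ => ?_
  rw [← Finset.sum_add_distrib]
  refine Finset.sum_congr rfl fun r _ => ?_
  rw [Finset.sum_mul_sum, Finset.sum_mul_sum, ← Finset.sum_add_distrib, Finset.mul_sum]
  refine Finset.sum_congr rfl fun p _ => ?_
  rw [← Finset.sum_add_distrib, Finset.mul_sum]
  exact Finset.sum_congr rfl fun q _ => by ring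

lemma sum_pull₂ {ι κ : Type} [Fintype ι] [Fintype κ] (f : ι → ι → ι → ι → κ → κ → ℂ) :
    ∑ j, ∑ r, ∑ p, ∑ q, ∑ u, ∑ v, f j r p q u v
      = ∑ u, ∑ v, ∑ j, ∑ r, ∑ p, ∑ q, f j r p q u v := by
  have h : ∀ g : ι → ι → ι → ι → κ → ℂ, ∑ j, ∑ r, ∑ p, ∑ q, ∑ u, g j r p q u
      = ∑ u, ∑ j, ∑ r, ∑ p, ∑ q, g j r p q u := by
    intro g
    conv_lhs => enter [2, j, 2, r, 2, p]; rw [Finset.sum_comm]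
    conv_lhs => enter [2, j, 2, r]; rw [Finset.sum_comm]
    conv_lhs => enter [2, j]; rw [Finset.sum_comm]
    rw [Finset.sum_comm]
  rw [h]
  exact Finset.sum_congr rfl fun u _ => h _

/-- The components, along the leaf, of the covariant derivative of the electric part of `𝔡`:
differentiating the normal contributes a term with the extrinsic curvature `K`. -/
lemma sum_nablaE (h : AdaptedFrame L x P Q s)
    (hW : bv (L.frakd x) = (sdBiv Q s)ᵀ * E * sdBiv Q s) {F : Fin 4 → Matrix (Fin 3) (Fin 3) ℂ}
    {N : Fin 4 → Tensor4} (hN : ∀ e, bv (N e) = (sdBiv Q s)ᵀ * F e * sdBiv Q s)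
    {B : Fin 4 → Fin 4 → ℂ} {K : Matrix (Fin 3) (Fin 3) ℂ}
    (hK : ∀ k p, ∑ c, P c (Fin.succ k) * B c p = ∑ r, K k r * P p (Fin.succ r))
    (hnE : ∀ e b d, L.nablaE x e b d = ∑ p, ∑ q, N e b p d q * P p 0 * P q 0
      + ∑ p, ∑ q, L.frakd x b p d q * (B e p * P q 0 + P p 0 * B e q)) (k l m : Fin 3) :
    ∑ i, ∑ j, ∑ r, P i k.succ * P j l.succ * P r m.succ * L.nablaE x i j r
      = ∑ e, P e k.succ * F e l m - Complex.I * s *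
        ∑ p, K k p * ∑ u, (E u m * (lc3 u l p : ℂ) + E l u * (lc3 u m p : ℂ)) := by
  have hd : ∀ b p d q, L.frakd x b p d q
      = ∑ u, ∑ v, E u v * sdBiv Q s u (b, p) * sdBiv Q s v (d, q) := by
    intro b p d q
    have h3 := congrFun (congrFun hW (b, p)) (d, q)
    have h4 : L.frakd x b p d q = bv (L.frakd x) (b, p) (d, q) := rfl
    rw [h4, h3]
    simp only [Matrix.mul_apply, Matrix.transpose_apply, Fin.sum_univ_three]
    ring
  have h1 : ∀ i j r, L.nablaE x i j r = ((spatial Q)ᵀ * F i * spatial Q) j r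
      + ∑ p, ∑ q, L.frakd x j p r q * (B i p * P q 0 + P p 0 * B i q) := by
    intro i j r
    rw [hnE, h.orth.sum_normal_normal (hN i)]
  have h2 : ∑ i, ∑ j, ∑ r, P i k.succ * P j l.succ * P r m.succ * L.nablaE x i j r
      = ∑ e, P e k.succ * (∑ b, ∑ d, P b l.succ * P d m.succ *
          ((spatial Q)ᵀ * F e * spatial Q) b d)
        + ∑ j, ∑ r, P j l.succ * P r m.succ * ∑ p, ∑ q, L.frakd x j p r q *
          ((∑ c, P c k.succ * B c p) * P q 0 + P p 0 * ∑ c, P c k.succ * B c q) := by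
    simp only [h1]
    generalize L.frakd x = D
    have h5 : ∑ j, ∑ r, P j l.succ * P r m.succ * ∑ p, ∑ q, D j p r q *
          ((∑ c, P c k.succ * B c p) * P q 0 + P p 0 * ∑ c, P c k.succ * B c q)
        = ∑ i, ∑ j, ∑ r, P i k.succ * P j l.succ * P r m.succ *
          ∑ p, ∑ q, D j p r q * (B i p * P q 0 + P p 0 * B i q) := by
      have h6 : ∀ j r, P j l.succ * P r m.succ * ∑ p, ∑ q, D j p r q *
          ((∑ c, P c k.succ * B c p) * P q 0 + P p 0 * ∑ c, P c k.succ * B c q)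
          = ∑ i, P i k.succ * P j l.succ * P r m.succ *
          ∑ p, ∑ q, D j p r q * (B i p * P q 0 + P p 0 * B i q) := by
        intro j r
        simp only [Finset.sum_mul, Finset.mul_sum, ← Finset.sum_add_distrib]
        conv_lhs => enter [2, p]; rw [Finset.sum_comm]
        rw [Finset.sum_comm]
        exact Finset.sum_congr rfl fun c _ => Finset.sum_congr rfl fun p _ =>
          Finset.sum_congr rfl fun q _ => by ring
      simp only [h6]
      conv_lhs => enter [2, j]; rw [Finset.sum_comm]
      rw [Finset.sum_comm]
    rw [h5, ← Finset.sum_add_distrib]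
    refine Finset.sum_congr rfl fun i _ => ?_
    rw [Finset.mul_sum, ← Finset.sum_add_distrib]
    refine Finset.sum_congr rfl fun j _ => ?_
    rw [Finset.mul_sum, ← Finset.sum_add_distrib]
    exact Finset.sum_congr rfl fun r _ => by ring
  rw [h2]
  simp only [h.sum_spatial, hK]
  have h7 : ∑ j, ∑ r, P j l.succ * P r m.succ * ∑ p, ∑ q, L.frakd x j p r q *
          ((∑ t, K k t * P p t.succ) * P q 0 + P p 0 * ∑ t, K k t * P q t.succ)
      = ∑ t : Fin 3, K k t * ∑ u, ∑ v, E u v *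
        ((∑ j, ∑ p, sdBiv Q s u (j, p) * P j l.succ * P p t.succ) *
          (∑ r, ∑ q, sdBiv Q s v (r, q) * P r m.succ * P q 0)
        + (∑ j, ∑ p, sdBiv Q s u (j, p) * P j l.succ * P p 0) *
          (∑ r, ∑ q, sdBiv Q s v (r, q) * P r m.succ * P q t.succ)) := by
    have h8 := fun u v => sum_prod_split (fun j p => sdBiv Q s u (j, p))
      (fun r q => sdBiv Q s v (r, q))
      (fun j => P j l.succ) (fun r => P r m.succ) (fun q => P q 0)
    calc _ = ∑ u, ∑ v, E u v * ∑ j, ∑ r, P j l.succ * P r m.succ * ∑ p, ∑ q,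
          sdBiv Q s u (j, p) * sdBiv Q s v (r, q) *
          ((∑ t, K k t * P p t.succ) * P q 0 + P p 0 * ∑ t, K k t * P q t.succ) := by
          simp only [hd]
          generalize hX : (fun p q => (∑ t : Fin 3, K k t * P p t.succ) * P q 0
            + P p 0 * ∑ t : Fin 3, K k t * P q t.succ) = X
          have hX' : ∀ p q, (∑ t : Fin 3, K k t * P p t.succ) * P q 0
            + P p 0 * ∑ t : Fin 3, K k t * P q t.succ = X p q := fun p q => congrFun₂ hX p q
          simp only [hX']
          clear hX hX'
          simp only [Finset.sum_mul, Finset.mul_sum]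
          rw [sum_pull₂]
          refine Finset.sum_congr rfl fun u _ => Finset.sum_congr rfl fun v _ =>
            Finset.sum_congr rfl fun j _ => Finset.sum_congr rfl fun r _ =>
            Finset.sum_congr rfl fun p _ => Finset.sum_congr rfl fun q _ => by ring
      _ = _ := by
          simp only [h8]
          have h9 : ∀ (f : Fin 4 → ℂ), ∑ q, f q * ∑ t : Fin 3, K k t * P q t.succ
              = ∑ t : Fin 3, K k t * ∑ q, f q * P q t.succ := by
            intro f
            simp only [Finset.mul_sum, mul_left_comm (f _)]
            exact Finset.sum_comm
          have h10 : ∀ (f : Fin 4 → Fin 4 → ℂ), ∑ r, ∑ q, f r q * ∑ t : Fin 3, K k t * P q t.succ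
              = ∑ t : Fin 3, K k t * ∑ r, ∑ q, f r q * P q t.succ := by
            intro f
            simp only [h9]
            rw [Finset.sum_comm]
            simp only [Finset.mul_sum]
          simp only [h10]
          simp only [Finset.sum_mul (ι := Fin 3), Finset.mul_sum (ι := Fin 3),
            ← Finset.sum_add_distrib (ι := Fin 3)]
          conv_lhs => enter [2, u]; rw [Finset.sum_comm]
          rw [Finset.sum_comm]
          exact Finset.sum_congr rfl fun t _ => Finset.sum_congr rfl fun u _ =>
            Finset.sum_congr rfl fun v _ => by ring
  rw [h7]
  simp only [h.sdBiv_spatial, h.sdBiv_spatial_normal]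
  rw [sub_eq_add_neg, add_right_inj, Finset.mul_sum, ← Finset.sum_neg_distrib]
  refine Finset.sum_congr rfl fun t _ => ?_
  simp only [mul_add, mul_ite, ite_mul, mul_neg, mul_one, mul_zero, neg_mul, one_mul, zero_mul,
    Finset.sum_add_distrib, Finset.sum_ite_eq', Finset.mem_univ, if_true]
  rw [Finset.sum_comm (f := fun u v => if u = l then _ else _)]
  simp only [Finset.sum_ite_eq', Finset.mem_univ, if_true]
  simp only [Finset.sum_neg_distrib, Fin.sum_univ_three]
  ring

lemma sum_eps (h : AdaptedFrame L x P Q s) (X : Fin 4 → Fin 4 → ℂ) (Z : Fin 4 → Fin 4 → Fin 4 → ℂ) :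
    ∑ b, ∑ c, ∑ d, ∑ e, (L.eps x c d e : ℂ) * X b c * Z e b d
      = s * ∑ q : Fin 3, ∑ m : Fin 3, ∑ k : Fin 3, (lc3 q m k : ℂ) *
        ∑ b, (∑ c, Q q.succ c * X b c) * ∑ d, ∑ e, Q m.succ d * Q k.succ e * Z e b d := by
  have h1 : ∀ b c d e, (L.eps x c d e : ℂ) * X b c * Z e b d
      = ∑ q : Fin 3, ∑ m : Fin 3, ∑ k : Fin 3, s * ((lc3 q m k : ℂ) *
        (Q q.succ c * X b c * (Q m.succ d * Q k.succ e * Z e b d))) := by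
    intro b c d e
    rw [h.eps_eq]
    simp only [Finset.mul_sum, Finset.sum_mul]
    exact Finset.sum_congr rfl fun q _ => Finset.sum_congr rfl fun m _ =>
      Finset.sum_congr rfl fun k _ => by ring
  simp only [h1, sum_comm₃ (ι := Fin 4) (κ := Fin 3)]
  simp only [← Finset.mul_sum, Finset.sum_mul]

/-- The scalar `w^∥` is minus the derivative of `w` along the normal.  Here `N e` is the self-dual
part of the derivative `∇_e d_{abcd}` of the rescaled Weyl tensor and `B e p` stands for
`∇_e n^p`. -/
lemma wPar_eq (h : AdaptedFrame L x P Q s) (hE : Eᵀ = E) (htr : E.trace = 0)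
    (hW : bv (L.frakd x) = (sdBiv Q s)ᵀ * E * sdBiv Q s) {F : Fin 4 → Matrix (Fin 3) (Fin 3) ℂ}
    (hF : ∀ e, (F e)ᵀ = F e)
    {N : Fin 4 → Tensor4} (hN : ∀ e, bv (N e) = (sdBiv Q s)ᵀ * F e * sdBiv Q s)
    (hdiv : ∀ a b c, ∑ e, ∑ d, ((L.metric x)⁻¹ e d : ℂ) * N e a b c d = 0)
    (hsa : ∀ e, pd e L.sa x = 32 * (F e * E).trace)
    (hsb : ∀ e, pd e L.sb x = -192 * (F e * (E * E)).trace) {B : Fin 4 → Fin 4 → ℂ}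
    (hnE : ∀ e b d, L.nablaE x e b d = ∑ p, ∑ q, N e b p d q * P p 0 * P q 0
      + ∑ p, ∑ q, L.frakd x b p d q * (B e p * P q 0 + P p 0 * B e q))
    (hBn : ∀ e, ∑ p, Q 0 p * B e p = 0)
    (hB : ∀ c d, ((pd c (fun y => L.normal y d) x
      - ∑ e, christoffel L.metric x e c d * L.normal x e : ℝ) : ℂ)
        = ∑ p, (L.metric x d p : ℂ) * B c p) (ha0 : L.sa x ≠ 0) :
    L.wPar x = -∑ e, P e 0 * ((L.sb x * pd e L.sa x - L.sa x * pd e L.sb x)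
      / (2 * L.sa x ^ 2)) := by
  set K : Matrix (Fin 3) (Fin 3) ℂ := Matrix.of fun k l =>
    ∑ c, ∑ p, P c k.succ * Q l.succ p * B c p with hKdef
  have hK : ∀ k p, ∑ c, P c (Fin.succ k) * B c p = ∑ r, K k r * P p (Fin.succ r) := by
    intro k p
    have h1 : ∀ c, B c p = ∑ r : Fin 3, (∑ q, Q r.succ q * B c q) * P p r.succ := by
      intro c
      calc B c p = ∑ q, (∑ i, P p i * Q i q) * B c q := by
            simp [h.orth.dual_apply']
        _ = P p 0 * (∑ q, Q 0 q * B c q)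
            + ∑ r : Fin 3, (∑ q, Q r.succ q * B c q) * P p r.succ := by
            simp only [Fin.sum_univ_succ (n := 3) (f := fun i => P p i * Q i _)]
            simp only [Fin.sum_univ_three, Fin.sum_univ_four]
            ring
        _ = _ := by rw [hBn]; ring
    simp only [h1 _, hKdef, Matrix.of_apply, Finset.mul_sum, Finset.sum_mul]
    conv_lhs => rw [Finset.sum_comm]
    refine Finset.sum_congr rfl fun r _ => Finset.sum_congr rfl fun c _ =>
      Finset.sum_congr rfl fun q _ => by ring
  have hextK : ∀ a b, (L.extK x a b : ℂ) = ((spatial Q)ᵀ * K * spatial Q) a b := by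
    intro a b
    have h1 : ∀ d p, ((L.metric x d p : ℝ) : ℂ) = ∑ k : Fin 3, Q k.succ d * Q k.succ p
        - Q 0 d * Q 0 p := by
      intro d p
      rw [← h.h_eq, LocalFields.h]
      push_cast
      rw [h.normal_eq, h.normal_eq]; ring
    have h2 : ∀ c d, ∑ p, (L.metric x d p : ℂ) * B c p
        = ∑ k : Fin 3, Q k.succ d * ∑ p, Q k.succ p * B c p := by
      intro c d
      have h3 := hBn c
      simp only [h1, Fin.sum_univ_three, Fin.sum_univ_four] at h3 ⊢
      linear_combination -Q 0 d * h3
    rw [LocalFields.extK, Complex.ofReal_sum]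
    simp only [Complex.ofReal_sum, Complex.ofReal_mul]
    have h4 : ∀ c d, ((pd c (fun y => L.normal y d) x
      - ∑ e, christoffel L.metric x e c d * L.normal x e : ℝ) : ℂ)
        = ∑ k : Fin 3, Q k.succ d * ∑ p, Q k.succ p * B c p := fun c d => by
      rw [hB, h2]
    simp only [h4, h.hMix_eq]
    have h5 : ∀ c, ∑ d, (∑ l : Fin 3, Q l.succ b * P d l.succ) *
        (∑ k : Fin 3, Q k.succ d * ∑ p, Q k.succ p * B c p)
        = ∑ l : Fin 3, Q l.succ b * ∑ p, Q l.succ p * B c p := by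
      intro c
      calc _ = ∑ l : Fin 3, Q l.succ b * ∑ k : Fin 3, (∑ d, Q k.succ d * P d l.succ) *
            ∑ p, Q k.succ p * B c p := by
            generalize (fun k : Fin 3 => ∑ p, Q k.succ p * B c p) = Z
            simp only [Fin.sum_univ_three, Fin.sum_univ_four]
            ring
        _ = _ := by simp [h.dual_spatial]
    simp only [mul_assoc, ← Finset.mul_sum, h5]
    simp only [hKdef, Matrix.mul_apply, spatial, Matrix.transpose_apply, Matrix.of_apply,
      Fin.sum_univ_three, Fin.sum_univ_four]
    ring
  set A : Matrix (Fin 3) (Fin 3) ℂ := (-4 : ℂ) • (E * E) + (L.sa x / 12) • 1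
    - (L.sb x / L.sa x) • E with hA
  have hcE := h.calE_eq hW
  have hcA : ∀ a b, L.frakA x a b = ((spatial Q)ᵀ * A * spatial Q) a b := h.frakA_eq hW
  have hev := evolution_identity (E := E) (A := A) (K := K) (Fn := ∑ e, P e 0 • F e)
    (F := fun m => ∑ e, P e m.succ • F e)
    (Fh := fun k l m => ∑ i, ∑ j, ∑ r, P i k.succ * P j l.succ * P r m.succ * L.nablaE x i j r)
    h.orth.sq hE htr (fun m => by simp [Matrix.transpose_sum, hF])
    (fun k j => by
      simp only [Matrix.sum_apply, Matrix.smul_apply, smul_eq_mul]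
      exact h.normal_deriv_eq hN hdiv k j)
    (fun k l m => by
      simp only [Matrix.sum_apply, Matrix.smul_apply, smul_eq_mul]
      exact h.sum_nablaE hW hN hK hnE k l m)
    (h.sa_eq hE hW) (h.sb_eq hW) ha0 hA
  have hlhs : -∑ e, P e 0 * ((L.sb x * pd e L.sa x - L.sa x * pd e L.sb x)
      / (2 * L.sa x ^ 2)) = -((L.sb x * (32 * ((∑ e, P e 0 • F e) * E).trace)
        - L.sa x * (-192 * ((∑ e, P e 0 • F e) * (E * E)).trace)) / (2 * L.sa x ^ 2)) := by
    simp only [hsa, hsb, Matrix.sum_mul, Matrix.smul_mul, Matrix.trace_sum, Matrix.trace_smul,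
      smul_eq_mul]
    simp only [Fin.sum_univ_four]
    ring
  rw [hlhs, hev, LocalFields.wPar]
  congr 1
  · congr 1
    have h1 : ∀ b c, L.sb x ^ 2 * L.calE x b c + L.sa x * (L.sb x * L.frakA x b c
        - 12 * L.sa x * ∑ d, L.mix x (L.calE x) b d * L.frakA x c d)
        = ((spatial Q)ᵀ * (L.sb x ^ 2 • E + L.sa x • (L.sb x • A - (12 * L.sa x) • (E * Aᵀ)))
          * spatial Q) b c := by
      intro b c
      have h2 : ∑ d, L.mix x (L.calE x) b d * L.frakA x c d
          = ((spatial Q)ᵀ * (E * Aᵀ) * spatial Q) b c := by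
        have h3 : ∀ d, L.frakA x c d = lower Q (fun l => ∑ k, Q k.succ c * A k l) d := by
          intro d
          rw [hcA]
          simp only [Matrix.mul_apply, spatial, lower, Matrix.transpose_apply, Matrix.of_apply,
            Fin.sum_univ_three]
          ring
        simp only [h.mix_eq hcE, h3, h.sum_raise_mul_lower]
        simp only [Matrix.mul_apply, spatial, Matrix.transpose_apply, Matrix.of_apply,
            Fin.sum_univ_three]
        ring
      rw [h2, hcE, hcA]
      simp only [Matrix.mul_add, Matrix.mul_sub, Matrix.add_mul, Matrix.sub_mul, Matrix.mul_smul,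
        Matrix.smul_mul, Matrix.add_apply, Matrix.sub_apply, Matrix.smul_apply, smul_eq_mul]
    simp only [h1, h.up2_eq hextK]
    rw [h.sum_up2_mul]
    simp only [Matrix.add_apply, Matrix.sub_apply, Matrix.smul_apply, smul_eq_mul]
  · congr 1
    have htrK : (L.trK x : ℂ) = K.trace := by
      rw [LocalFields.trK]
      push_cast
      simp only [h.hUp_eq, hextK]
      have := h.sum_up2_mul K 1
      simp only [Matrix.one_apply, mul_ite, mul_one, mul_zero, ite_mul, one_mul, zero_mul,
        Finset.sum_ite_eq, Finset.mem_univ, if_true] at this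
      rw [this]
      rfl
    rw [htrK]
    congr 2
    have h1 : ∀ b c, L.sb x * L.up2 x (L.calE x) b c + 3 * L.sa x * L.up2 x (L.frakA x) b c
        = ∑ k, ∑ l, P b (Fin.succ k) * P c (Fin.succ l)
          * (L.sb x * E k l + 3 * L.sa x * A k l) := by
      intro b c
      rw [h.up2_eq hcE, h.up2_eq hcA]
      simp only [Finset.mul_sum, ← Finset.sum_add_distrib]
      exact Finset.sum_congr rfl fun k _ => Finset.sum_congr rfl fun l _ => by ring
    simp only [h1]
    have h2 := h.sum_eps (fun b c => ∑ k, ∑ l, P b (Fin.succ k) * P c (Fin.succ l) *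
      (L.sb x * E k l + 3 * L.sa x * A k l)) (L.covDEUp x)
    rw [h2]
    congr 1
    have h3 : ∀ (q : Fin 3) b, ∑ c, Q q.succ c * ∑ k, ∑ l, P b (Fin.succ k) * P c (Fin.succ l) *
        (L.sb x * E k l + 3 * L.sa x * A k l)
        = raise P (fun k => L.sb x * E k q + 3 * L.sa x * A k q) b := by
      intro q b
      calc _ = ∑ k : Fin 3, P b k.succ * ∑ l : Fin 3, (∑ c, Q q.succ c * P c l.succ) *
            (L.sb x * E k l + 3 * L.sa x * A k l) := by
            simp only [Fin.sum_univ_three, Fin.sum_univ_four]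
            ring
        _ = _ := by simp [h.dual_spatial, raise]
    have h4 : ∀ (m k : Fin 3) b, ∑ d, ∑ e, Q m.succ d * Q k.succ e * L.covDEUp x e b d
        = lower Q (fun l => ∑ i, ∑ j, ∑ r, P i k.succ * P j l.succ * P r m.succ
          * L.nablaE x i j r) b := by
      intro m k b
      simp only [h.covDEUp_eq]
      generalize hN' : (fun k l m : Fin 3 => ∑ i, ∑ j, ∑ r, P i k.succ * P j l.succ * P r m.succ
          * L.nablaE x i j r) = N'
      have hN'' : ∀ k l m : Fin 3, ∑ i, ∑ j, ∑ r, P i k.succ * P j l.succ * P r m.succ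
          * L.nablaE x i j r = N' k l m := fun k l m => by rw [← hN']
      simp only [hN'']
      calc _ = ∑ k' : Fin 3, ∑ l : Fin 3, ∑ m' : Fin 3, (∑ e, Q k.succ e * P e k'.succ) * Q l.succ b
            * (∑ d, Q m.succ d * P d m'.succ) * N' k' l m' := by
            simp only [Finset.mul_sum (ι := Fin 3)]
            simp only [sum_comm₃ (ι := Fin 4) (κ := Fin 3)]
            refine Finset.sum_congr rfl fun k' _ => Finset.sum_congr rfl fun l _ =>
              Finset.sum_congr rfl fun m' _ => ?_
            simp only [Fin.sum_univ_four]
            ring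
        _ = _ := by simp [h.dual_spatial, lower]
    simp only [h3, h4, h.sum_raise_mul_lower]
    simp only [Finset.mul_sum (ι := Fin 3)]
    rw [sum_comm₃, Finset.sum_comm]
    refine Finset.sum_congr rfl fun k _ => ?_
    rw [Finset.sum_comm]
    exact Finset.sum_congr rfl fun l _ => Finset.sum_congr rfl fun m _ =>
      Finset.sum_congr rfl fun q _ => (mul_assoc _ _ _).symm

end AdaptedFrame

/-! ### Splitting of the gradients -/

namespace AdaptedFrame

variable {L : LocalFields} {x : R4} {P Q : Matrix (Fin 4) (Fin 4) ℂ} {s : ℂ}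
  {E : Matrix (Fin 3) (Fin 3) ℂ}

lemma sum_hMix (h : AdaptedFrame L x P Q s) (v : Fin 4 → ℂ) (a : Fin 4) :
    ∑ b, (L.hMix x a b : ℂ) * v b = lower Q (fun k => ∑ b, P b k.succ * v b) a := by
  simp only [h.hMix_eq, lower, Finset.sum_mul, Finset.mul_sum]
  rw [Finset.sum_comm]
  exact Finset.sum_congr rfl fun k _ => Finset.sum_congr rfl fun b _ => mul_assoc _ _ _

lemma split_covector (h : AdaptedFrame L x P Q s) (v : Fin 4 → ℂ) (a : Fin 4) :
    v a = Q 0 a * (∑ b, P b 0 * v b) + lower Q (fun k => ∑ b, P b k.succ * v b) a := by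
  have h1 := fun b => h.orth.dual_apply' b a
  calc v a = ∑ b, (∑ i, P b i * Q i a) * v b := by simp [h1]
    _ = _ := by
      simp only [Fin.sum_univ_succ (n := 3) (f := fun i => P _ i * Q i _), lower,
        Fin.sum_univ_three, Fin.sum_univ_four]
      ring

lemma sigLow_eq (h : AdaptedFrame L x P Q s) : (fun a => (L.sigLow x a : ℂ))
    = lower Q fun k => ∑ b, P b k.succ * ((pd b L.conf x : ℝ) : ℂ) := by
  ext a
  rw [← h.sum_hMix fun b => ((pd b L.conf x : ℝ) : ℂ), LocalFields.sigLow]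
  push_cast
  rfl

lemma wPerp_eq (h : AdaptedFrame L x P Q s)
    (hsw : ∀ a, pd a L.sw x
      = (L.sb x * pd a L.sa x - L.sa x * pd a L.sb x) / (2 * L.sa x ^ 2)) :
    L.wPerp x = lower Q fun k => ∑ b, P b k.succ * pd b L.sw x := by
  ext a
  rw [← h.sum_hMix fun b => pd b L.sw x, LocalFields.wPerp, LocalFields.gradD, LocalFields.gradD,
    Finset.mul_sum, Finset.mul_sum, ← Finset.sum_sub_distrib, Finset.sum_div]
  exact Finset.sum_congr rfl fun b _ => by rw [hsw]; ring

/-- The orthogonal splitting of `3 w ∇_a Θ + Θ ∇_a w`. -/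
lemma grad_eq (h : AdaptedFrame L x P Q s)
    (hpar : L.wPar x = -∑ e, P e 0 * pd e L.sw x) (a : Fin 4) :
    3 * L.sw x * ((pd a L.conf x : ℝ) : ℂ) + L.conf x * pd a L.sw x
      = -Q 0 a * normalGrad L x + lower Q (gradComp L x
        (fun k => ∑ b, P b k.succ * ((pd b L.conf x : ℝ) : ℂ))
        (fun k => ∑ b, P b k.succ * pd b L.sw x)) a := by
  rw [h.split_covector (fun a => ((pd a L.conf x : ℝ) : ℂ)) a,
    h.split_covector (fun a => pd a L.sw x) a, normalGrad, hpar, LocalFields.sig]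
  push_cast
  simp only [← h.timelike]
  have : ∀ u v : Fin 3 → ℂ, lower Q (gradComp L x u v) a
      = 3 * L.sw x * lower Q u a + L.conf x * lower Q v a := by
    intro u v
    simp only [lower, gradComp, Fin.sum_univ_three]
    ring
  rw [this]
  ring

end AdaptedFrame

/-! ### Partial derivatives in the coordinate space -/

section Calculus

variable {F : Type} [NormedCommRing F] [NormedAlgebra ℝ F] {f g : R4 → F} {x : R4} {i : Fin 4}

lemma pd_add (hf : DifferentiableAt ℝ f x) (hg : DifferentiableAt ℝ g x) :
    pd i (fun y => f y + g y) x = pd i f x + pd i g x := by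
  simp only [pd, fderiv_fun_add hf hg, _root_.add_apply]

lemma pd_sub (hf : DifferentiableAt ℝ f x) (hg : DifferentiableAt ℝ g x) :
    pd i (fun y => f y - g y) x = pd i f x - pd i g x := by
  simp only [pd, fderiv_fun_sub hf hg, _root_.sub_apply]

lemma pd_neg : pd i (fun y => -f y) x = -pd i f x := by
  simp only [pd, fderiv_fun_neg, _root_.neg_apply]

lemma pd_mul (hf : DifferentiableAt ℝ f x) (hg : DifferentiableAt ℝ g x) :
    pd i (fun y => f y * g y) x = pd i f x * g x + f x * pd i g x := by
  simp only [pd, fderiv_fun_mul hf hg, _root_.add_apply, _root_.smul_apply,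
    smul_eq_mul]
  ring

lemma pd_const (c : F) : pd i (fun _ => c) x = 0 := by
  simp [pd]

lemma pd_const_mul (c : F) (hf : DifferentiableAt ℝ f x) :
    pd i (fun y => c * f y) x = c * pd i f x := by
  rw [pd_mul (differentiableAt_const c) hf, pd_const, zero_mul, zero_add]

lemma pd_sum {ι : Type} {s : Finset ι} {h : ι → R4 → F}
    (hh : ∀ k ∈ s, DifferentiableAt ℝ (h k) x) :
    pd i (fun y => ∑ k ∈ s, h k y) x = ∑ k ∈ s, pd i (h k) x := by
  simp only [pd, fderiv_fun_sum hh, _root_.sum_apply]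

lemma pd_congr (h : f =ᶠ[nhds x] g) : pd i f x = pd i g x := by
  rw [pd, h.fderiv_eq, pd]

lemma pd_ofReal {f : R4 → ℝ} (hf : DifferentiableAt ℝ f x) :
    pd i (fun y => (f y : ℂ)) x = ((pd i f x : ℝ) : ℂ) := by
  have := (Complex.ofRealCLM.hasFDerivAt (x := f x)).comp x hf.hasFDerivAt
  simp only [pd]
  rw [HasFDerivAt.fderiv (f := fun y => (f y : ℂ)) this]
  rfl

lemma differentiableAt_ofReal {f : R4 → ℝ} (hf : DifferentiableAt ℝ f x) :
    DifferentiableAt ℝ (fun y => (f y : ℂ)) x :=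
  (Complex.ofRealCLM.differentiableAt (x := f x)).comp x hf

lemma contDiffOn_pd {U : Set R4} (hU : IsOpen U) (hf : ContDiffOn ℝ ∞ f U) :
    ContDiffOn ℝ ∞ (pd i f) U :=
  (hf.fderiv_of_isOpen hU (m := ∞) (by simp)).clm_apply contDiffOn_const

lemma pd_comm {U : Set R4} (hU : IsOpen U) (hf : ContDiffOn ℝ ∞ f U) (hx : x ∈ U) (j : Fin 4) :
    pd i (fun y => pd j f y) x = pd j (fun y => pd i f y) x := by
  have hfx : ContDiffAt ℝ ∞ f x := hf.contDiffAt (hU.mem_nhds hx)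
  have h1 : DifferentiableAt ℝ (fderiv ℝ f) x :=
    ((hf.fderiv_of_isOpen hU (m := ∞) (by simp)).contDiffAt (hU.mem_nhds hx)).differentiableAt
      (by simp)
  have h2 := hfx.isSymmSndFDerivAt (by simp only [minSmoothness_of_isRCLikeNormedField]; exact WithTop.coe_le_coe.mpr le_top)
  have h3 : ∀ i j, pd i (fun y => pd j f y) x
      = fderiv ℝ (fderiv ℝ f) x (EuclideanSpace.single i 1) (EuclideanSpace.single j 1) := by
    intro i j
    simp only [pd]
    rw [fderiv_clm_apply h1 (differentiableAt_const _)]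
    simp
  rw [h3, h3]
  exact h2 _ _

lemma ContDiffOn.differentiableAt_of_mem {U : Set R4} (hU : IsOpen U) (hf : ContDiffOn ℝ ∞ f U)
    (hx : x ∈ U) : DifferentiableAt ℝ f x :=
  (hf.contDiffAt (hU.mem_nhds hx)).differentiableAt (by simp)

/-! ### Entrywise derivatives of matrix-valued functions -/

variable {l m n : Type}

/-- The entrywise partial derivative of a matrix-valued function. -/
noncomputable def mpd (i : Fin 4) (M : R4 → Matrix l m F) (x : R4) : Matrix l m F :=
  Matrix.of fun a b => pd i (fun y => M y a b) x

/-- Entrywise differentiability of a matrix-valued function. -/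
def EntryDiffAt (M : R4 → Matrix l m F) (x : R4) : Prop :=
  ∀ a b, DifferentiableAt ℝ (fun y => M y a b) x

lemma mpd_mul [Fintype m] {M : R4 → Matrix l m F} {N : R4 → Matrix m n F} (hM : EntryDiffAt M x)
    (hN : EntryDiffAt N x) :
    mpd i (fun y => M y * N y) x = mpd i M x * N x + M x * mpd i N x := by
  ext a b
  simp only [mpd, Matrix.mul_apply, Matrix.of_apply, Matrix.add_apply]
  rw [pd_sum (h := fun k y => M y a k * N y k b) fun k _ => (hM a k).mul (hN k b),
    ← Finset.sum_add_distrib]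
  exact Finset.sum_congr rfl fun k _ => pd_mul (hM a k) (hN k b)

lemma EntryDiffAt.mul [Fintype m] {M : R4 → Matrix l m F} {N : R4 → Matrix m n F}
    (hM : EntryDiffAt M x)
    (hN : EntryDiffAt N x) : EntryDiffAt (fun y => M y * N y) x := by
  intro a b
  simp only [Matrix.mul_apply]
  exact DifferentiableAt.fun_sum fun k _ => (hM a k).mul (hN k b)

lemma mpd_add {M N : R4 → Matrix l m F} (hM : EntryDiffAt M x) (hN : EntryDiffAt N x) :
    mpd i (fun y => M y + N y) x = mpd i M x + mpd i N x := by
  ext a b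
  exact pd_add (hM a b) (hN a b)

lemma mpd_sub {M N : R4 → Matrix l m F} (hM : EntryDiffAt M x) (hN : EntryDiffAt N x) :
    mpd i (fun y => M y - N y) x = mpd i M x - mpd i N x := by
  ext a b
  exact pd_sub (hM a b) (hN a b)

lemma EntryDiffAt.add {M N : R4 → Matrix l m F} (hM : EntryDiffAt M x) (hN : EntryDiffAt N x) :
    EntryDiffAt (fun y => M y + N y) x := fun a b => (hM a b).add (hN a b)

lemma EntryDiffAt.sub {M N : R4 → Matrix l m F} (hM : EntryDiffAt M x) (hN : EntryDiffAt N x) :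
    EntryDiffAt (fun y => M y - N y) x := fun a b => (hM a b).sub (hN a b)

lemma mpd_smul (c : F) {M : R4 → Matrix l m F} (hM : EntryDiffAt M x) :
    mpd i (fun y => c • M y) x = c • mpd i M x := by
  ext a b
  exact pd_const_mul c (hM a b)

lemma EntryDiffAt.smul (c : F) {M : R4 → Matrix l m F} (hM : EntryDiffAt M x) :
    EntryDiffAt (fun y => c • M y) x := fun a b => (differentiableAt_const c).mul (hM a b)

lemma mpd_transpose {M : R4 → Matrix l m F} : mpd i (fun y => (M y)ᵀ) x = (mpd i M x)ᵀ := rfl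

lemma EntryDiffAt.transpose {M : R4 → Matrix l m F} (hM : EntryDiffAt M x) :
    EntryDiffAt (fun y => (M y)ᵀ) x :=
  fun a b => hM b a

lemma mpd_congr {M N : R4 → Matrix l m F} (h : M =ᶠ[nhds x] N) : mpd i M x = mpd i N x := by
  ext a b
  exact pd_congr (h.fun_comp fun M => M a b)

lemma pd_trace [Fintype m] {M : R4 → Matrix m m F} (hM : EntryDiffAt M x) :
    pd i (fun y => (M y).trace) x = (mpd i M x).trace :=
  pd_sum fun k _ => hM k k

lemma mpd_comm {U : Set R4} (hU : IsOpen U) {M : R4 → Matrix l m F}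
    (hM : ∀ a b, ContDiffOn ℝ ∞ (fun y => M y a b) U) (hx : x ∈ U) (j : Fin 4) :
    mpd i (mpd j M) x = mpd j (mpd i M) x := by
  ext a b
  exact pd_comm hU (hM a b) hx j

end Calculus

/-! ### The Levi-Civita connection and the Bianchi identity -/

/-- The components of a smooth nondegenerate metric on an open set of the coordinate space. -/
structure SmoothMetric (U : Set R4) (G : R4 → Matrix (Fin 4) (Fin 4) ℝ) : Prop where
  isOpen : IsOpen U
  smooth : ∀ i j, ContDiffOn ℝ ∞ (fun y => G y i j) U
  symm : ∀ y ∈ U, (G y)ᵀ = G y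
  det : ∀ y ∈ U, IsUnit (G y).det

/-- The matrices `(A_a)^d_c = Γ^d_{ac}` of the Levi-Civita connection. -/
noncomputable def conn (G : R4 → Matrix (Fin 4) (Fin 4) ℝ) (a : Fin 4) (x : R4) :
    Matrix (Fin 4) (Fin 4) ℝ :=
  Matrix.of fun d c => christoffel G x d a c

/-- The curvature matrices `(F_{ab})^d_c = R_{abc}{}^d`. -/
noncomputable def curv (G : R4 → Matrix (Fin 4) (Fin 4) ℝ) (a b : Fin 4) (x : R4) :
    Matrix (Fin 4) (Fin 4) ℝ :=
  Matrix.of fun d c => riemann G x a b c d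

lemma curv_eq (G : R4 → Matrix (Fin 4) (Fin 4) ℝ) (a b : Fin 4) (x : R4) :
    curv G a b x = mpd b (conn G a) x - mpd a (conn G b) x
      + conn G b x * conn G a x - conn G a x * conn G b x := by
  ext d c
  simp only [curv, riemann, Matrix.of_apply, Matrix.sub_apply, Matrix.add_apply, Matrix.mul_apply,
    conn, mpd, Finset.sum_sub_distrib]
  simp only [mul_comm]
  ring

lemma contDiffOn_det {U : Set R4} {n : Type} [Fintype n] [DecidableEq n] {M : R4 → Matrix n n ℝ}
    (hM : ∀ i j, ContDiffOn ℝ ∞ (fun y => M y i j) U) :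
    ContDiffOn ℝ ∞ (fun y => (M y).det) U := by
  simp only [Matrix.det_apply, Units.smul_def, zsmul_eq_mul]
  exact ContDiffOn.sum fun σ _ => contDiffOn_const.mul (contDiffOn_prod fun i _ => hM _ _)

namespace SmoothMetric

variable {U : Set R4} {G : R4 → Matrix (Fin 4) (Fin 4) ℝ} {x : R4}

lemma smooth_inv (h : SmoothMetric U G) (i j : Fin 4) :
    ContDiffOn ℝ ∞ (fun y => (G y)⁻¹ i j) U := by
  simp only [Matrix.inv_def, Ring.inverse_eq_inv', Matrix.smul_apply, smul_eq_mul,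
    Matrix.adjugate_apply]
  refine ((contDiffOn_det h.smooth).inv fun y hy => (h.det y hy).ne_zero).mul
    (contDiffOn_det fun k l => ?_)
  simp only [Matrix.updateRow_apply]
  split_ifs
  · exact contDiffOn_const
  · exact h.smooth _ _

lemma smooth_christoffel (h : SmoothMetric U G) (k i j : Fin 4) :
    ContDiffOn ℝ ∞ (fun y => christoffel G y k i j) U := by
  simp only [christoffel]
  exact contDiffOn_const.mul (ContDiffOn.sum fun l _ => (h.smooth_inv k l).mul
    (((contDiffOn_pd h.isOpen (h.smooth _ _)).add (contDiffOn_pd h.isOpen (h.smooth _ _))).sub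
      (contDiffOn_pd h.isOpen (h.smooth _ _))))

lemma inv_mul (h : SmoothMetric U G) (hx : x ∈ U) : (G x)⁻¹ * G x = 1 :=
  Matrix.nonsing_inv_mul _ (h.det x hx)

lemma mul_inv (h : SmoothMetric U G) (hx : x ∈ U) : G x * (G x)⁻¹ = 1 :=
  Matrix.mul_nonsing_inv _ (h.det x hx)

lemma apply_symm (h : SmoothMetric U G) (hx : x ∈ U) (i j : Fin 4) : G x i j = G x j i :=
  congrFun (congrFun (h.symm x hx) j) i

lemma inv_transpose (h : SmoothMetric U G) (hx : x ∈ U) : ((G x)⁻¹)ᵀ = (G x)⁻¹ := by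
  rw [Matrix.transpose_nonsing_inv, h.symm x hx]

lemma inv_symm (h : SmoothMetric U G) (hx : x ∈ U) (i j : Fin 4) : (G x)⁻¹ i j = (G x)⁻¹ j i :=
  congrFun (congrFun (h.inv_transpose hx) j) i

lemma pd_symm (h : SmoothMetric U G) (hx : x ∈ U) (a i j : Fin 4) :
    pd a (fun y => G y i j) x = pd a (fun y => G y j i) x :=
  pd_congr (Filter.eventuallyEq_of_mem (h.isOpen.mem_nhds hx) fun _ hy => h.apply_symm hy i j)

lemma christoffel_symm (h : SmoothMetric U G) (hx : x ∈ U) (k i j : Fin 4) :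
    christoffel G x k i j = christoffel G x k j i := by
  simp only [christoffel]
  congr 1
  refine Finset.sum_congr rfl fun l _ => ?_
  rw [h.pd_symm hx l i j]
  ring

/-- The Christoffel symbols of the first kind. -/
lemma lower_christoffel (h : SmoothMetric U G) (hx : x ∈ U) (d a c : Fin 4) :
    ∑ e, G x d e * christoffel G x e a c = 1 / 2 * (pd a (fun y => G y c d) x
      + pd c (fun y => G y a d) x - pd d (fun y => G y a c) x) := by
  have h1 : ∀ l, ∑ e, G x d e * (G x)⁻¹ e l = if d = l then 1 else 0 := fun l => by
    rw [← Matrix.mul_apply, h.mul_inv hx, Matrix.one_apply]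
  simp only [christoffel]
  have h2 : ∀ e, G x d e * (1 / 2 * ∑ l, (G x)⁻¹ e l * (pd a (fun y => G y c l) x
      + pd c (fun y => G y a l) x - pd l (fun y => G y a c) x))
      = 1 / 2 * ∑ l, G x d e * (G x)⁻¹ e l * (pd a (fun y => G y c l) x
      + pd c (fun y => G y a l) x - pd l (fun y => G y a c) x) := by
    intro e
    rw [mul_left_comm, Finset.mul_sum]
    simp only [mul_assoc]
  simp only [h2]
  rw [← Finset.mul_sum, Finset.sum_comm]
  simp [← Finset.sum_mul, h1]

/-- The metric is covariantly constant, in matrix form. -/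
lemma compat (h : SmoothMetric U G) (hx : x ∈ U) (a : Fin 4) :
    mpd a G x = (conn G a x)ᵀ * G x + G x * conn G a x := by
  ext c d
  have h1 := h.lower_christoffel hx d a c
  have h2 := h.lower_christoffel hx c a d
  have h3 : ((conn G a x)ᵀ * G x) c d = ∑ e, G x d e * christoffel G x e a c := by
    simp only [Matrix.mul_apply, conn, Matrix.transpose_apply, Matrix.of_apply]
    exact Finset.sum_congr rfl fun e _ => by rw [h.apply_symm hx e d, mul_comm]
  rw [Matrix.add_apply, h3, h1, Matrix.mul_apply]
  simp only [conn, Matrix.of_apply, h2, mpd]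
  rw [h.pd_symm hx a d c, h.pd_symm hx c a d, h.pd_symm hx d a c]
  ring

lemma entryDiffAt (h : SmoothMetric U G) (hx : x ∈ U) : EntryDiffAt G x := fun i j =>
  (h.smooth i j).differentiableAt_of_mem h.isOpen hx

lemma entryDiffAt_conn (h : SmoothMetric U G) (hx : x ∈ U) (a : Fin 4) :
    EntryDiffAt (conn G a) x := fun i j =>
  (h.smooth_christoffel i a j).differentiableAt_of_mem h.isOpen hx

/-- The curvature matrices take values in the Lie algebra of the orthogonal group of the metric. -/
lemma curv_transpose (h : SmoothMetric U G) (hx : x ∈ U) (a b : Fin 4) :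
    (curv G a b x)ᵀ * G x + G x * curv G a b x = 0 := by
  have h1 : ∀ a b, mpd b (mpd a G) x = (mpd b (conn G a) x)ᵀ * G x
      + (conn G a x)ᵀ * ((conn G b x)ᵀ * G x + G x * conn G b x)
      + (((conn G b x)ᵀ * G x + G x * conn G b x) * conn G a x + G x * mpd b (conn G a) x) := by
    intro a b
    have hA := h.entryDiffAt_conn hx a
    have hG := h.entryDiffAt hx
    rw [mpd_congr (Filter.eventuallyEq_of_mem (h.isOpen.mem_nhds hx) fun _ hy => h.compat hy a),
      mpd_add (hA.transpose.mul hG) (hG.mul hA), mpd_mul hA.transpose hG, mpd_mul hG hA,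
      mpd_transpose, h.compat hx]
  have h2 := mpd_comm h.isOpen h.smooth hx (i := b) a
  rw [h1, h1] at h2
  rw [← sub_eq_zero] at h2
  rw [curv_eq, ← h2]
  simp only [Matrix.transpose_add, Matrix.transpose_sub, Matrix.transpose_mul]
  noncomm_ring

lemma pd_metric (h : SmoothMetric U G) (hx : x ∈ U) (b a c : Fin 4) :
    pd b (fun y => G y a c) x = ∑ e, christoffel G x e b a * G x e c
      + ∑ e, G x a e * christoffel G x e b c :=
  congrFun (congrFun (h.compat hx b) a) c

/-- Lowering the index of the covariant derivative of a vector field. -/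
lemma lower_nabla (h : SmoothMetric U G) (hx : x ∈ U) {u V : Fin 4 → R4 → ℝ}
    (hV : ∀ d, DifferentiableAt ℝ (V d) x) (hu : ∀ y ∈ U, ∀ k, ∑ d, G y k d * V d y = u k y)
    (b k : Fin 4) :
    ∑ d, G x k d * (pd b (V d) x + ∑ e, christoffel G x d b e * V e x)
      = pd b (u k) x - ∑ e, christoffel G x e b k * u e x := by
  have h1 : pd b (u k) x = ∑ d, (pd b (fun y => G y k d) x * V d x + G x k d * pd b (V d) x) := by
    rw [pd_congr (g := fun y => ∑ d, G y k d * V d y)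
      (Filter.eventuallyEq_of_mem (h.isOpen.mem_nhds hx) fun y hy => (hu y hy k).symm),
      pd_sum (h := fun d y => G y k d * V d y) fun d _ => (h.entryDiffAt hx k d).fun_mul (hV d)]
    exact Finset.sum_congr rfl fun d _ => pd_mul (h.entryDiffAt hx k d) (hV d)
  have h3 : ∑ d, (∑ e, christoffel G x e b k * G x e d) * V d x
      = ∑ e, christoffel G x e b k * u e x := by
    simp only [Finset.sum_mul]
    rw [Finset.sum_comm]
    simp only [mul_assoc, ← Finset.mul_sum, hu x hx]
  have h4 : ∑ d, (∑ e, G x k e * christoffel G x e b d) * V d x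
      = ∑ d, G x k d * ∑ e, christoffel G x d b e * V e x := by
    simp only [Finset.sum_mul, Finset.mul_sum, ← mul_assoc]
    rw [Finset.sum_comm]
  simp only [h1, h.pd_metric hx, add_mul, mul_add, Finset.sum_add_distrib, h3, h4]
  ring

/-- The second Bianchi identity. -/
lemma bianchi (h : SmoothMetric U G) (hx : x ∈ U) (e a b : Fin 4) :
    (mpd e (curv G a b) x + conn G e x * curv G a b x - curv G a b x * conn G e x)
      + (mpd a (curv G b e) x + conn G a x * curv G b e x - curv G b e x * conn G a x)
      + (mpd b (curv G e a) x + conn G b x * curv G e a x - curv G e a x * conn G b x) = 0 := by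
  have hd : ∀ a b, EntryDiffAt (mpd b (conn G a)) x := fun a b i j =>
    (contDiffOn_pd h.isOpen (h.smooth_christoffel i a j)).differentiableAt_of_mem h.isOpen hx
  have hA := h.entryDiffAt_conn hx
  have h1 : ∀ e a b, mpd e (curv G a b) x = mpd e (mpd b (conn G a)) x - mpd e (mpd a (conn G b)) x
      + (mpd e (conn G b) x * conn G a x + conn G b x * mpd e (conn G a) x)
      - (mpd e (conn G a) x * conn G b x + conn G a x * mpd e (conn G b) x) := by
    intro e a b
    have : curv G a b = fun y => mpd b (conn G a) y - mpd a (conn G b) y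
      + conn G b y * conn G a y - conn G a y * conn G b y := funext fun y => curv_eq G a b y
    rw [this, mpd_sub (((hd a b).sub (hd b a)).add ((hA b).mul (hA a))) ((hA a).mul (hA b)),
      mpd_add ((hd a b).sub (hd b a)) ((hA b).mul (hA a)), mpd_sub (hd a b) (hd b a),
      mpd_mul (hA b) (hA a), mpd_mul (hA a) (hA b)]
  have h2 : ∀ a e b, mpd e (mpd b (conn G a)) x = mpd b (mpd e (conn G a)) x := fun a e b =>
    mpd_comm h.isOpen (fun i j => h.smooth_christoffel i a j) hx b
  simp only [h1, curv_eq]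
  rw [h2 a e b, h2 b e a, h2 e a b]
  noncomm_ring

end SmoothMetric

/-! ### Symmetries of the curvature and of the Weyl tensor -/

/-- The algebraic symmetries of the Weyl tensor of a metric with contravariant components `Gi`. -/
structure IsWeylTensor (Gi : Matrix (Fin 4) (Fin 4) ℝ) (T : Fin 4 → Fin 4 → Fin 4 → Fin 4 → ℝ) :
    Prop where
  antisymm : ∀ a b c d, T b a c d = -T a b c d
  pair : ∀ a b c d, T c d a b = T a b c d
  cyclic : ∀ a b c d, T a b c d + T b c a d + T c a b d = 0
  trace : ∀ a c, ∑ b, ∑ d, Gi b d * T a b c d = 0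

lemma IsWeylTensor.weylSymm {Gi : Matrix (Fin 4) (Fin 4) ℝ}
    {T : Fin 4 → Fin 4 → Fin 4 → Fin 4 → ℝ} (h : IsWeylTensor Gi T) :
    WeylSymm (toC Gi) fun a b c d => (T a b c d : ℂ) where
  antisymm a b c d := by exact_mod_cast h.antisymm a b c d
  pair a b c d := by exact_mod_cast h.pair a b c d
  cyclic a b c d := by exact_mod_cast h.cyclic a b c d
  trace a c := by
    have := h.trace a c
    simp only [Matrix.map_apply]
    exact_mod_cast this

lemma IsWeylTensor.antisymm_right {Gi : Matrix (Fin 4) (Fin 4) ℝ}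
    {T : Fin 4 → Fin 4 → Fin 4 → Fin 4 → ℝ} (h : IsWeylTensor Gi T) (a b c d : Fin 4) :
    T a b d c = -T a b c d := by
  rw [← h.pair, h.antisymm, h.pair]

/-- The symmetry under the exchange of the two pairs follows from the cyclic identity. -/
lemma pair_symm_of_cyclic {T : Fin 4 → Fin 4 → Fin 4 → Fin 4 → ℝ}
    (h1 : ∀ a b c d, T b a c d = -T a b c d) (h2 : ∀ a b c d, T a b d c = -T a b c d)
    (h3 : ∀ a b c d, T a b c d + T b c a d + T c a b d = 0) (a b c d : Fin 4) :
    T c d a b = T a b c d := by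
  linarith [h3 a b c d, h3 b c d a, h3 c d a b, h3 d a b c, h1 a b c d, h1 b c a d, h1 c a b d,
    h1 b c d a, h1 c d b a, h1 d b c a, h1 c d a b, h1 d a c b, h1 a c d b, h1 d a b c, h1 a b d c,
    h1 b d a c, h2 a b c d, h2 b c a d, h2 c a b d, h2 b c d a, h2 c d b a, h2 d b c a, h2 c d a b,
    h2 d a c b, h2 a c d b, h2 d a b c, h2 a b d c, h2 b d a c]

/-- The product `m_{db} g_{ac} - m_{da} g_{bc} + g_{db} m_{ac} - g_{da} m_{bc}` of two symmetric
forms. -/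
def wedge (m g : Matrix (Fin 4) (Fin 4) ℝ) (a b c d : Fin 4) : ℝ :=
  m d b * g a c - m d a * g b c + (g d b * m a c - g d a * m b c)

lemma wedge_symm {m g : Matrix (Fin 4) (Fin 4) ℝ} (hm : ∀ i j, m i j = m j i)
    (hg : ∀ i j, g i j = g j i) (a b c d : Fin 4) :
    wedge m g b a c d = -wedge m g a b c d ∧ wedge m g a b d c = -wedge m g a b c d ∧
      wedge m g a b c d + wedge m g b c a d + wedge m g c a b d = 0 := by
  refine ⟨?_, ?_, ?_⟩
  · simp only [wedge]; ring
  · simp only [wedge]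
    rw [hm c b, hm c a, hm a d, hm b d, hg c b, hg c a, hg a d, hg b d]; ring
  · simp only [wedge]
    rw [hm b a, hm c a, hm c b, hg b a, hg c a, hg c b]; ring

/-- The trace of `wedge m g`; in particular `m` is determined by `wedge m g`, so that no product with
the metric is trace-free except zero. -/
lemma wedge_trace {m g gi : Matrix (Fin 4) (Fin 4) ℝ} (hm : ∀ i j, m i j = m j i)
    (hgi : ∀ i j, gi i j = gi j i)
    (h : gi * g = 1) (a c : Fin 4) :
    ∑ b, ∑ d, gi b d * wedge m g a b c d
      = 2 * m a c + (∑ b, ∑ d, gi b d * m b d) * g a c := by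
  have h1 : ∀ i j, ∑ k, gi i k * g k j = if i = j then 1 else 0 := fun i j => by
    rw [← Matrix.mul_apply, h, Matrix.one_apply]
  have h2 : ∀ i j, ∑ k, gi k i * g k j = if i = j then 1 else 0 := fun i j => by
    simp only [hgi _ i, h1]
  have e1 : ∑ b, ∑ d, gi b d * (m d a * g b c) = m a c := by
    rw [Finset.sum_comm]
    have : ∀ d b, gi b d * (m d a * g b c) = m d a * (gi b d * g b c) := fun _ _ => by ring
    simp only [this, ← Finset.mul_sum, h2]
    simp [hm c a]
  have e2 : ∑ b, ∑ d, gi b d * (g d a * m b c) = m a c := by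
    have : ∀ b d, gi b d * (g d a * m b c) = m b c * (gi b d * g d a) := fun _ _ => by ring
    simp only [this, ← Finset.mul_sum, h1]
    simp
  have e3 : ∑ b, ∑ d, gi b d * (g d b * m a c) = 4 * m a c := by
    simp only [← mul_assoc, ← Finset.sum_mul, h1]
    simp
  have e4 : ∑ b, ∑ d, gi b d * (m d b * g a c) = (∑ b, ∑ d, gi b d * m b d) * g a c := by
    simp only [← mul_assoc, ← Finset.sum_mul]
    congr 1
    exact Finset.sum_congr rfl fun b _ => Finset.sum_congr rfl fun d _ => by rw [hm]
  simp only [wedge, mul_add, mul_sub, Finset.sum_add_distrib, Finset.sum_sub_distrib, e1, e2, e3, e4]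
  ring

/-- The covariant components `R_{abcd}` of the Riemann tensor. -/
noncomputable def riemannLow (G : R4 → Matrix (Fin 4) (Fin 4) ℝ) (x : R4) (a b c d : Fin 4) : ℝ :=
  ∑ k, G x d k * riemann G x a b c k

lemma weyl_eq (G : R4 → Matrix (Fin 4) (Fin 4) ℝ) (x : R4) (a b c d : Fin 4) :
    weyl G x a b c d = riemannLow G x a b c d - wedge (Matrix.of (schouten G x)) (G x) a b c d := by
  simp only [weyl, riemannLow, wedge, Matrix.of_apply]
  ring

namespace SmoothMetric

variable {U : Set R4} {G : R4 → Matrix (Fin 4) (Fin 4) ℝ} {x : R4}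

lemma riemann_antisymm (G : R4 → Matrix (Fin 4) (Fin 4) ℝ) (x : R4) (a b c d : Fin 4) :
    riemann G x b a c d = -riemann G x a b c d := by
  simp only [riemann, Finset.sum_sub_distrib]
  ring

lemma riemann_cyclic (h : SmoothMetric U G) (hx : x ∈ U) (a b c d : Fin 4) :
    riemann G x a b c d + riemann G x b c a d + riemann G x c a b d = 0 := by
  have h1 : ∀ i j k l, pd i (fun y => christoffel G y j k l) x
      = pd i (fun y => christoffel G y j l k) x := fun i j k l =>
    pd_congr (Filter.eventuallyEq_of_mem (h.isOpen.mem_nhds hx)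
      fun _ hy => h.christoffel_symm hy j k l)
  simp only [riemann, Finset.sum_sub_distrib]
  rw [h1 c d b a, h1 b d a c, h1 a d c b]
  simp only [h.christoffel_symm hx _ b a, h.christoffel_symm hx _ c a, h.christoffel_symm hx _ c b]
  ring

lemma riemannLow_antisymm (G : R4 → Matrix (Fin 4) (Fin 4) ℝ) (x : R4) (a b c d : Fin 4) :
    riemannLow G x b a c d = -riemannLow G x a b c d := by
  simp only [riemannLow, riemann_antisymm G x a b, mul_neg, Finset.sum_neg_distrib]

lemma riemannLow_cyclic (h : SmoothMetric U G) (hx : x ∈ U) (a b c d : Fin 4) :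
    riemannLow G x a b c d + riemannLow G x b c a d + riemannLow G x c a b d = 0 := by
  simp only [riemannLow, ← Finset.sum_add_distrib, ← mul_add, h.riemann_cyclic hx, mul_zero,
    Finset.sum_const_zero]

lemma riemannLow_antisymm_right (h : SmoothMetric U G) (hx : x ∈ U) (a b c d : Fin 4) :
    riemannLow G x a b d c = -riemannLow G x a b c d := by
  have h1 := congrFun (congrFun (h.curv_transpose hx a b) c) d
  simp only [Matrix.add_apply, Matrix.mul_apply, Matrix.transpose_apply, curv, Matrix.of_apply,
    Matrix.zero_apply] at h1
  have h2 : ∑ k, riemann G x a b c k * G x k d = riemannLow G x a b c d :=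
    Finset.sum_congr rfl fun k _ => by rw [h.apply_symm hx k d, mul_comm]
  rw [h2] at h1
  simp only [riemannLow] at h1 ⊢
  linarith

lemma riemannLow_trace (h : SmoothMetric U G) (hx : x ∈ U) (a c : Fin 4) :
    ∑ b, ∑ d, (G x)⁻¹ b d * riemannLow G x a b c d = ricci G x a c := by
  have h1 : ∀ i j, ∑ k, (G x)⁻¹ i k * G x k j = if i = j then 1 else 0 := fun i j => by
    rw [← Matrix.mul_apply, h.inv_mul hx, Matrix.one_apply]
  refine Finset.sum_congr rfl fun b _ => ?_
  simp only [riemannLow, Finset.mul_sum, ← mul_assoc]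
  rw [Finset.sum_comm]
  simp [← Finset.sum_mul, h1]

lemma riemannLow_pair (h : SmoothMetric U G) (hx : x ∈ U) (a b c d : Fin 4) :
    riemannLow G x c d a b = riemannLow G x a b c d :=
  pair_symm_of_cyclic (riemannLow_antisymm G x) (h.riemannLow_antisymm_right hx)
    (h.riemannLow_cyclic hx) a b c d

lemma ricci_symm (h : SmoothMetric U G) (hx : x ∈ U) (a c : Fin 4) :
    ricci G x a c = ricci G x c a := by
  rw [← h.riemannLow_trace hx, ← h.riemannLow_trace hx, Finset.sum_comm]
  refine Finset.sum_congr rfl fun b _ => Finset.sum_congr rfl fun d _ => ?_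
  rw [← h.riemannLow_pair hx, h.inv_symm hx]

lemma schouten_symm (h : SmoothMetric U G) (hx : x ∈ U) (a c : Fin 4) :
    schouten G x a c = schouten G x c a := by
  rw [schouten, schouten, h.ricci_symm hx, h.apply_symm hx]

lemma sum_inv_mul_self (h : SmoothMetric U G) (hx : x ∈ U) :
    ∑ b, ∑ d, (G x)⁻¹ b d * G x b d = 4 := by
  have h1 : ∀ i j, ∑ k, (G x)⁻¹ i k * G x k j = if i = j then 1 else 0 := fun i j => by
    rw [← Matrix.mul_apply, h.inv_mul hx, Matrix.one_apply]
  have : ∀ b, ∑ d, (G x)⁻¹ b d * G x b d = 1 := fun b => by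
    have := h1 b b
    rw [if_pos rfl] at this
    rw [← this]
    exact Finset.sum_congr rfl fun d _ => by rw [h.apply_symm hx]
  simp [this]

lemma isWeylTensor_weyl (h : SmoothMetric U G) (hx : x ∈ U) :
    IsWeylTensor (G x)⁻¹ (weyl G x) := by
  have hw := wedge_symm (m := Matrix.of (schouten G x)) (g := G x) (h.schouten_symm hx)
    (h.apply_symm hx)
  have h1 : ∀ a b c d, weyl G x b a c d = -weyl G x a b c d := fun a b c d => by
    rw [weyl_eq, weyl_eq, riemannLow_antisymm, (hw a b c d).1]; ring
  have h2 : ∀ a b c d, weyl G x a b d c = -weyl G x a b c d := fun a b c d => by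
    rw [weyl_eq, weyl_eq, h.riemannLow_antisymm_right hx, (hw a b c d).2.1]; ring
  have h3 : ∀ a b c d, weyl G x a b c d + weyl G x b c a d + weyl G x c a b d = 0 :=
    fun a b c d => by
      rw [weyl_eq, weyl_eq, weyl_eq]
      linarith [h.riemannLow_cyclic hx a b c d, (hw a b c d).2.2]
  refine ⟨h1, pair_symm_of_cyclic h1 h2 h3, h3, fun a c => ?_⟩
  simp only [weyl_eq, mul_sub, Finset.sum_sub_distrib]
  rw [h.riemannLow_trace hx, wedge_trace (m := Matrix.of (schouten G x)) (h.schouten_symm hx)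
    (h.inv_symm hx) (h.inv_mul hx)]
  have h4 : ∑ b, ∑ d, (G x)⁻¹ b d * Matrix.of (schouten G x) b d = scalarCurv G x / 6 := by
    have : ∀ b d, (G x)⁻¹ b d * Matrix.of (schouten G x) b d
        = 1 / 2 * ((G x)⁻¹ b d * ricci G x b d)
          - 1 / 12 * scalarCurv G x * ((G x)⁻¹ b d * G x b d) := by
      intro b d
      rw [Matrix.of_apply, schouten]; ring
    simp only [this, Finset.sum_sub_distrib, ← Finset.mul_sum]
    rw [h.sum_inv_mul_self hx]
    have : ∑ b, ∑ d, (G x)⁻¹ b d * ricci G x b d = scalarCurv G x := rfl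
    rw [this]; ring
  rw [h4, Matrix.of_apply, schouten]
  ring

end SmoothMetric

/-! ### Conformal change of the curvature -/

/-- Two smooth metrics related by `g = Θ² g̃`. -/
structure ConformalPair (U : Set R4) (G Gt : R4 → Matrix (Fin 4) (Fin 4) ℝ) (θ : R4 → ℝ) :
    Prop where
  metric : SmoothMetric U G
  phys : SmoothMetric U Gt
  smooth : ContDiffOn ℝ ∞ θ U
  ne_zero : ∀ y ∈ U, θ y ≠ 0
  eq : ∀ y ∈ U, G y = θ y ^ 2 • Gt y

/-- The covector `u_a = -∂_a Θ / Θ`. -/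
noncomputable def logGrad (θ : R4 → ℝ) (a : Fin 4) (x : R4) : ℝ := -pd a θ x / θ x

/-- The vector `u^a`. -/
noncomputable def logGradUp (G : R4 → Matrix (Fin 4) (Fin 4) ℝ) (θ : R4 → ℝ) (a : Fin 4) (x : R4) :
    ℝ :=
  ∑ b, (G x)⁻¹ a b * logGrad θ b x

/-- The difference `S^d_{ac} = u_a δ^d_c + u_c δ^d_a - u^d g_{ac}` of the two Levi-Civita
connections. -/
noncomputable def connDiff (G : R4 → Matrix (Fin 4) (Fin 4) ℝ) (θ : R4 → ℝ) (a : Fin 4) (x : R4) :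
    Matrix (Fin 4) (Fin 4) ℝ :=
  Matrix.of fun d c => logGrad θ a x * (if d = c then 1 else 0)
    + (if d = a then 1 else 0) * logGrad θ c x - logGradUp G θ d x * G x a c

/-- The covariant derivative `∇_b u_c`. -/
noncomputable def logHess (G : R4 → Matrix (Fin 4) (Fin 4) ℝ) (θ : R4 → ℝ) (b c : Fin 4) (x : R4) :
    ℝ :=
  pd b (logGrad θ c) x - ∑ e, christoffel G x e b c * logGrad θ e x

/-- The norm `u_a u^a`. -/
noncomputable def logNorm (G : R4 → Matrix (Fin 4) (Fin 4) ℝ) (θ : R4 → ℝ) (x : R4) : ℝ :=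
  ∑ e, logGrad θ e x * logGradUp G θ e x

/-- The tensor `∇_b u_c - u_b u_c + (1/2) u² g_{bc}`. -/
noncomputable def schoutenDiff (G : R4 → Matrix (Fin 4) (Fin 4) ℝ) (θ : R4 → ℝ) (x : R4) :
    Matrix (Fin 4) (Fin 4) ℝ :=
  Matrix.of fun b c => logHess G θ b c x - logGrad θ b x * logGrad θ c x
    + 1 / 2 * logNorm G θ x * G x b c

namespace ConformalPair

variable {U : Set R4} {G Gt : R4 → Matrix (Fin 4) (Fin 4) ℝ} {θ : R4 → ℝ} {x : R4}

lemma diff_conf (h : ConformalPair U G Gt θ) (hx : x ∈ U) : DifferentiableAt ℝ θ x :=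
  h.smooth.differentiableAt_of_mem h.metric.isOpen hx

lemma inv_eq (h : ConformalPair U G Gt θ) (hx : x ∈ U) : (Gt x)⁻¹ = θ x ^ 2 • (G x)⁻¹ := by
  refine Matrix.inv_eq_left_inv ?_
  rw [Matrix.smul_mul, ← Matrix.mul_smul, ← h.eq x hx, h.metric.inv_mul hx]

lemma pd_eq (h : ConformalPair U G Gt θ) (hx : x ∈ U) (a i j : Fin 4) :
    θ x ^ 2 * pd a (fun y => Gt y i j) x
      = pd a (fun y => G y i j) x + 2 * logGrad θ a x * G x i j := by
  have hθ := h.diff_conf hx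
  have hGt := h.phys.entryDiffAt hx i j
  have h1 : pd a (fun y => G y i j) x = pd a (fun y => θ y * θ y * Gt y i j) x :=
    pd_congr (Filter.eventuallyEq_of_mem (h.metric.isOpen.mem_nhds hx) fun y hy => by
      rw [h.eq y hy, Matrix.smul_apply, smul_eq_mul, pow_two])
  rw [h1, pd_mul (hθ.fun_mul hθ) hGt, pd_mul hθ hθ, h.eq x hx, Matrix.smul_apply, smul_eq_mul, logGrad]
  have := h.ne_zero x hx
  field_simp
  ring

/-- The conformal change of the Levi-Civita connection. -/
lemma christoffel_eq (h : ConformalPair U G Gt θ) (hx : x ∈ U) (d a c : Fin 4) :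
    christoffel Gt x d a c = christoffel G x d a c + connDiff G θ a x d c := by
  have h1 : ∀ i j, ∑ k, (G x)⁻¹ i k * G x k j = if i = j then 1 else 0 := fun i j => by
    rw [← Matrix.mul_apply, h.metric.inv_mul hx, Matrix.one_apply]
  have h2 : ∀ l, (Gt x)⁻¹ d l * (pd a (fun y => Gt y c l) x + pd c (fun y => Gt y a l) x
      - pd l (fun y => Gt y a c) x) = (G x)⁻¹ d l * (pd a (fun y => G y c l) x
      + pd c (fun y => G y a l) x - pd l (fun y => G y a c) x)
      + 2 * (logGrad θ a x * ((G x)⁻¹ d l * G x l c) + logGrad θ c x * ((G x)⁻¹ d l * G x l a)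
        - (G x)⁻¹ d l * logGrad θ l x * G x a c) := by
    intro l
    rw [h.inv_eq hx, Matrix.smul_apply, smul_eq_mul, h.metric.apply_symm hx l c,
      h.metric.apply_symm hx l a]
    linear_combination (G x)⁻¹ d l * (h.pd_eq hx a c l + h.pd_eq hx c a l - h.pd_eq hx l a c)
  simp only [christoffel, h2, Finset.sum_add_distrib, ← Finset.mul_sum, Finset.sum_sub_distrib, h1,
    ← Finset.sum_mul, connDiff, Matrix.of_apply, logGradUp]
  ring

lemma smooth_logGrad (h : ConformalPair U G Gt θ) (a : Fin 4) : ContDiffOn ℝ ∞ (logGrad θ a) U :=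
  (contDiffOn_pd h.metric.isOpen h.smooth).neg.div h.smooth h.ne_zero

lemma smooth_logGradUp (h : ConformalPair U G Gt θ) (a : Fin 4) :
    ContDiffOn ℝ ∞ (logGradUp G θ a) U :=
  ContDiffOn.sum fun b _ => (h.metric.smooth_inv a b).mul (h.smooth_logGrad b)

lemma lower_logGradUp (h : ConformalPair U G Gt θ) (hx : x ∈ U) (a : Fin 4) :
    ∑ e, G x a e * logGradUp G θ e x = logGrad θ a x := by
  have h1 : ∀ i j, ∑ k, G x i k * (G x)⁻¹ k j = if i = j then 1 else 0 := fun i j => by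
    rw [← Matrix.mul_apply, h.metric.mul_inv hx, Matrix.one_apply]
  simp only [logGradUp, Finset.mul_sum, ← mul_assoc]
  rw [Finset.sum_comm]
  simp [← Finset.sum_mul, h1]

lemma pd_logGrad_comm (h : ConformalPair U G Gt θ) (hx : x ∈ U) (b c : Fin 4) :
    pd b (logGrad θ c) x = pd c (logGrad θ b) x := by
  have hU := h.metric.isOpen
  have h1 : ∀ b c, θ x * pd b (logGrad θ c) x = logGrad θ b x * logGrad θ c x * θ x
      - pd b (fun y => pd c θ y) x := by
    intro b c
    have hu := (h.smooth_logGrad c).differentiableAt_of_mem hU hx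
    have h2 : pd b (fun y => pd c θ y) x = pd b (fun y => -(θ y * logGrad θ c y)) x :=
      pd_congr (Filter.eventuallyEq_of_mem (hU.mem_nhds hx) fun y hy => by
        have := h.ne_zero y hy
        simp only [logGrad]
        field_simp)
    rw [h2, pd_neg, pd_mul (h.diff_conf hx) hu]
    have : pd b θ x = -(logGrad θ b x * θ x) := by
      have := h.ne_zero x hx
      simp only [logGrad]
      field_simp
    rw [this]
    ring
  refine mul_left_cancel₀ (h.ne_zero x hx) ?_
  rw [h1, h1, pd_comm hU h.smooth hx c]
  ring

lemma logHess_symm (h : ConformalPair U G Gt θ) (hx : x ∈ U) (b c : Fin 4) :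
    logHess G θ b c x = logHess G θ c b x := by
  simp only [logHess, h.pd_logGrad_comm hx b c, h.metric.christoffel_symm hx _ b c]

lemma schoutenDiff_symm (h : ConformalPair U G Gt θ) (hx : x ∈ U) (b c : Fin 4) :
    schoutenDiff G θ x b c = schoutenDiff G θ x c b := by
  simp only [schoutenDiff, Matrix.of_apply, h.logHess_symm hx b c, h.metric.apply_symm hx b c]
  ring

lemma lower_logHess (h : ConformalPair U G Gt θ) (hx : x ∈ U) (b k : Fin 4) :
    ∑ d, G x k d * (pd b (logGradUp G θ d) x + ∑ e, christoffel G x d b e * logGradUp G θ e x)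
      = logHess G θ b k x :=
  h.metric.lower_nabla hx
    (fun d => (h.smooth_logGradUp d).differentiableAt_of_mem h.metric.isOpen hx)
    (fun _ hy k => h.lower_logGradUp hy k) b k

/-- The conformal change of the curvature. -/
lemma riemann_eq (h : ConformalPair U G Gt θ) (hx : x ∈ U) (a b c d : Fin 4) :
    riemann Gt x a b c d = riemann G x a b c d
      + (if d = a then 1 else 0) * schoutenDiff G θ x b c
      - (if d = b then 1 else 0) * schoutenDiff G θ x a c
      - (pd b (logGradUp G θ d) x + ∑ e, christoffel G x d b e * logGradUp G θ e x
        - logGrad θ b x * logGradUp G θ d x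
        + 1 / 2 * logNorm G θ x * (if d = b then 1 else 0)) * G x a c
      + (pd a (logGradUp G θ d) x + ∑ e, christoffel G x d a e * logGradUp G θ e x
        - logGrad θ a x * logGradUp G θ d x
        + 1 / 2 * logNorm G θ x * (if d = a then 1 else 0)) * G x b c := by
  have hU := h.metric.isOpen
  have hu : ∀ a, DifferentiableAt ℝ (logGrad θ a) x := fun a =>
    (h.smooth_logGrad a).differentiableAt_of_mem hU hx
  have hV : ∀ a, DifferentiableAt ℝ (logGradUp G θ a) x := fun a =>
    (h.smooth_logGradUp a).differentiableAt_of_mem hU hx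
  have hG := h.metric.entryDiffAt hx
  have hA := h.metric.entryDiffAt_conn hx
  have hS1 : ∀ a d c, DifferentiableAt ℝ (fun y => logGrad θ a y * (if d = c then 1 else 0)
      + (if d = a then 1 else 0) * logGrad θ c y) x := fun a d c =>
    ((hu a).mul (differentiableAt_const _)).add ((differentiableAt_const _).mul (hu c))
  have hS : ∀ a, EntryDiffAt (connDiff G θ a) x := fun a d c =>
    (hS1 a d c).sub ((hV d).mul (hG a c))
  have hconn : ∀ a, ∀ y ∈ U, conn Gt a y = conn G a y + connDiff G θ a y := by
    intro a y hy
    ext d c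
    exact h.christoffel_eq hy d a c
  have h1 : ∀ a b, mpd b (conn Gt a) x = mpd b (conn G a) x + mpd b (connDiff G θ a) x := by
    intro a b
    rw [mpd_congr (Filter.eventuallyEq_of_mem (hU.mem_nhds hx) (hconn a)), mpd_add (hA a) (hS a)]
  have h2 : curv Gt a b x = curv G a b x
      + (mpd b (connDiff G θ a) x + conn G b x * connDiff G θ a x - connDiff G θ a x * conn G b x)
      - (mpd a (connDiff G θ b) x + conn G a x * connDiff G θ b x - connDiff G θ b x * conn G a x)
      + (connDiff G θ b x * connDiff G θ a x - connDiff G θ a x * connDiff G θ b x) := by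
    rw [curv_eq, curv_eq, h1, h1, hconn a x hx, hconn b x hx]
    noncomm_ring
  have h3 : ∀ a b, mpd b (connDiff G θ a) x d c = pd b (logGrad θ a) x * (if d = c then 1 else 0)
      + (if d = a then 1 else 0) * pd b (logGrad θ c) x - (pd b (logGradUp G θ d) x * G x a c
        + logGradUp G θ d x * (∑ e, christoffel G x e b a * G x e c
          + ∑ e, G x a e * christoffel G x e b c)) := by
    intro a b
    have h4 : pd b (fun y => G y a c) x = ∑ e, christoffel G x e b a * G x e c
      + ∑ e, G x a e * christoffel G x e b c := congrFun (congrFun (h.metric.compat hx b) a) c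
    rw [← h4, ← pd_mul (hV d) (hG a c)]
    have h5 : mpd b (connDiff G θ a) x d c
      = pd b (fun y => (logGrad θ a y * (if d = c then 1 else 0)
      + (if d = a then 1 else 0) * logGrad θ c y) - logGradUp G θ d y * G y a c) x := rfl
    rw [h5, pd_sub (hS1 a d c) ((hV d).fun_mul (hG a c)),
      pd_add ((hu a).fun_mul (differentiableAt_const _))
      ((differentiableAt_const _).fun_mul (hu c)), pd_const_mul _ (hu c),
      pd_mul (hu a) (differentiableAt_const _), pd_const, mul_zero, add_zero]
  have h6 : ∀ a b, (conn G b x * connDiff G θ a x) d c = logGrad θ a x * christoffel G x d b c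
      + christoffel G x d b a * logGrad θ c x
      - (∑ e, christoffel G x d b e * logGradUp G θ e x) * G x a c := by
    intro a b
    simp only [Matrix.mul_apply, conn, connDiff, Matrix.of_apply, mul_add, mul_sub,
      Finset.sum_add_distrib, Finset.sum_sub_distrib, Finset.sum_mul]
    simp [mul_comm, mul_left_comm]
  have h7 : ∀ a b, (connDiff G θ a x * conn G b x) d c = logGrad θ a x * christoffel G x d b c
      + (if d = a then 1 else 0) * (∑ e, christoffel G x e b c * logGrad θ e x)
      - logGradUp G θ d x * ∑ e, G x a e * christoffel G x e b c := by
    intro a b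
    simp only [Matrix.mul_apply, conn, connDiff, Matrix.of_apply, add_mul, sub_mul,
      Finset.sum_add_distrib, Finset.sum_sub_distrib, Finset.mul_sum]
    simp [mul_comm, mul_left_comm, mul_assoc]
  have h8 : ∀ a b, (connDiff G θ b x * connDiff G θ a x) d c
      = logGrad θ b x * connDiff G θ a x d c
      + (if d = b then 1 else 0) * (logGrad θ a x * logGrad θ c x + logGrad θ a x * logGrad θ c x
        - logNorm G θ x * G x a c)
      - logGradUp G θ d x * (logGrad θ a x * G x b c + G x b a * logGrad θ c x
        - logGrad θ b x * G x a c) := by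
    intro a b
    have e1 : ∑ e, logGrad θ e x * connDiff G θ a x e c
        = logGrad θ a x * logGrad θ c x + logGrad θ a x * logGrad θ c x
          - logNorm G θ x * G x a c := by
      simp only [connDiff, Matrix.of_apply, mul_add, mul_sub, Finset.sum_add_distrib,
        Finset.sum_sub_distrib, logNorm, Finset.sum_mul]
      simp [mul_comm, mul_left_comm]
    have e2 : ∑ e, G x b e * connDiff G θ a x e c
        = logGrad θ a x * G x b c + G x b a * logGrad θ c x - logGrad θ b x * G x a c := by
      simp only [connDiff, Matrix.of_apply, mul_add, mul_sub, Finset.sum_add_distrib,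
        Finset.sum_sub_distrib, ← h.lower_logGradUp hx b, Finset.sum_mul]
      simp [mul_comm, mul_left_comm]
    rw [← e1, ← e2, Matrix.mul_apply]
    have e3 : ∀ e, connDiff G θ b x d e * connDiff G θ a x e c
        = logGrad θ b x * ((if d = e then 1 else 0) * connDiff G θ a x e c)
          + (if d = b then 1 else 0) * (logGrad θ e x * connDiff G θ a x e c)
          - logGradUp G θ d x * (G x b e * connDiff G θ a x e c) := by
      intro e
      have : connDiff G θ b x d e = logGrad θ b x * (if d = e then 1 else 0)
        + (if d = b then 1 else 0) * logGrad θ e x - logGradUp G θ d x * G x b e := rfl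
      rw [this]
      ring
    simp only [e3, Finset.sum_add_distrib, Finset.sum_sub_distrib, ← Finset.mul_sum]
    simp
  have h9 := congrFun (congrFun h2 d) c
  simp only [Matrix.add_apply, Matrix.sub_apply, h3, h6, h7, h8, curv, Matrix.of_apply] at h9
  rw [h9]
  simp only [connDiff, schoutenDiff, logHess, Matrix.of_apply]
  rw [h.pd_logGrad_comm hx b a, h.metric.apply_symm hx b a]
  simp only [h.metric.christoffel_symm hx _ b a]
  ring

/-- The curvature tensors differ by the product of a symmetric form with the metric. -/
lemma riemannLow_eq (h : ConformalPair U G Gt θ) (hx : x ∈ U) (a b c d : Fin 4) :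
    θ x ^ 2 * riemannLow Gt x a b c d
      = riemannLow G x a b c d - wedge (schoutenDiff G θ x) (G x) a b c d := by
  have h1 : ∀ b, ∑ k, G x d k * (pd b (logGradUp G θ k) x
      + ∑ e, christoffel G x k b e * logGradUp G θ e x - logGrad θ b x * logGradUp G θ k x
      + 1 / 2 * logNorm G θ x * (if k = b then 1 else 0)) = schoutenDiff G θ x b d := by
    intro b
    have e1 := h.lower_logHess hx b d
    have e2 := h.lower_logGradUp hx d
    have e3 : ∀ k, G x d k * (pd b (logGradUp G θ k) x
      + ∑ e, christoffel G x k b e * logGradUp G θ e x - logGrad θ b x * logGradUp G θ k x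
      + 1 / 2 * logNorm G θ x * (if k = b then 1 else 0))
      = G x d k * (pd b (logGradUp G θ k) x + ∑ e, christoffel G x k b e * logGradUp G θ e x)
        - logGrad θ b x * (G x d k * logGradUp G θ k x)
        + 1 / 2 * logNorm G θ x * (G x d k * (if k = b then 1 else 0)) := fun k => by ring
    simp only [e3, Finset.sum_add_distrib, Finset.sum_sub_distrib, ← Finset.mul_sum, e1, e2]
    simp [schoutenDiff, h.metric.apply_symm hx d b]
  have h2 : θ x ^ 2 * riemannLow Gt x a b c d = ∑ k, G x d k * riemann Gt x a b c k := by
    simp only [riemannLow, Finset.mul_sum, h.eq x hx, Matrix.smul_apply, smul_eq_mul, mul_assoc]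
  have h3 : ∀ k, G x d k * riemann Gt x a b c k = G x d k * riemann G x a b c k
      + schoutenDiff G θ x b c * (G x d k * if k = a then 1 else 0)
      - schoutenDiff G θ x a c * (G x d k * if k = b then 1 else 0)
      - G x a c * (G x d k * (pd b (logGradUp G θ k) x
      + ∑ e, christoffel G x k b e * logGradUp G θ e x - logGrad θ b x * logGradUp G θ k x
      + 1 / 2 * logNorm G θ x * (if k = b then 1 else 0)))
      + G x b c * (G x d k * (pd a (logGradUp G θ k) x
      + ∑ e, christoffel G x k a e * logGradUp G θ e x - logGrad θ a x * logGradUp G θ k x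
      + 1 / 2 * logNorm G θ x * (if k = a then 1 else 0))) := by
    intro k
    rw [h.riemann_eq hx]
    ring
  rw [h2]
  simp only [h3, Finset.sum_add_distrib, Finset.sum_sub_distrib, ← Finset.mul_sum, h1]
  simp only [mul_ite, mul_one, mul_zero, Finset.sum_ite_eq', Finset.mem_univ, if_true, wedge,
    riemannLow]
  rw [h.schoutenDiff_symm hx d b, h.schoutenDiff_symm hx d a]
  ring

/-- The conformal invariance of the Weyl tensor.  The difference of the two sides is both trace-free
and a product with the metric, so it vanishes. -/
lemma weyl_eq (h : ConformalPair U G Gt θ) (hx : x ∈ U) (a b c d : Fin 4) :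
    weyl G x a b c d = θ x ^ 2 * weyl Gt x a b c d := by
  set m : Matrix (Fin 4) (Fin 4) ℝ := schoutenDiff G θ x - Matrix.of (schouten G x)
    + Matrix.of (schouten Gt x) with hm
  have hms : ∀ i j, m i j = m j i := by
    intro i j
    simp only [hm, Matrix.add_apply, Matrix.sub_apply, Matrix.of_apply, h.schoutenDiff_symm hx i j,
      h.metric.schouten_symm hx i j, h.phys.schouten_symm hx i j]
  have h1 : ∀ a b c d, weyl G x a b c d - θ x ^ 2 * weyl Gt x a b c d = wedge m (G x) a b c d := by
    intro a b c d
    rw [TypeDData.weyl_eq, TypeDData.weyl_eq, mul_sub, h.riemannLow_eq hx]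
    simp only [wedge, hm, Matrix.add_apply, Matrix.sub_apply, Matrix.of_apply, h.eq x hx,
      Matrix.smul_apply, smul_eq_mul]
    ring
  have htr : ∀ a c, 2 * m a c + (∑ b, ∑ d, (G x)⁻¹ b d * m b d) * G x a c = 0 := by
    intro a c
    rw [← wedge_trace hms (h.metric.inv_symm hx) (h.metric.inv_mul hx)]
    have e1 := (h.metric.isWeylTensor_weyl hx).trace a c
    have e2 := (h.phys.isWeylTensor_weyl hx).trace a c
    simp only [h.inv_eq hx, Matrix.smul_apply, smul_eq_mul, mul_assoc, ← Finset.mul_sum] at e2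
    have e3 : ∑ b, ∑ d, (G x)⁻¹ b d * weyl Gt x a b c d = 0 :=
      (mul_eq_zero.mp e2).resolve_left (pow_ne_zero 2 (h.ne_zero x hx))
    have e4 : ∀ b d, (G x)⁻¹ b d * wedge m (G x) a b c d
        = (G x)⁻¹ b d * weyl G x a b c d - θ x ^ 2 * ((G x)⁻¹ b d * weyl Gt x a b c d) := by
      intro b d
      rw [← h1]; ring
    simp only [e4, Finset.sum_sub_distrib, ← Finset.mul_sum, e1, e3]
    ring
  have htr0 : ∑ b, ∑ d, (G x)⁻¹ b d * m b d = 0 := by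
    have e1 : ∑ a, ∑ c, (G x)⁻¹ a c * (2 * m a c
        + (∑ b, ∑ d, (G x)⁻¹ b d * m b d) * G x a c) = 0 := by simp [htr]
    have e2 : ∀ a c, (G x)⁻¹ a c * (2 * m a c + (∑ b, ∑ d, (G x)⁻¹ b d * m b d) * G x a c)
        = 2 * ((G x)⁻¹ a c * m a c)
          + (∑ b, ∑ d, (G x)⁻¹ b d * m b d) * ((G x)⁻¹ a c * G x a c) := fun a c => by ring
    simp only [e2, Finset.sum_add_distrib, ← Finset.mul_sum, h.metric.sum_inv_mul_self hx] at e1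
    linarith
  have hm0 : ∀ a c, m a c = 0 := by
    intro a c
    have := htr a c
    rw [htr0] at this
    linarith
  have := h1 a b c d
  simp only [wedge, hm0] at this
  linarith

end ConformalPair

/-! ### The divergence of the Weyl tensor of an Einstein metric -/

/-- The covariant derivative `∇_e T_{abcd}`. -/
noncomputable def nabla4 (G : R4 → Matrix (Fin 4) (Fin 4) ℝ)
    (T : R4 → Fin 4 → Fin 4 → Fin 4 → Fin 4 → ℝ) (x : R4) (e a b c d : Fin 4) : ℝ :=
  pd e (fun y => T y a b c d) x - ∑ f, (christoffel G x f e a * T x f b c d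
    + christoffel G x f e b * T x a f c d + christoffel G x f e c * T x a b f d
    + christoffel G x f e d * T x a b c f)

/-- The covariant derivative `∇_e V_{abc}{}^d`. -/
noncomputable def nabla31 (G : R4 → Matrix (Fin 4) (Fin 4) ℝ)
    (V : R4 → Fin 4 → Fin 4 → Fin 4 → Fin 4 → ℝ) (x : R4) (e a b c d : Fin 4) : ℝ :=
  pd e (fun y => V y a b c d) x + ∑ f, (christoffel G x d e f * V x a b c f
    - christoffel G x f e a * V x f b c d - christoffel G x f e b * V x a f c d
    - christoffel G x f e c * V x a b f d)

/-- The divergence `∇_e V_{abc}{}^e`. -/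
noncomputable def div31 (G : R4 → Matrix (Fin 4) (Fin 4) ℝ)
    (V : R4 → Fin 4 → Fin 4 → Fin 4 → Fin 4 → ℝ) (x : R4) (a b c : Fin 4) : ℝ :=
  ∑ e, nabla31 G V x e a b c e

/-- The Weyl tensor `C_{abc}{}^d`, for an Einstein metric with cosmological constant `lam`. -/
noncomputable def einsteinWeyl (G : R4 → Matrix (Fin 4) (Fin 4) ℝ) (lam : ℝ) (x : R4)
    (a b c d : Fin 4) : ℝ :=
  riemann G x a b c d - lam / 3 * ((if d = b then 1 else 0) * G x a c
    - (if d = a then 1 else 0) * G x b c)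

namespace SmoothMetric

variable {U : Set R4} {G : R4 → Matrix (Fin 4) (Fin 4) ℝ} {x : R4} {lam : ℝ}

lemma smooth_riemann (h : SmoothMetric U G) (a b c d : Fin 4) :
    ContDiffOn ℝ ∞ (fun y => riemann G y a b c d) U := by
  have hΓ := h.smooth_christoffel
  exact ((contDiffOn_pd h.isOpen (hΓ d a c)).sub (contDiffOn_pd h.isOpen (hΓ d b c))).add
    (ContDiffOn.sum fun e _ => ((hΓ e a c).mul (hΓ d b e)).sub ((hΓ e b c).mul (hΓ d a e)))

lemma smooth_einsteinWeyl (h : SmoothMetric U G) (a b c d : Fin 4) :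
    ContDiffOn ℝ ∞ (fun y => einsteinWeyl G lam y a b c d) U :=
  (h.smooth_riemann a b c d).sub (contDiffOn_const.mul
    ((contDiffOn_const.mul (h.smooth a c)).sub (contDiffOn_const.mul (h.smooth b c))))

lemma schouten_eq_of_einstein (h : SmoothMetric U G) (hx : x ∈ U)
    (hE : ∀ i j, ricci G x i j = lam * G x i j) (i j : Fin 4) :
    schouten G x i j = lam / 6 * G x i j := by
  have h1 : scalarCurv G x = 4 * lam := by
    have : ∀ i j, (G x)⁻¹ i j * ricci G x i j = lam * ((G x)⁻¹ i j * G x i j) := fun i j => by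
      rw [hE]; ring
    simp only [scalarCurv, this, ← Finset.mul_sum, h.sum_inv_mul_self hx]
    ring
  rw [schouten, h1, hE]
  ring

lemma lower_einsteinWeyl (h : SmoothMetric U G) (hx : x ∈ U)
    (hE : ∀ i j, ricci G x i j = lam * G x i j) (a b c d : Fin 4) :
    ∑ k, G x d k * einsteinWeyl G lam x a b c k = weyl G x a b c d := by
  have h1 : ∀ k, G x d k * einsteinWeyl G lam x a b c k = G x d k * riemann G x a b c k
      - lam / 3 * (G x a c * (G x d k * (if k = b then 1 else 0))
        - G x b c * (G x d k * if k = a then 1 else 0)) := fun k => by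
    rw [einsteinWeyl]; ring
  rw [weyl]
  simp only [h1, Finset.sum_sub_distrib, ← Finset.mul_sum, h.schouten_eq_of_einstein hx hE]
  simp only [mul_ite, mul_one, mul_zero, Finset.sum_ite_eq', Finset.mem_univ, if_true]
  ring

/-- The Riemann tensor of an Einstein metric is divergence-free, by the contracted Bianchi
identity. -/
lemma div31_riemann (h : SmoothMetric U G) (hx : x ∈ U)
    (hE : ∀ y ∈ U, ∀ i j, ricci G y i j = lam * G y i j) (a b c : Fin 4) :
    div31 G (riemann G) x a b c = 0 := by
  have hR : ∀ a b c d, DifferentiableAt ℝ (fun y => riemann G y a b c d) x := fun a b c d =>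
    (h.smooth_riemann a b c d).differentiableAt_of_mem h.isOpen hx
  have h1 : ∀ e, _ := fun e => congrFun (congrFun (h.bianchi hx e a b) e) c
  simp only [Matrix.add_apply, Matrix.sub_apply, Matrix.mul_apply, curv, conn, mpd, Matrix.of_apply,
    Matrix.zero_apply] at h1
  have h2 := Finset.sum_eq_zero fun e (_ : e ∈ Finset.univ) => h1 e
  simp only [Finset.sum_add_distrib, Finset.sum_sub_distrib] at h2
  have hric : ∀ a b c, pd a (fun y => ricci G y b c) x = lam * (∑ e, christoffel G x e a b * G x e c
      + ∑ e, G x b e * christoffel G x e a c) := by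
    intro a b c
    rw [← h.pd_metric hx, ← pd_const_mul lam (h.entryDiffAt hx b c)]
    exact pd_congr (Filter.eventuallyEq_of_mem (h.isOpen.mem_nhds hx) fun y hy => hE y hy b c)
  have hr1 : ∑ e, pd a (fun y => riemann G y b e c e) x = pd a (fun y => ricci G y b c) x :=
    (pd_sum (h := fun e y => riemann G y b e c e) fun e _ => hR b e c e).symm
  have hr2 : ∑ e, pd b (fun y => riemann G y e a c e) x = -pd b (fun y => ricci G y a c) x := by
    rw [← pd_neg, ← pd_sum (h := fun e y => riemann G y e a c e) fun e _ => hR e a c e]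
    refine congrArg (fun f => pd b f x) (funext fun y => ?_)
    simp only [riemann_antisymm G y a _, Finset.sum_neg_distrib, ricci]
  have hr3 : ∑ e, ∑ j, riemann G x b e j e * christoffel G x j a c
      = lam * ∑ j, G x b j * christoffel G x j a c := by
    rw [Finset.sum_comm]
    simp only [← Finset.sum_mul]
    simp only [Finset.mul_sum, ← mul_assoc, ← hE x hx]
    rfl
  have hr4 : ∑ e, ∑ j, riemann G x e a j e * christoffel G x j b c
      = -(lam * ∑ j, G x a j * christoffel G x j b c) := by
    rw [Finset.sum_comm]
    simp only [← Finset.sum_mul]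
    simp only [Finset.mul_sum, ← mul_assoc, ← hE x hx, riemann_antisymm G x a _,
      Finset.sum_neg_distrib, neg_mul]
    rfl
  have hr5 : ∑ e, ∑ j, christoffel G x e a j * riemann G x b e c j
      = -∑ e, ∑ j, christoffel G x j e a * riemann G x j b c e := by
    rw [Finset.sum_comm, ← Finset.sum_neg_distrib]
    refine Finset.sum_congr rfl fun e _ => ?_
    rw [← Finset.sum_neg_distrib]
    refine Finset.sum_congr rfl fun j _ => ?_
    rw [riemann_antisymm G x j b, h.christoffel_symm hx j a e]; ring
  have hr6 : ∑ e, ∑ j, christoffel G x e b j * riemann G x e a c j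
      = -∑ e, ∑ j, christoffel G x j e b * riemann G x a j c e := by
    rw [Finset.sum_comm, ← Finset.sum_neg_distrib]
    refine Finset.sum_congr rfl fun e _ => ?_
    rw [← Finset.sum_neg_distrib]
    refine Finset.sum_congr rfl fun j _ => ?_
    rw [riemann_antisymm G x a j, h.christoffel_symm hx j b e]; ring
  rw [hr1, hr2, hr3, hr4, hr5, hr6, hric, hric] at h2
  simp only [h.christoffel_symm hx _ b a] at h2
  simp only [div31, nabla31, Finset.sum_add_distrib, Finset.sum_sub_distrib]
  have hr7 : ∑ e, ∑ j, riemann G x a b j e * christoffel G x j e c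
      = ∑ e, ∑ j, christoffel G x j e c * riemann G x a b j e := by
    simp only [mul_comm]
  rw [hr7] at h2
  linarith

/-- The tensor `δ^d_b g_{ac}` is divergence-free. -/
lemma div31_metric (h : SmoothMetric U G) (hx : x ∈ U) (a b c : Fin 4) :
    div31 G (fun y a b c d => (if d = b then 1 else 0) * G y a c) x a b c = 0
    ∧ div31 G (fun y a b c d => (if d = a then 1 else 0) * G y b c) x a b c = 0 := by
  have hG := h.entryDiffAt hx
  constructor
  · simp only [div31, nabla31, pd_const_mul _ (hG _ _), h.pd_metric hx, Finset.sum_add_distrib,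
      Finset.sum_sub_distrib]
    simp [mul_comm]
  · simp only [div31, nabla31, pd_const_mul _ (hG _ _), h.pd_metric hx, Finset.sum_add_distrib,
      Finset.sum_sub_distrib]
    simp [mul_comm]

lemma div31_einsteinWeyl (h : SmoothMetric U G) (hx : x ∈ U)
    (hE : ∀ y ∈ U, ∀ i j, ricci G y i j = lam * G y i j) (a b c : Fin 4) :
    div31 G (einsteinWeyl G lam) x a b c = 0 := by
  have hR : ∀ a b c d, DifferentiableAt ℝ (fun y => riemann G y a b c d) x := fun a b c d =>
    (h.smooth_riemann a b c d).differentiableAt_of_mem h.isOpen hx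
  have hG := h.entryDiffAt hx
  have h2 : ∀ e a b c d, pd e (fun y => einsteinWeyl G lam y a b c d) x
      = pd e (fun y => riemann G y a b c d) x - lam / 3 *
        (pd e (fun y => (if d = b then 1 else 0) * G y a c) x
          - pd e (fun y => (if d = a then 1 else 0) * G y b c) x) := by
    intro e a b c d
    simp only [einsteinWeyl]
    rw [pd_sub (hR a b c d) ((((hG a c).const_mul _).fun_sub ((hG b c).const_mul _)).const_mul _),
      pd_const_mul _ (((hG a c).const_mul _).fun_sub ((hG b c).const_mul _)),
      pd_sub ((hG a c).const_mul _) ((hG b c).const_mul _)]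
  have h3 : div31 G (einsteinWeyl G lam) x a b c = div31 G (riemann G) x a b c - lam / 3 *
      (div31 G (fun y a b c d => (if d = b then 1 else 0) * G y a c) x a b c
        - div31 G (fun y a b c d => (if d = a then 1 else 0) * G y b c) x a b c) := by
    simp only [div31, nabla31]
    rw [← Finset.sum_sub_distrib, Finset.mul_sum, ← Finset.sum_sub_distrib]
    refine Finset.sum_congr rfl fun e _ => ?_
    rw [h2, add_sub_add_comm, mul_add, add_sub_add_comm, ← Finset.sum_sub_distrib, Finset.mul_sum,
      ← Finset.sum_sub_distrib]
    congr 1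
    refine Finset.sum_congr rfl fun f _ => ?_
    simp only [einsteinWeyl]
    ring
  rw [h3, h.div31_riemann hx hE, (h.div31_metric hx a b c).1, (h.div31_metric hx a b c).2]
  ring

/-- The inverse metric is covariantly constant, in matrix form. -/
lemma mpd_inv (h : SmoothMetric U G) (hx : x ∈ U) (e : Fin 4) :
    mpd e (fun y => (G y)⁻¹) x = -(conn G e x * (G x)⁻¹ + (G x)⁻¹ * (conn G e x)ᵀ) := by
  have hGi : EntryDiffAt (fun y => (G y)⁻¹) x := fun i j =>
    (h.smooth_inv i j).differentiableAt_of_mem h.isOpen hx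
  have h1 : mpd e (fun y => (G y)⁻¹ * G y) x = 0 := by
    rw [mpd_congr (N := fun _ => 1) (Filter.eventuallyEq_of_mem (h.isOpen.mem_nhds hx)
      fun y hy => h.inv_mul hy)]
    ext i j
    exact pd_const _
  rw [mpd_mul hGi (h.entryDiffAt hx), h.compat hx] at h1
  have h2 := congrArg (· * (G x)⁻¹) h1
  simp only [Matrix.add_mul, Matrix.mul_add, Matrix.zero_mul, Matrix.mul_assoc, h.mul_inv hx,
    Matrix.mul_one] at h2
  rw [← Matrix.mul_assoc (G x)⁻¹ (G x), h.inv_mul hx, Matrix.one_mul] at h2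
  rw [eq_neg_iff_add_eq_zero, ← h2]
  abel

end SmoothMetric

/-! ### The divergence under a conformal change -/

namespace ConformalPair

variable {U : Set R4} {G Gt : R4 → Matrix (Fin 4) (Fin 4) ℝ} {θ : R4 → ℝ} {x : R4} {lam : ℝ}

/-- The behaviour of the divergence of a tensor with the symmetries of the Weyl tensor under a
conformal change of the metric. -/
lemma div31_eq (h : ConformalPair U G Gt θ) (hx : x ∈ U)
    {V : R4 → Fin 4 → Fin 4 → Fin 4 → Fin 4 → ℝ} {W : Fin 4 → Fin 4 → Fin 4 → Fin 4 → ℝ}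
    (hV : ∀ a b c d, ∑ k, G x d k * V x a b c k = W a b c d) (hW : IsWeylTensor (G x)⁻¹ W)
    (a b c : Fin 4) :
    div31 Gt V x a b c = div31 G V x a b c + ∑ e, logGrad θ e x * V x a b c e := by
  have h1 : ∀ i j, ∑ k, (G x)⁻¹ i k * G x k j = if i = j then 1 else 0 := fun i j => by
    rw [← Matrix.mul_apply, h.metric.inv_mul hx, Matrix.one_apply]
  have hVW : ∀ a b c d, V x a b c d = ∑ k, (G x)⁻¹ d k * W a b c k := by
    intro a b c d
    simp only [← hV, Finset.mul_sum, ← mul_assoc]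
    rw [Finset.sum_comm]
    simp [← Finset.sum_mul, h1]
  have t1 : ∀ a c, ∑ e, V x a e c e = 0 := fun a c => by simp only [hVW, hW.trace]
  have t2 : ∀ b c, ∑ e, V x e b c e = 0 := fun b c => by
    rw [← neg_eq_zero, ← t1 b c, ← Finset.sum_neg_distrib]
    refine Finset.sum_congr rfl fun e _ => ?_
    rw [hVW, hVW, ← Finset.sum_neg_distrib]
    exact Finset.sum_congr rfl fun k _ => by rw [hW.antisymm]; ring
  have t3 : ∀ a b, ∑ e, V x a b e e = 0 := fun a b => by
    have : ∑ e, V x a b e e = -∑ e, V x a b e e := by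
      simp only [hVW]
      conv_lhs => rw [Finset.sum_comm]
      rw [← Finset.sum_neg_distrib]
      refine Finset.sum_congr rfl fun e _ => ?_
      rw [← Finset.sum_neg_distrib]
      exact Finset.sum_congr rfl fun k _ => by
        rw [hW.antisymm_right, h.metric.inv_symm hx]; ring
    linarith
  have hlow : ∀ a b c d, ∑ e, G x e d * V x a b c e = W a b c d := fun a b c d => by
    rw [← hV]; exact Finset.sum_congr rfl fun e _ => by rw [h.metric.apply_symm hx]
  have hu : ∀ a b c, ∑ e, logGrad θ e x * V x a b c e = ∑ f, logGradUp G θ f x * W a b c f := by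
    intro a b c
    simp only [← hV, ← h.lower_logGradUp hx, Finset.mul_sum, Finset.sum_mul]
    rw [Finset.sum_comm]
    refine Finset.sum_congr rfl fun f _ => Finset.sum_congr rfl fun e _ => ?_
    rw [h.metric.apply_symm hx e f]; ring
  -- the four terms with the difference tensor
  have s0 : ∑ e, ∑ f, connDiff G θ e x e f * V x a b c f
      = 4 * ∑ f, logGradUp G θ f x * W a b c f := by
    have : ∀ f, ∑ e, connDiff G θ e x e f = 4 * logGrad θ f x := by
      intro f
      have h2 : ∑ e, logGradUp G θ e x * G x e f = logGrad θ f x := by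
        rw [← h.lower_logGradUp hx]
        exact Finset.sum_congr rfl fun e _ => by rw [h.metric.apply_symm hx]; ring
      simp only [connDiff, Matrix.of_apply, Finset.sum_sub_distrib, Finset.sum_add_distrib, h2]
      simp
    rw [Finset.sum_comm]
    simp only [← Finset.sum_mul, this, mul_assoc, ← Finset.mul_sum, hu]
  have hS : ∀ (X : Fin 4 → Fin 4 → ℝ) (i : Fin 4), ∑ e, ∑ f, connDiff G θ e x f i * X f e
      = ∑ e, logGrad θ e x * X i e + logGrad θ i x * ∑ e, X e e
        - ∑ f, logGradUp G θ f x * ∑ e, G x e i * X f e := by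
    intro X i
    simp only [connDiff, Matrix.of_apply, add_mul, sub_mul, Finset.sum_sub_distrib,
      Finset.sum_add_distrib]
    congr 1
    · simp [Finset.mul_sum]
    · rw [Finset.sum_comm]
      simp only [Finset.mul_sum, mul_assoc]
  have s1 : ∑ e, ∑ f, connDiff G θ e x f a * V x f b c e
      = ∑ f, logGradUp G θ f x * W a b c f - ∑ f, logGradUp G θ f x * W f b c a := by
    rw [hS fun f e => V x f b c e, hu, t2]
    simp only [hlow]
    ring
  have s2 : ∑ e, ∑ f, connDiff G θ e x f b * V x a f c e
      = ∑ f, logGradUp G θ f x * W a b c f - ∑ f, logGradUp G θ f x * W a f c b := by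
    rw [hS fun f e => V x a f c e, hu, t1]
    simp only [hlow]
    ring
  have s3 : ∑ e, ∑ f, connDiff G θ e x f c * V x a b f e
      = ∑ f, logGradUp G θ f x * W a b c f - ∑ f, logGradUp G θ f x * W a b f c := by
    rw [hS fun f e => V x a b f e, hu, t3]
    simp only [hlow]
    ring
  have hcyc : ∑ f, logGradUp G θ f x * W f b c a + ∑ f, logGradUp G θ f x * W a f c b
      + ∑ f, logGradUp G θ f x * W a b f c = 0 := by
    rw [← Finset.sum_add_distrib, ← Finset.sum_add_distrib]
    refine Finset.sum_eq_zero fun f _ => ?_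
    have : W f b c a + W a f c b + W a b f c = 0 := by
      linarith [hW.cyclic a b c f, hW.pair f b c a, hW.pair a f c b, hW.antisymm_right a b c f,
        hW.cyclic c a f b, hW.cyclic f b c a, hW.cyclic a f b c, hW.pair a b c f,
        hW.antisymm c a f b, hW.antisymm c b a f, hW.cyclic a b f c, hW.pair c b a f,
        hW.antisymm_right a f c b, hW.antisymm_right f b c a, hW.antisymm_right b f a c,
        hW.antisymm f b a c, hW.antisymm a f b c, hW.pair a f b c]
    rw [← mul_add, ← mul_add, this, mul_zero]
  simp only [div31, nabla31, h.christoffel_eq hx]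
  simp only [add_mul, Finset.sum_add_distrib, Finset.sum_sub_distrib, s0, s1, s2, s3, hu]
  linarith

/-- The rescaled Weyl tensor of an Einstein metric is divergence-free. -/
lemma div31_resWeyl (h : ConformalPair U G Gt θ) (hx : x ∈ U)
    (hE : ∀ y ∈ U, ∀ i j, ricci Gt y i j = lam * Gt y i j) (a b c : Fin 4) :
    div31 G (fun y a b c d => (θ y)⁻¹ * einsteinWeyl Gt lam y a b c d) x a b c = 0 := by
  have hθ := h.ne_zero x hx
  have hU := h.metric.isOpen
  have hV : ∀ a b c d, ∑ k, G x d k * einsteinWeyl Gt lam x a b c k = weyl G x a b c d := by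
    intro a b c d
    rw [h.weyl_eq hx, ← h.phys.lower_einsteinWeyl hx (hE x hx), h.eq x hx, Finset.mul_sum]
    exact Finset.sum_congr rfl fun k _ => by rw [Matrix.smul_apply, smul_eq_mul]; ring
  have h1 := h.div31_eq hx (V := einsteinWeyl Gt lam) hV (h.metric.isWeylTensor_weyl hx) a b c
  rw [h.phys.div31_einsteinWeyl hx hE] at h1
  have hd : DifferentiableAt ℝ (fun y => (θ y)⁻¹) x :=
    (h.smooth.inv h.ne_zero).differentiableAt_of_mem hU hx
  have hinv : ∀ e, pd e (fun y => (θ y)⁻¹) x = (θ x)⁻¹ * logGrad θ e x := by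
    intro e
    have h2 : pd e (fun y => θ y * (θ y)⁻¹) x = 0 := by
      rw [pd_congr (g := fun _ => 1) (Filter.eventuallyEq_of_mem (hU.mem_nhds hx)
        fun y hy => mul_inv_cancel₀ (h.ne_zero y hy)), pd_const]
    rw [pd_mul (h.diff_conf hx) hd] at h2
    rw [logGrad]
    have h3 : θ x * pd e (fun y => (θ y)⁻¹) x = -(pd e θ x * (θ x)⁻¹) := by linarith
    refine mul_left_cancel₀ hθ ?_
    rw [h3]
    field_simp
  have h2 : ∀ e a b c d, pd e (fun y => (θ y)⁻¹ * einsteinWeyl Gt lam y a b c d) x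
      = (θ x)⁻¹ * (logGrad θ e x * einsteinWeyl Gt lam x a b c d
        + pd e (fun y => einsteinWeyl Gt lam y a b c d) x) := by
    intro e a b c d
    rw [pd_mul hd ((h.phys.smooth_einsteinWeyl a b c d).differentiableAt_of_mem hU hx), hinv]
    ring
  have h3 : div31 G (fun y a b c d => (θ y)⁻¹ * einsteinWeyl Gt lam y a b c d) x a b c
      = (θ x)⁻¹ * (div31 G (einsteinWeyl Gt lam) x a b c
        + ∑ e, logGrad θ e x * einsteinWeyl Gt lam x a b c e) := by
    simp only [div31, nabla31, h2]
    rw [← Finset.sum_add_distrib, Finset.mul_sum]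
    refine Finset.sum_congr rfl fun e _ => ?_
    rw [mul_add, mul_add, mul_add, Finset.mul_sum]
    have : ∀ f, christoffel G x e e f * ((θ x)⁻¹ * einsteinWeyl Gt lam x a b c f)
        - christoffel G x f e a * ((θ x)⁻¹ * einsteinWeyl Gt lam x f b c e)
        - christoffel G x f e b * ((θ x)⁻¹ * einsteinWeyl Gt lam x a f c e)
        - christoffel G x f e c * ((θ x)⁻¹ * einsteinWeyl Gt lam x a b f e)
        = (θ x)⁻¹ * (christoffel G x e e f * einsteinWeyl Gt lam x a b c f
        - christoffel G x f e a * einsteinWeyl Gt lam x f b c e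
        - christoffel G x f e b * einsteinWeyl Gt lam x a f c e
        - christoffel G x f e c * einsteinWeyl Gt lam x a b f e) := fun f => by ring
    simp only [this]
    ring
  rw [h3, ← h1, mul_zero]

end ConformalPair

namespace SmoothMetric

variable {U : Set R4} {G : R4 → Matrix (Fin 4) (Fin 4) ℝ} {x : R4}
  {T : R4 → Fin 4 → Fin 4 → Fin 4 → Fin 4 → ℝ}

/-- The divergence of a tensor, expressed through its covariant components. -/
lemma sum_inv_nabla4 (h : SmoothMetric U G) (hx : x ∈ U)
    {V : R4 → Fin 4 → Fin 4 → Fin 4 → Fin 4 → ℝ}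
    (hV : ∀ a b c d, DifferentiableAt ℝ (fun y => V y a b c d) x)
    (hTV : ∀ y ∈ U, ∀ a b c d, T y a b c d = ∑ k, G y d k * V y a b c k) (a b c : Fin 4) :
    ∑ e, ∑ d, (G x)⁻¹ e d * nabla4 G T x e a b c d = div31 G V x a b c := by
  have h1 : ∀ i j, ∑ k, (G x)⁻¹ i k * G x k j = if i = j then 1 else 0 := fun i j => by
    rw [← Matrix.mul_apply, h.inv_mul hx, Matrix.one_apply]
  have h2 : ∀ e d, nabla4 G T x e a b c d = ∑ k, G x d k * nabla31 G V x e a b c k := by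
    intro e d
    have e1 : pd e (fun y => T y a b c d) x = ∑ k, (pd e (fun y => G y d k) x * V x a b c k
        + G x d k * pd e (fun y => V y a b c k) x) := by
      rw [pd_congr (g := fun y => ∑ k, G y d k * V y a b c k) (Filter.eventuallyEq_of_mem
        (h.isOpen.mem_nhds hx) fun y hy => hTV y hy a b c d),
        pd_sum (h := fun k y => G y d k * V y a b c k) fun k _ =>
          (h.entryDiffAt hx d k).fun_mul (hV a b c k)]
      exact Finset.sum_congr rfl fun k _ => pd_mul (h.entryDiffAt hx d k) (hV a b c k)
    have e2 : ∀ (i : Fin 4) (X : Fin 4 → Fin 4 → ℝ), ∑ f, christoffel G x f e i *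
        (∑ k, G x d k * X f k) = ∑ k, G x d k * ∑ f, christoffel G x f e i * X f k := by
      intro i X
      simp only [Finset.mul_sum]
      rw [Finset.sum_comm]
      exact Finset.sum_congr rfl fun k _ => Finset.sum_congr rfl fun f _ => by ring
    have e3 : ∑ f, christoffel G x f e d * ∑ k, G x f k * V x a b c k
        = ∑ k, (∑ f, christoffel G x f e d * G x f k) * V x a b c k := by
      simp only [Finset.mul_sum, Finset.sum_mul, ← mul_assoc]
      exact Finset.sum_comm
    have e4 : ∑ k, (∑ f, G x d f * christoffel G x f e k) * V x a b c k
        = ∑ k, G x d k * ∑ f, christoffel G x k e f * V x a b c f := by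
      simp only [Finset.mul_sum, Finset.sum_mul, ← mul_assoc]
      exact Finset.sum_comm
    simp only [nabla4, e1, h.pd_metric hx, hTV x hx, Finset.sum_add_distrib, add_mul, nabla31,
      Finset.sum_sub_distrib, mul_add, mul_sub]
    rw [e2 a fun f k => V x f b c k, e2 b fun f k => V x a f c k, e2 c fun f k => V x a b f k,
      e3, e4]
    ring
  simp only [div31, h2]
  refine Finset.sum_congr rfl fun e _ => ?_
  simp only [Finset.mul_sum, ← mul_assoc]
  rw [Finset.sum_comm]
  simp [← Finset.sum_mul, h1]

/-- The covariant derivative of a tensor with the symmetries of the Weyl tensor has these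
symmetries. -/
lemma isWeylTensor_nabla4 (h : SmoothMetric U G) (hx : x ∈ U)
    (hd : ∀ a b c d, DifferentiableAt ℝ (fun y => T y a b c d) x)
    (hT : ∀ y ∈ U, IsWeylTensor (G y)⁻¹ (T y)) (e : Fin 4) :
    IsWeylTensor (G x)⁻¹ (nabla4 G T x e) := by
  have hev : ∀ {f g : R4 → ℝ}, (∀ y ∈ U, f y = g y) → pd e f x = pd e g x := fun hfg =>
    pd_congr (Filter.eventuallyEq_of_mem (h.isOpen.mem_nhds hx) hfg)
  have hTx := hT x hx
  refine ⟨fun a b c d => ?_, fun a b c d => ?_, fun a b c d => ?_, fun a c => ?_⟩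
  · simp only [nabla4]
    rw [hev fun y hy => (hT y hy).antisymm a b c d, pd_neg, neg_sub', ← Finset.sum_neg_distrib]
    congr 1
    refine Finset.sum_congr rfl fun f _ => ?_
    rw [hTx.antisymm a f c d, hTx.antisymm f b c d, hTx.antisymm a b f d, hTx.antisymm a b c f]
    ring
  · simp only [nabla4]
    rw [hev fun y hy => (hT y hy).pair a b c d]
    congr 1
    refine Finset.sum_congr rfl fun f _ => ?_
    rw [hTx.pair a b f d, hTx.pair a b c f, hTx.pair f b c d, hTx.pair a f c d]
    ring
  · have h1 : pd e (fun y => T y a b c d) x + pd e (fun y => T y b c a d) x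
        + pd e (fun y => T y c a b d) x = 0 := by
      rw [← pd_add (hd _ _ _ _) (hd _ _ _ _), ← pd_add ((hd _ _ _ _).fun_add (hd _ _ _ _))
        (hd _ _ _ _), hev fun y hy => (hT y hy).cyclic a b c d, pd_const]
    have h2 : ∑ f, (christoffel G x f e a * T x f b c d
        + christoffel G x f e b * T x a f c d + christoffel G x f e c * T x a b f d
        + christoffel G x f e d * T x a b c f)
        + ∑ f, (christoffel G x f e b * T x f c a d
        + christoffel G x f e c * T x b f a d + christoffel G x f e a * T x b c f d
        + christoffel G x f e d * T x b c a f)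
        + ∑ f, (christoffel G x f e c * T x f a b d
        + christoffel G x f e a * T x c f b d + christoffel G x f e b * T x c a f d
        + christoffel G x f e d * T x c a b f) = 0 := by
      rw [← Finset.sum_add_distrib, ← Finset.sum_add_distrib]
      refine Finset.sum_eq_zero fun f _ => ?_
      linear_combination christoffel G x f e a * hTx.cyclic f b c d
        + christoffel G x f e b * hTx.cyclic a f c d + christoffel G x f e c * hTx.cyclic a b f d
        + christoffel G x f e d * hTx.cyclic a b c f
    simp only [nabla4]
    linarith
  · have hGi : ∀ b d, DifferentiableAt ℝ (fun y => (G y)⁻¹ b d) x := fun b d =>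
      (h.smooth_inv b d).differentiableAt_of_mem h.isOpen hx
    have h1 : ∑ b, ∑ d, (pd e (fun y => (G y)⁻¹ b d) x * T x a b c d
        + (G x)⁻¹ b d * pd e (fun y => T y a b c d) x) = 0 := by
      rw [← pd_const (i := e) (x := x) (0 : ℝ), ← hev fun y hy => (hT y hy).trace a c,
        pd_sum (h := fun b y => ∑ d, (G y)⁻¹ b d * T y a b c d) fun b _ =>
          DifferentiableAt.fun_sum fun d _ => (hGi b d).fun_mul (hd a b c d)]
      refine Finset.sum_congr rfl fun b _ => ?_
      rw [pd_sum (h := fun d y => (G y)⁻¹ b d * T y a b c d) fun d _ =>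
          (hGi b d).fun_mul (hd a b c d)]
      exact Finset.sum_congr rfl fun d _ => (pd_mul (hGi b d) (hd a b c d)).symm
    have h2 : ∀ b d, pd e (fun y => (G y)⁻¹ b d) x
        = -(∑ f, christoffel G x b e f * (G x)⁻¹ f d + ∑ f, (G x)⁻¹ b f * christoffel G x d e f) :=
      fun b d => congrFun (congrFun (h.mpd_inv hx e) b) d
    have e1 : ∑ b, ∑ d, (∑ f, christoffel G x b e f * (G x)⁻¹ f d) * T x a b c d
        = ∑ b, ∑ d, (G x)⁻¹ b d * ∑ f, christoffel G x f e b * T x a f c d := by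
      simp only [Finset.mul_sum, Finset.sum_mul]
      have : ∀ f : Fin 4 → Fin 4 → Fin 4 → ℝ, ∑ b, ∑ d, ∑ k, f b d k
          = ∑ k, ∑ d, ∑ b, f b d k := by
        intro f
        conv_lhs => enter [2, b]; rw [Finset.sum_comm]
        rw [Finset.sum_comm]
        exact Finset.sum_congr rfl fun k _ => Finset.sum_comm
      rw [this]
      exact Finset.sum_congr rfl fun k _ => Finset.sum_congr rfl fun d _ =>
        Finset.sum_congr rfl fun b _ => by ring
    have e2 : ∑ b, ∑ d, (∑ f, (G x)⁻¹ b f * christoffel G x d e f) * T x a b c d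
        = ∑ b, ∑ d, (G x)⁻¹ b d * ∑ f, christoffel G x f e d * T x a b c f := by
      simp only [Finset.mul_sum, Finset.sum_mul]
      refine Finset.sum_congr rfl fun b _ => ?_
      rw [Finset.sum_comm]
      exact Finset.sum_congr rfl fun k _ => Finset.sum_congr rfl fun d _ => by ring
    have e3 : ∀ (i : Fin 4) (X : Fin 4 → Fin 4 → Fin 4 → ℝ),
        (∀ f, ∑ b, ∑ d, (G x)⁻¹ b d * X f b d = 0) →
        ∑ b, ∑ d, (G x)⁻¹ b d * ∑ f, christoffel G x f e i * X f b d = 0 := by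
      intro i X hX
      have : ∀ b, ∑ d, (G x)⁻¹ b d * ∑ f, christoffel G x f e i * X f b d
          = ∑ f, christoffel G x f e i * ∑ d, (G x)⁻¹ b d * X f b d := by
        intro b
        simp only [Finset.mul_sum]
        rw [Finset.sum_comm]
        exact Finset.sum_congr rfl fun f _ => Finset.sum_congr rfl fun d _ => by ring
      simp only [this]
      rw [Finset.sum_comm]
      simp only [← Finset.mul_sum, hX]
      simp
    have e4 := e3 a (fun f b d => T x f b c d) fun f => hTx.trace f c
    have e5 := e3 c (fun f b d => T x a b f d) fun f => hTx.trace a f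
    simp only [h2, neg_mul, add_mul, Finset.sum_add_distrib, Finset.sum_neg_distrib, neg_add,
      e1, e2] at h1
    simp only [nabla4, mul_sub, Finset.sum_sub_distrib, Finset.sum_add_distrib, mul_add, e4, e5]
    linarith

end SmoothMetric

/-! ### Derivatives of the volume element and of self-dual parts -/

/-- Jacobi's formula for the derivative of a determinant. -/
lemma pd_det {n : Type} [Fintype n] [DecidableEq n] {M : R4 → Matrix n n ℝ} {x : R4} {i : Fin 4}
    (hM : EntryDiffAt M x) :
    pd i (fun y => (M y).det) x = ((M x).adjugate * mpd i M x).trace := by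
  have hp : ∀ σ : Equiv.Perm n, DifferentiableAt ℝ (fun y => ∏ k, M y (σ k) k) x := fun σ =>
    (HasFDerivAt.finsetProd (g := fun k y => M y (σ k) k) fun k _ =>
      (hM (σ k) k).hasFDerivAt).differentiableAt
  have h1 : ∀ σ : Equiv.Perm n, pd i (fun y => ((Equiv.Perm.sign σ : ℤ) : ℝ) * ∏ k, M y (σ k) k) x
      = ∑ j, ((Equiv.Perm.sign σ : ℤ) : ℝ)
        * ∏ k, (M x).updateCol j (fun l => mpd i M x l j) (σ k) k := by
    intro σ
    rw [pd_const_mul _ (hp σ), pd,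
      fderiv_finsetProd fun k _ => hM (σ k) k, ← Finset.mul_sum]
    congr 1
    simp only [_root_.sum_apply, _root_.smul_apply, smul_eq_mul]
    refine Finset.sum_congr rfl fun j _ => ?_
    rw [← Finset.mul_prod_erase Finset.univ _ (Finset.mem_univ j), Matrix.updateCol_self, mul_comm]
    refine congrArg₂ _ rfl (Finset.prod_congr rfl fun k hk => ?_)
    rw [Matrix.updateCol_ne (Finset.ne_of_mem_erase hk)]
  simp only [Matrix.det_apply']
  rw [pd_sum (h := fun σ y => ((Equiv.Perm.sign σ : ℤ) : ℝ) * ∏ k, M y (σ k) k) fun σ _ =>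
    (hp σ).const_mul _]
  simp only [h1]
  rw [Finset.sum_comm]
  refine Finset.sum_congr rfl fun j _ => ?_
  rw [← Matrix.det_apply', ← Matrix.cramer_apply, Matrix.cramer_eq_adjugate_mulVec]
  rfl

/-- The action of matrices on the Levi-Civita symbol is by the trace, here for an elementary matrix. -/
lemma lc4_derivation : ∀ p q a b c d : Fin 4,
    (if q = a then lc4 p b c d else 0) + (if q = b then lc4 a p c d else 0)
      + (if q = c then lc4 a b p d else 0) + (if q = d then lc4 a b c p else 0)
      = if p = q then lc4 a b c d else 0 := by
  decide +kernel

/-- The components `v ε_{abcd}` of a smooth volume element of a Lorentzian metric, with `v` the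
square root of minus the determinant of the metric, up to sign. -/
structure SmoothVolume (U : Set R4) (G : R4 → Matrix (Fin 4) (Fin 4) ℝ)
    (vol : R4 → Fin 4 → Fin 4 → Fin 4 → Fin 4 → ℝ) (v : R4 → ℝ) : Prop where
  eq : ∀ y ∈ U, ∀ a b c d, vol y a b c d = v y * lc4 a b c d
  smooth : ContDiffOn ℝ ∞ v U
  sq : ∀ y ∈ U, v y ^ 2 = -(G y).det

namespace SmoothVolume

variable {U : Set R4} {G : R4 → Matrix (Fin 4) (Fin 4) ℝ} {x : R4}
  {vol : R4 → Fin 4 → Fin 4 → Fin 4 → Fin 4 → ℝ} {v : R4 → ℝ}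

lemma diff (hv : SmoothVolume U G vol v) (h : SmoothMetric U G) (hx : x ∈ U) :
    DifferentiableAt ℝ v x := hv.smooth.differentiableAt_of_mem h.isOpen hx

/-- The derivative of the density `v = ± √(-det g)` is the trace of the connection, by Jacobi's formula. -/
lemma pd_eq (hv : SmoothVolume U G vol v) (h : SmoothMetric U G) (hx : x ∈ U) (e : Fin 4) :
    pd e v x = (conn G e x).trace * v x := by
  have hv0 : v x ≠ 0 := by
    intro h0
    have := hv.sq x hx
    rw [h0] at this
    exact (h.det x hx).ne_zero (by linarith)
  have h1 : pd e (fun y => v y * v y) x = -pd e (fun y => (G y).det) x := by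
    rw [← pd_neg]
    refine pd_congr (Filter.eventuallyEq_of_mem (h.isOpen.mem_nhds hx) fun y hy => ?_)
    rw [← hv.sq y hy, _root_.sq]
  have h2 : ((G x).adjugate * ((conn G e x)ᵀ * G x)).trace = (G x).det * (conn G e x).trace := by
    rw [Matrix.trace_mul_comm, Matrix.mul_assoc, Matrix.mul_adjugate, Matrix.mul_smul,
      Matrix.mul_one, Matrix.trace_smul, Matrix.trace_transpose, smul_eq_mul]
  rw [pd_mul (hv.diff h hx) (hv.diff h hx), pd_det (h.entryDiffAt hx), h.compat hx, Matrix.mul_add,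
    Matrix.trace_add, h2, ← Matrix.mul_assoc, Matrix.adjugate_mul, Matrix.smul_mul, Matrix.one_mul,
    Matrix.trace_smul, smul_eq_mul] at h1
  have h3 := hv.sq x hx
  refine mul_right_cancel₀ hv0 ?_
  linear_combination (1 / 2) * h1 - (conn G e x).trace * h3

/-- The volume element is covariantly constant. -/
lemma nabla4_eq_zero (hv : SmoothVolume U G vol v) (h : SmoothMetric U G) (hx : x ∈ U)
    (e a b c d : Fin 4) : nabla4 G vol x e a b c d = 0 := by
  have h1 : pd e (fun y => vol y a b c d) x = (conn G e x).trace * v x * lc4 a b c d := by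
    rw [pd_congr (Filter.eventuallyEq_of_mem (h.isOpen.mem_nhds hx) fun y hy => hv.eq y hy a b c d),
      pd_mul (hv.diff h hx) (differentiableAt_const _), pd_const, hv.pd_eq h hx]
    ring
  have h2 : ∀ p q, christoffel G x p e q * ((if q = a then (lc4 p b c d : ℝ) else 0)
      + (if q = b then (lc4 a p c d : ℝ) else 0) + (if q = c then (lc4 a b p d : ℝ) else 0)
      + (if q = d then (lc4 a b c p : ℝ) else 0))
      = christoffel G x p e q * if p = q then (lc4 a b c d : ℝ) else 0 := fun p q => by
    have := congrArg (Int.cast (R := ℝ)) (lc4_derivation p q a b c d)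
    push_cast at this
    rw [this]
  have h3 := Finset.sum_congr rfl fun p (_ : p ∈ Finset.univ) =>
    Finset.sum_congr rfl fun q (_ : q ∈ Finset.univ) => h2 p q
  simp only [mul_add, mul_ite, mul_zero, Finset.sum_add_distrib, Finset.sum_ite_eq',
    Finset.sum_ite_eq, Finset.mem_univ, if_true] at h3
  have h4 : (conn G e x).trace = ∑ p, christoffel G x p e p := rfl
  rw [nabla4, h1, h4]
  simp only [hv.eq x hx, Finset.sum_add_distrib]
  rw [mul_right_comm, Finset.sum_mul, ← h3]
  simp only [add_mul, Finset.sum_mul]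
  simp only [mul_assoc, mul_comm (v x), sub_self]

end SmoothVolume

/-- The action of the connection matrix on bivectors. -/
noncomputable def connBiv (G : R4 → Matrix (Fin 4) (Fin 4) ℝ) (e : Fin 4) (x : R4) :
    Matrix (Fin 4 × Fin 4) (Fin 4 × Fin 4) ℂ :=
  toC (conn G e x) ⊗ₖ 1 + 1 ⊗ₖ toC (conn G e x)

/-- The inverse metric on bivectors. -/
noncomputable def invBiv (G : R4 → Matrix (Fin 4) (Fin 4) ℝ) (x : R4) :
    Matrix (Fin 4 × Fin 4) (Fin 4 × Fin 4) ℂ :=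
  toC (G x)⁻¹ ⊗ₖ toC (G x)⁻¹

lemma mpd_kronecker {F l m n p : Type} [NormedCommRing F] [NormedAlgebra ℝ F]
    {M : R4 → Matrix l m F} {N : R4 → Matrix n p F} {x : R4}
    {i : Fin 4} (hM : EntryDiffAt M x) (hN : EntryDiffAt N x) :
    mpd i (fun y => M y ⊗ₖ N y) x = mpd i M x ⊗ₖ N x + M x ⊗ₖ mpd i N x := by
  ext a b
  exact pd_mul (hM a.1 b.1) (hN a.2 b.2)

lemma mpd_toC {l m : Type} {M : R4 → Matrix l m ℝ} {x : R4} {i : Fin 4} (hM : EntryDiffAt M x) :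
    mpd i (fun y => toC (M y)) x = toC (mpd i M x) := by
  ext a b
  exact pd_ofReal (hM a b)

lemma EntryDiffAt.toC {l m : Type} {M : R4 → Matrix l m ℝ} {x : R4} (hM : EntryDiffAt M x) :
    EntryDiffAt (fun y => toC (M y)) x := fun a b => differentiableAt_ofReal (hM a b)

lemma entryDiffAt_bv {T : R4 → Fin 4 → Fin 4 → Fin 4 → Fin 4 → ℝ} {x : R4}
    (hT : ∀ a b c d, DifferentiableAt ℝ (fun y => T y a b c d) x) :
    EntryDiffAt (fun y => bv fun a b c d => (T y a b c d : ℂ)) x :=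
  fun _ _ => differentiableAt_ofReal (hT _ _ _ _)

/-- The partial derivative of a tensor, as its covariant derivative and the action of the connection. -/
lemma mpd_bv {G : R4 → Matrix (Fin 4) (Fin 4) ℝ} {T : R4 → Fin 4 → Fin 4 → Fin 4 → Fin 4 → ℝ}
    {x : R4} (hT : ∀ a b c d, DifferentiableAt ℝ (fun y => T y a b c d) x) (e : Fin 4) :
    mpd e (fun y => bv fun a b c d => (T y a b c d : ℂ)) x
      = bv (fun a b c d => (nabla4 G T x e a b c d : ℂ))
        + (connBiv G e x)ᵀ * bv (fun a b c d => (T x a b c d : ℂ))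
        + bv (fun a b c d => (T x a b c d : ℂ)) * connBiv G e x := by
  ext ⟨a, b⟩ ⟨c, d⟩
  have h1 : mpd e (fun y => bv fun a b c d => (T y a b c d : ℂ)) x (a, b) (c, d)
      = ((pd e (fun y => T y a b c d) x : ℝ) : ℂ) := pd_ofReal (hT a b c d)
  rw [h1]
  simp only [Matrix.add_apply, Matrix.mul_apply, Fintype.sum_prod_type, connBiv,
    Matrix.transpose_apply, Matrix.kroneckerMap_apply, Matrix.one_apply, bv, Matrix.of_apply,
    Matrix.map_apply, nabla4, conn, add_mul, mul_add, Finset.sum_add_distrib]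
  push_cast
  simp only [mul_ite, ite_mul, mul_one, one_mul, mul_zero, zero_mul, Finset.sum_ite_eq',
    Finset.mem_univ, if_true, Finset.sum_const_zero, Finset.sum_ite_irrel]
  simp only [mul_comm (T _ _ _ _ _ : ℂ)]
  ring

namespace SmoothMetric

variable {U : Set R4} {G : R4 → Matrix (Fin 4) (Fin 4) ℝ} {x : R4}

lemma entryDiffAt_inv (h : SmoothMetric U G) (hx : x ∈ U) :
    EntryDiffAt (fun y => (G y)⁻¹) x := fun i j =>
  (h.smooth_inv i j).differentiableAt_of_mem h.isOpen hx

lemma entryDiffAt_invBiv (h : SmoothMetric U G) (hx : x ∈ U) : EntryDiffAt (invBiv G) x :=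
  fun _ _ => ((h.entryDiffAt_inv hx).toC _ _).fun_mul ((h.entryDiffAt_inv hx).toC _ _)

/-- The inverse metric on bivectors is covariantly constant. -/
lemma mpd_invBiv (h : SmoothMetric U G) (hx : x ∈ U) (e : Fin 4) :
    mpd e (invBiv G) x = -(connBiv G e x * invBiv G x + invBiv G x * (connBiv G e x)ᵀ) := by
  have h1 := h.entryDiffAt_inv hx
  have h2 : toC (-(conn G e x * (G x)⁻¹ + (G x)⁻¹ * (conn G e x)ᵀ))
      = -(toC (conn G e x) * toC (G x)⁻¹ + toC (G x)⁻¹ * (toC (conn G e x))ᵀ) := by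
    ext i j
    simp [Matrix.mul_apply]
  rw [show invBiv G = fun y => toC (G y)⁻¹ ⊗ₖ toC (G y)⁻¹ from rfl, mpd_kronecker h1.toC h1.toC,
    mpd_toC h1, h.mpd_inv hx, h2, connBiv, Matrix.transpose_add,
    ← Matrix.kroneckerMap_transpose, ← Matrix.kroneckerMap_transpose, Matrix.transpose_one]
  simp only [Matrix.add_mul, Matrix.mul_add, ← Matrix.mul_kronecker_mul, Matrix.one_mul,
    Matrix.mul_one]
  rw [← neg_one_smul ℂ (toC (conn G e x) * toC (G x)⁻¹ + _), Matrix.smul_kronecker,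
    Matrix.kronecker_smul]
  simp only [Matrix.add_kronecker, Matrix.kronecker_add]
  module

lemma invBiv_transpose (h : SmoothMetric U G) (hx : x ∈ U) : (invBiv G x)ᵀ = invBiv G x := by
  rw [invBiv, ← Matrix.kroneckerMap_transpose, ← Matrix.transpose_map, h.inv_transpose hx]

end SmoothMetric

section SelfDual

variable {U : Set R4} {G : R4 → Matrix (Fin 4) (Fin 4) ℝ} {x : R4}
  {vol T : R4 → Fin 4 → Fin 4 → Fin 4 → Fin 4 → ℝ} {v : R4 → ℝ}

/-- The derivative of the self-dual part of a tensor: taking it commutes with the covariant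
derivative. -/
lemma mpd_selfDual (hv : SmoothVolume U G vol v) (h : SmoothMetric U G) (hx : x ∈ U)
    (hT : ∀ a b c d, DifferentiableAt ℝ (fun y => T y a b c d) x) (e : Fin 4) :
    EntryDiffAt (fun y => bv (selfDual (G y) (vol y) (T y))) x ∧
    mpd e (fun y => bv (selfDual (G y) (vol y) (T y))) x
      = bv (selfDual (G x) (vol x) (nabla4 G T x e))
        + (connBiv G e x)ᵀ * bv (selfDual (G x) (vol x) (T x))
        + bv (selfDual (G x) (vol x) (T x)) * connBiv G e x := by
  have hvol : ∀ a b c d, DifferentiableAt ℝ (fun y => vol y a b c d) x := fun a b c d =>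
    ((hv.diff h hx).mul_const _).congr_of_eventuallyEq
      (Filter.eventuallyEq_of_mem (h.isOpen.mem_nhds hx) fun y hy => hv.eq y hy a b c d)
  have hTb := entryDiffAt_bv hT
  have hVb := (entryDiffAt_bv hvol).transpose
  have hK := (h.entryDiffAt_invBiv hx).transpose
  have hV := mpd_bv (G := G) hvol e
  have h0 : bv (fun a b c d => (nabla4 G vol x e a b c d : ℂ)) = 0 := by
    ext ⟨a, b⟩ ⟨c, d⟩
    simp [bv, hv.nabla4_eq_zero h hx]
  rw [h0, zero_add] at hV
  have hK' : ∀ y, toC (G y)⁻¹ ⊗ₖ toC (G y)⁻¹ = invBiv G y := fun _ => rfl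
  have h1 := (hTb.mul hK).mul hVb
  simp only [bv_selfDual, hK']
  refine ⟨(hTb.sub (h1.smul _)).smul _, ?_⟩
  rw [mpd_smul _ (hTb.sub (h1.smul _)), mpd_sub hTb (h1.smul _), mpd_smul _ h1,
    mpd_mul (hTb.mul hK) hVb, mpd_mul hTb hK, mpd_transpose, mpd_transpose, hV,
      mpd_bv (G := G) hT e,
    h.mpd_invBiv hx]
  simp only [Matrix.transpose_add, Matrix.transpose_mul, Matrix.transpose_neg,
    Matrix.transpose_transpose, Matrix.mul_add, Matrix.add_mul, Matrix.mul_sub, Matrix.sub_mul,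
    Matrix.mul_smul, Matrix.smul_mul, Matrix.mul_neg, Matrix.neg_mul, Matrix.mul_assoc]
  module

/-- The derivative of `𝔡_{abcd} 𝔡^{abcd}`.  The terms with the connection cancel under the trace. -/
lemma pd_scalarA (hv : SmoothVolume U G vol v) (h : SmoothMetric U G) (hx : x ∈ U)
    (hT : ∀ a b c d, DifferentiableAt ℝ (fun y => T y a b c d) x) (e : Fin 4)
    (hs : (bv (selfDual (G x) (vol x) (T x)))ᵀ = bv (selfDual (G x) (vol x) (T x)))
    (hsN : (bv (selfDual (G x) (vol x) (nabla4 G T x e)))ᵀ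
      = bv (selfDual (G x) (vol x) (nabla4 G T x e))) :
    DifferentiableAt ℝ (fun y => scalarA (G y) (selfDual (G y) (vol y) (T y))) x ∧
    pd e (fun y => scalarA (G y) (selfDual (G y) (vol y) (T y))) x
      = 2 * (bv (selfDual (G x) (vol x) (nabla4 G T x e)) * invBiv G x
        * (bv (selfDual (G x) (vol x) (T x)) * invBiv G x)).trace := by
  obtain ⟨hD, hd⟩ := mpd_selfDual hv h hx hT e
  have hK := h.entryDiffAt_invBiv hx
  have hX := hD.mul hK.transpose
  have hX' := (hK.mul hD).transpose
  have hK' : ∀ y, toC (G y)⁻¹ ⊗ₖ toC (G y)⁻¹ = invBiv G y := fun _ => rfl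
  simp only [scalarA_eq_trace, bv_raiseLast, bv_raiseFirst, hK']
  refine ⟨DifferentiableAt.fun_sum fun k _ => hX.mul hX' k k, ?_⟩
  rw [pd_trace (hX.mul hX'), mpd_mul hX hX', mpd_transpose, mpd_mul hK hD, mpd_mul hD hK.transpose,
    mpd_transpose, hd, h.mpd_invBiv hx]
  simp only [Matrix.transpose_add, Matrix.transpose_mul, Matrix.transpose_neg,
    Matrix.transpose_transpose, hs, hsN, h.invBiv_transpose hx]
  generalize bv (selfDual (G x) (vol x) (nabla4 G T x e)) = N
  generalize bv (selfDual (G x) (vol x) (T x)) = D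
  generalize invBiv G x = K
  generalize connBiv G e x = A
  have c1 : (N * (K * (D * K))).trace = (D * (K * (N * K))).trace := by
    rw [← Matrix.mul_assoc N, Matrix.trace_mul_comm, Matrix.mul_assoc]
  have c2 : (Aᵀ * (D * (K * (D * K)))).trace = (D * (K * (D * (K * Aᵀ)))).trace := by
    rw [Matrix.trace_mul_comm]
    simp only [Matrix.mul_assoc]
  simp only [Matrix.mul_add, Matrix.add_mul, Matrix.mul_neg, Matrix.neg_mul, Matrix.mul_assoc,
    Matrix.trace_add, Matrix.trace_neg, c1, c2]
  ring

/-- The derivative of `𝔡_{ab}{}^{cd} 𝔡_{cd}{}^{pq} 𝔡_{pq}{}^{ab}`.  The terms with the connection cancel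
under the trace. -/
lemma pd_scalarB (hv : SmoothVolume U G vol v) (h : SmoothMetric U G) (hx : x ∈ U)
    (hT : ∀ a b c d, DifferentiableAt ℝ (fun y => T y a b c d) x) (e : Fin 4) :
    DifferentiableAt ℝ (fun y => scalarB (G y) (selfDual (G y) (vol y) (T y))) x ∧
    pd e (fun y => scalarB (G y) (selfDual (G y) (vol y) (T y))) x
      = 3 * (bv (selfDual (G x) (vol x) (nabla4 G T x e)) * invBiv G x
        * (bv (selfDual (G x) (vol x) (T x)) * invBiv G x
          * (bv (selfDual (G x) (vol x) (T x)) * invBiv G x))).trace := by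
  obtain ⟨hD, hd⟩ := mpd_selfDual hv h hx hT e
  have hK := h.entryDiffAt_invBiv hx
  have hX := hD.mul hK.transpose
  have hK' : ∀ y, toC (G y)⁻¹ ⊗ₖ toC (G y)⁻¹ = invBiv G y := fun _ => rfl
  simp only [scalarB_eq_trace, bv_raiseLast, hK']
  refine ⟨DifferentiableAt.fun_sum fun k _ => hX.mul (hX.mul hX) k k, ?_⟩
  rw [pd_trace (hX.mul (hX.mul hX)), mpd_mul hX (hX.mul hX), mpd_mul hX hX,
    mpd_mul hD hK.transpose, mpd_transpose, hd, h.mpd_invBiv hx]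
  simp only [Matrix.transpose_add, Matrix.transpose_mul, Matrix.transpose_neg,
    Matrix.transpose_transpose, h.invBiv_transpose hx]
  generalize bv (selfDual (G x) (vol x) (nabla4 G T x e)) = N
  generalize bv (selfDual (G x) (vol x) (T x)) = D
  generalize invBiv G x = K
  generalize connBiv G e x = A
  have c1 : (D * (K * (N * (K * (D * K))))).trace = (N * (K * (D * (K * (D * K))))).trace := by
    rw [← Matrix.mul_assoc D, Matrix.trace_mul_comm]
    simp only [Matrix.mul_assoc]
  have c2 : (D * (K * (D * (K * (N * K))))).trace = (N * (K * (D * (K * (D * K))))).trace := by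
    rw [← c1, ← Matrix.mul_assoc D, Matrix.trace_mul_comm]
    simp only [Matrix.mul_assoc]
  have c3 : (Aᵀ * (D * (K * (D * (K * (D * K)))))).trace
      = (D * (K * (D * (K * (D * (K * Aᵀ)))))).trace := by
    rw [Matrix.trace_mul_comm]
    simp only [Matrix.mul_assoc]
  simp only [Matrix.mul_add, Matrix.add_mul, Matrix.mul_neg, Matrix.neg_mul, Matrix.mul_assoc,
    Matrix.trace_add, Matrix.trace_neg, c1, c2, c3]
  ring

end SelfDual

/-! ### Conformally vacuum fields in coordinates -/

/-- Components, on an open set of the coordinate space, of the unphysical fields for which the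
physical metric `Gt` is an Einstein metric. -/
structure VacuumFields (U : Set R4) (L : LocalFields) (Gt : R4 → Matrix (Fin 4) (Fin 4) ℝ)
    (lam : ℝ) (v : R4 → ℝ) : Prop where
  pair : ConformalPair U L.metric Gt L.conf
  einstein : ∀ y ∈ U, ∀ i j, ricci Gt y i j = lam * Gt y i j
  volume : SmoothVolume U L.metric L.vol v
  smooth_normal : ∀ i, ContDiffOn ℝ ∞ (fun y => L.normal y i) U
  unit : ∀ y ∈ U, ∑ a, L.normal y a * L.nUp y a = -1

lemma toC_inv {G : Matrix (Fin 4) (Fin 4) ℝ} (hG : IsUnit G.det) : (toC G)⁻¹ = toC G⁻¹ := by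
  refine Matrix.inv_eq_right_inv ?_
  have h1 : toC G * toC G⁻¹ = toC (G * G⁻¹) := by
    ext i j
    simp [Matrix.mul_apply]
  rw [h1, Matrix.mul_nonsing_inv _ hG]
  ext i j
  simp [Matrix.one_apply, apply_ite]

namespace VacuumFields

variable {U : Set R4} {L : LocalFields} {Gt : R4 → Matrix (Fin 4) (Fin 4) ℝ} {lam : ℝ} {v : R4 → ℝ}
  {x : R4} {P Q : Matrix (Fin 4) (Fin 4) ℂ} {s : ℂ}

section Fields

variable (h : VacuumFields U L Gt lam v)
include h

lemma lower_normal (hx : x ∈ U) (k : Fin 4) : ∑ d, L.metric x k d * L.nUp x d = L.normal x k := by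
  have h1 : ∀ j, ∑ d, L.metric x k d * (L.metric x)⁻¹ d j = if k = j then 1 else 0 := fun j => by
    rw [← Matrix.mul_apply, h.pair.metric.mul_inv hx, Matrix.one_apply]
  simp only [LocalFields.nUp, Finset.mul_sum, ← mul_assoc]
  rw [Finset.sum_comm]
  simp [← Finset.sum_mul, h1]

lemma diff_nUp (hx : x ∈ U) (a : Fin 4) : DifferentiableAt ℝ (fun y => L.nUp y a) x :=
  DifferentiableAt.fun_sum fun b _ => (h.pair.metric.entryDiffAt_inv hx a b).fun_mul
    ((h.smooth_normal b).differentiableAt_of_mem h.pair.metric.isOpen hx)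

lemma resWeyl_eq (hx : x ∈ U) (a b c d : Fin 4) : L.resWeyl x a b c d
    = ∑ k, L.metric x d k * ((L.conf x)⁻¹ * einsteinWeyl Gt lam x a b c k) := by
  have h0 := h.pair.ne_zero x hx
  rw [LocalFields.resWeyl, h.pair.weyl_eq hx, ← h.pair.phys.lower_einsteinWeyl hx (h.einstein x hx),
    h.pair.eq x hx, Finset.mul_sum, Finset.sum_div]
  refine Finset.sum_congr rfl fun k _ => ?_
  rw [Matrix.smul_apply, smul_eq_mul]
  field_simp

lemma smooth_resWeylUp (a b c d : Fin 4) :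
    ContDiffOn ℝ ∞ (fun y => (L.conf y)⁻¹ * einsteinWeyl Gt lam y a b c d) U :=
  (h.pair.smooth.inv h.pair.ne_zero).mul (h.pair.phys.smooth_einsteinWeyl a b c d)

lemma diff_resWeyl (hx : x ∈ U) (a b c d : Fin 4) :
    DifferentiableAt ℝ (fun y => L.resWeyl y a b c d) x := by
  have hU := h.pair.metric.isOpen
  refine DifferentiableAt.congr_of_eventuallyEq (DifferentiableAt.fun_sum (u := Finset.univ) fun k _ =>
    (h.pair.metric.entryDiffAt hx d k).fun_mul
      ((h.smooth_resWeylUp a b c k).differentiableAt_of_mem hU hx)) ?_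
  exact Filter.eventuallyEq_of_mem (hU.mem_nhds hx) fun y hy => h.resWeyl_eq hy a b c d

lemma isWeylTensor_resWeyl (hx : x ∈ U) : IsWeylTensor (L.metric x)⁻¹ (L.resWeyl x) := by
  have hw := h.pair.metric.isWeylTensor_weyl hx
  refine ⟨fun a b c d => ?_, fun a b c d => ?_, fun a b c d => ?_, fun a c => ?_⟩
  · simp only [LocalFields.resWeyl]; rw [hw.antisymm, neg_div]
  · simp only [LocalFields.resWeyl]; rw [hw.pair]
  · simp only [LocalFields.resWeyl]; rw [← add_div, ← add_div, hw.cyclic, zero_div]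
  · simp only [LocalFields.resWeyl, mul_div_assoc']
    simp only [← Finset.sum_div, hw.trace, zero_div]

lemma isWeylTensor_nablaResWeyl (hx : x ∈ U) (e : Fin 4) :
    IsWeylTensor (L.metric x)⁻¹ (nabla4 L.metric L.resWeyl x e) :=
  h.pair.metric.isWeylTensor_nabla4 hx (h.diff_resWeyl hx) (fun _ hy => h.isWeylTensor_resWeyl hy) e

/-- The rescaled Weyl tensor is divergence-free. -/
lemma div_resWeyl (hx : x ∈ U) (a b c : Fin 4) :
    ∑ e, ∑ d, (L.metric x)⁻¹ e d * nabla4 L.metric L.resWeyl x e a b c d = 0 := by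
  rw [h.pair.metric.sum_inv_nabla4 hx
    (fun a b c d => (h.smooth_resWeylUp a b c d).differentiableAt_of_mem h.pair.metric.isOpen hx)
    (fun y hy a b c d => h.resWeyl_eq hy a b c d), h.pair.div31_resWeyl hx h.einstein]

/-- Frames adapted to the normal exist. -/
lemma exists_adaptedFrame (hx : x ∈ U) : ∃ P Q s, AdaptedFrame L x P Q s := by
  have hd := h.pair.metric.det x hx
  have hdet : (toC (L.metric x)).det = (((L.metric x).det : ℝ) : ℂ) :=
    (RingHom.map_det Complex.ofRealHom (L.metric x)).symm
  have hn : (fun a => (L.nUp x a : ℂ)) ⬝ᵥ toC (L.metric x) *ᵥ (fun a => (L.nUp x a : ℂ)) = -1 := by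
    have h1 : toC (L.metric x) *ᵥ (fun a => (L.nUp x a : ℂ)) = fun a => (L.normal x a : ℂ) := by
      ext k
      rw [← h.lower_normal hx]
      simp [Matrix.mulVec, dotProduct]
    rw [h1]
    have := congrArg (Complex.ofReal) (h.unit x hx)
    push_cast at this
    rw [← this]
    simp [dotProduct, mul_comm]
  obtain ⟨P, Q, s, h1, h2⟩ := exists_orthFrame (G := toC (L.metric x))
    (by rw [← Matrix.transpose_map, h.pair.metric.symm x hx])
    (by rw [hdet]; exact isUnit_iff_ne_zero.mpr (Complex.ofReal_ne_zero.mpr hd.ne_zero)) _ hn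
    (v x : ℂ) (by rw [hdet]; exact_mod_cast h.volume.sq x hx)
  refine ⟨P, Q, s, ?_, h2⟩
  rw [← toC_inv hd]
  convert h1 using 2
  ext b c d
  rw [h.volume.eq x hx]
  push_cast
  rfl

/-- The covariant derivative `∇_e n^p` of the unit normal is orthogonal to the normal. -/
lemma normal_nablaUp (hx : x ∈ U) (e : Fin 4) : ∑ p, L.normal x p * (pd e (fun y => L.nUp y p) x
    + ∑ f, christoffel L.metric x p e f * L.nUp x f) = 0 := by
  have hU := h.pair.metric.isOpen
  have hn := fun i => (h.smooth_normal i).differentiableAt_of_mem hU hx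
  have h1 : ∑ a, (pd e (fun y => L.normal y a) x * L.nUp x a
      + L.normal x a * pd e (fun y => L.nUp y a) x) = 0 := by
    rw [← pd_const (i := e) (x := x) (-1 : ℝ), ← pd_congr
      (Filter.eventuallyEq_of_mem (hU.mem_nhds hx) h.unit),
      pd_sum (h := fun a y => L.normal y a * L.nUp y a) fun a _ => (hn a).fun_mul (h.diff_nUp hx a)]
    exact Finset.sum_congr rfl fun a _ => (pd_mul (hn a) (h.diff_nUp hx a)).symm
  have h2 := fun k => h.pair.metric.lower_nabla hx (u := fun k y => L.normal y k)
    (V := fun d y => L.nUp y d) (h.diff_nUp hx) (fun y hy k => h.lower_normal hy k) e k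
  set B : Fin 4 → ℝ := fun p => pd e (fun y => L.nUp y p) x
    + ∑ f, christoffel L.metric x p e f * L.nUp x f with hB
  have h3 : ∑ p, L.normal x p * B p = ∑ k, (∑ d, L.metric x k d * B d) * L.nUp x k := by
    simp only [← h.lower_normal hx, Finset.sum_mul]
    rw [Finset.sum_comm]
    exact Finset.sum_congr rfl fun k _ => Finset.sum_congr rfl fun d _ => by
      rw [h.pair.metric.apply_symm hx]; ring
  have h4 : ∑ k, (∑ f, christoffel L.metric x f e k * L.normal x f) * L.nUp x k
      = ∑ p, L.normal x p * ∑ f, christoffel L.metric x p e f * L.nUp x f := by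
    simp only [Finset.sum_mul, Finset.mul_sum]
    rw [Finset.sum_comm]
    exact Finset.sum_congr rfl fun k _ => Finset.sum_congr rfl fun d _ => by ring
  have h5 : ∑ p, L.normal x p * B p + ∑ p, L.normal x p * B p = 0 := by
    conv_lhs => enter [1]; rw [h3]
    simp only [hB, h2]
    simp only [sub_mul, mul_add, Finset.sum_sub_distrib, Finset.sum_add_distrib, h4]
    rw [Finset.sum_add_distrib] at h1
    linarith
  change ∑ p, L.normal x p * B p = 0
  linarith

/-- The derivative of the self-dual rescaled Weyl tensor, in components. -/
lemma pd_frakd (hx : x ∈ U) (e a b c d : Fin 4) :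
    DifferentiableAt ℝ (fun y => L.frakd y a b c d) x ∧
    pd e (fun y => L.frakd y a b c d) x
      = selfDual (L.metric x) (L.vol x) (nabla4 L.metric L.resWeyl x e) a b c d
        + (∑ f, (christoffel L.metric x f e a : ℂ) * L.frakd x f b c d
        + ∑ f, (christoffel L.metric x f e b : ℂ) * L.frakd x a f c d
        + ∑ f, (christoffel L.metric x f e c : ℂ) * L.frakd x a b f d
        + ∑ f, (christoffel L.metric x f e d : ℂ) * L.frakd x a b c f) := by
  obtain ⟨h1, h2⟩ := mpd_selfDual h.volume h.pair.metric hx (h.diff_resWeyl hx) e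
  refine ⟨h1 (a, b) (c, d), (congrFun (congrFun h2 (a, b)) (c, d)).trans ?_⟩
  simp only [Matrix.add_apply, Matrix.mul_apply, Fintype.sum_prod_type, connBiv,
    Matrix.transpose_apply, Matrix.kroneckerMap_apply, Matrix.one_apply, bv, Matrix.of_apply,
    Matrix.map_apply, conn, add_mul, mul_add, Finset.sum_add_distrib]
  simp only [mul_ite, ite_mul, mul_one, one_mul, mul_zero, zero_mul, Finset.sum_ite_eq',
    Finset.mem_univ, if_true, Finset.sum_const_zero, Finset.sum_ite_irrel]
  simp only [LocalFields.frakd, mul_comm (selfDual _ _ (L.resWeyl x) _ _ _ _)]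
  ring

/-- The covariant derivative of the electric part `𝔡_{apbq} n^p n^q`, by the Leibniz rule. -/
lemma nablaE_eq (hx : x ∈ U) (e b d : Fin 4) : L.nablaE x e b d
    = ∑ p, ∑ q, selfDual (L.metric x) (L.vol x) (nabla4 L.metric L.resWeyl x e) b p d q
        * L.nUp x p * L.nUp x q
      + ∑ p, ∑ q, L.frakd x b p d q *
        (((pd e (fun y => L.nUp y p) x + ∑ f, christoffel L.metric x p e f * L.nUp x f : ℝ) : ℂ)
          * L.nUp x q + L.nUp x p *
        ((pd e (fun y => L.nUp y q) x + ∑ f, christoffel L.metric x q e f * L.nUp x f : ℝ) : ℂ)) := by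
  have hn := fun a => differentiableAt_ofReal (h.diff_nUp hx a)
  have hD := fun a b c d => (h.pd_frakd hx e a b c d).1
  have h1 : pd e (fun y => L.calE y b d) x = ∑ p, ∑ q,
      (pd e (fun y => L.frakd y b p d q) x * L.nUp x p * L.nUp x q
        + L.frakd x b p d q * ((pd e (fun y => L.nUp y p) x : ℝ) : ℂ) * L.nUp x q
        + L.frakd x b p d q * L.nUp x p * ((pd e (fun y => L.nUp y q) x : ℝ) : ℂ)) := by
    simp only [LocalFields.calE]
    rw [pd_sum (h := fun p y => ∑ q, L.frakd y b p d q * (L.nUp y p : ℂ) * (L.nUp y q : ℂ))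
      fun p _ => DifferentiableAt.fun_sum fun q _ => ((hD b p d q).fun_mul (hn p)).fun_mul (hn q)]
    refine Finset.sum_congr rfl fun p _ => ?_
    rw [pd_sum (h := fun q y => L.frakd y b p d q * (L.nUp y p : ℂ) * (L.nUp y q : ℂ))
      fun q _ => ((hD b p d q).fun_mul (hn p)).fun_mul (hn q)]
    refine Finset.sum_congr rfl fun q _ => ?_
    rw [pd_mul ((hD b p d q).fun_mul (hn p)) (hn q), pd_mul (hD b p d q) (hn p),
      pd_ofReal (h.diff_nUp hx p), pd_ofReal (h.diff_nUp hx q)]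
    ring
  -- the connection terms of the free indices cancel, those of the contracted ones are relabelled
  have e1 : ∑ p, ∑ q, (∑ f, (christoffel L.metric x f e b : ℂ) * L.frakd x f p d q)
        * L.nUp x p * L.nUp x q
      = ∑ f, (christoffel L.metric x f e b : ℂ) * L.calE x f d := by
    simp only [LocalFields.calE, Fin.sum_univ_four]; ring
  have e2 : ∑ p, ∑ q, (∑ f, (christoffel L.metric x f e d : ℂ) * L.frakd x b p f q)
        * L.nUp x p * L.nUp x q
      = ∑ f, (christoffel L.metric x f e d : ℂ) * L.calE x b f := by
    simp only [LocalFields.calE, Fin.sum_univ_four]; ring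
  have e3 : ∑ p, ∑ q, (∑ f, (christoffel L.metric x f e p : ℂ) * L.frakd x b f d q)
        * L.nUp x p * L.nUp x q
      = ∑ p, ∑ q, L.frakd x b p d q * (∑ f, (christoffel L.metric x p e f : ℂ) * L.nUp x f)
        * L.nUp x q := by
    simp only [Fin.sum_univ_four]; ring
  have e4 : ∑ p, ∑ q, (∑ f, (christoffel L.metric x f e q : ℂ) * L.frakd x b p d f)
        * L.nUp x p * L.nUp x q
      = ∑ p, ∑ q, L.frakd x b p d q * L.nUp x p
        * (∑ f, (christoffel L.metric x q e f : ℂ) * L.nUp x f) := by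
    simp only [Fin.sum_univ_four]; ring
  rw [LocalFields.nablaE, h1]
  simp only [(h.pd_frakd hx e _ _ _ _).2, add_mul, Finset.sum_add_distrib, e1, e2, e3, e4]
  push_cast
  simp only [mul_add, add_mul, Finset.sum_add_distrib, mul_assoc]
  ring

end Fields

/-- The self-dual part of a tensor of Weyl type, in an adapted frame. -/
lemma _root_.TypeDData.AdaptedFrame.selfDual_eq (hf : AdaptedFrame L x P Q s)
    {T : Fin 4 → Fin 4 → Fin 4 → Fin 4 → ℝ} (hT : IsWeylTensor (L.metric x)⁻¹ T) :
    ∃ E : Matrix (Fin 3) (Fin 3) ℂ, Eᵀ = E ∧ E.trace = 0 ∧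
      bv (selfDual (L.metric x) (L.vol x) T) = (sdBiv Q s)ᵀ * E * sdBiv Q s := by
  obtain ⟨E, h1, h2, h3⟩ := hf.orth.selfDual_bv_eq hT.weylSymm
  refine ⟨E, h1, h2, ?_⟩
  rw [bv_selfDual, ← Matrix.kroneckerMap_transpose, hf.orth.inv_transpose, h3]

/-- The self-dual part of a divergence-free tensor is divergence-free, as the dual may be taken
on the first two indices. -/
lemma _root_.TypeDData.AdaptedFrame.div_selfDual (hf : AdaptedFrame L x P Q s)
    {T : Fin 4 → Fin 4 → Fin 4 → Fin 4 → Fin 4 → ℝ}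
    (hT : ∀ e, IsWeylTensor (L.metric x)⁻¹ (T e))
    (hdiv : ∀ a b c, ∑ e, ∑ d, (L.metric x)⁻¹ e d * T e a b c d = 0) (a b c : Fin 4) :
    ∑ e, ∑ d, ((L.metric x)⁻¹ e d : ℂ) * selfDual (L.metric x) (L.vol x) (T e) a b c d = 0 := by
  set J := bv (fun a b c d => (L.vol x a b c d : ℂ)) * (toC (L.metric x)⁻¹ ⊗ₖ toC (L.metric x)⁻¹)
    with hJ
  have h1 : ∀ e d, selfDual (L.metric x) (L.vol x) (T e) a b c d
      = 1 / 2 * ((T e a b c d : ℂ) - Complex.I / 2 * ∑ p, ∑ q, J (a, b) (p, q) * T e p q c d) := by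
    intro e d
    have h2 := bv_selfDual (L.metric x) (L.vol x) (T e)
    rw [← Matrix.kroneckerMap_transpose, hf.orth.inv_transpose,
      hf.orth.dual_comm (hT e).weylSymm, ← hJ] at h2
    have h3 := congrFun (congrFun h2 (a, b)) (c, d)
    simpa [bv, Matrix.mul_apply, Fintype.sum_prod_type] using h3
  have h4 : ∀ a b, ∑ e, ∑ d, ((L.metric x)⁻¹ e d : ℂ) * (T e a b c d : ℂ) = 0 := fun a b => by
    exact_mod_cast hdiv a b c
  have h5 : ∑ e, ∑ d, ((L.metric x)⁻¹ e d : ℂ) * ∑ p, ∑ q, J (a, b) (p, q) * T e p q c d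
      = ∑ p, ∑ q, J (a, b) (p, q) * ∑ e, ∑ d, ((L.metric x)⁻¹ e d : ℂ) * T e p q c d := by
    simp only [Finset.mul_sum]
    refine (Finset.sum_congr rfl fun e _ => Finset.sum_comm).trans <| Finset.sum_comm.trans <|
      Finset.sum_congr rfl fun p _ => (Finset.sum_congr rfl fun e _ => Finset.sum_comm).trans <|
      Finset.sum_comm.trans <| Finset.sum_congr rfl fun q _ => Finset.sum_congr rfl fun e _ =>
      Finset.sum_congr rfl fun d _ => by ring
  have h6 : ∀ e d, ((L.metric x)⁻¹ e d : ℂ) * selfDual (L.metric x) (L.vol x) (T e) a b c d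
      = 1 / 2 * (((L.metric x)⁻¹ e d : ℂ) * (T e a b c d : ℂ)) - Complex.I / 4 *
        (((L.metric x)⁻¹ e d : ℂ) * ∑ p, ∑ q, J (a, b) (p, q) * T e p q c d) := fun e d => by
    rw [h1]; ring
  simp only [h6, Finset.sum_sub_distrib, ← Finset.mul_sum, h4, h5]
  simp

/-- The equation `Ξ = φ η ⊗ η`, in terms of the unphysical fields, is equivalent to the three
conditions on the orthogonal splitting of `η`. -/
lemma xiForm_eq_iff (h : VacuumFields U L Gt lam v) (hx : x ∈ U) (ha : L.sa x ≠ 0) {φ Y : ℂ}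
    (hφ : φ ≠ 0) (hY : Y ≠ 0) (y : Fin 4 → ℂ) (hy : ∑ a, (L.nUp x a : ℂ) * y a = 0) :
    DifferentiableAt ℝ L.sw x ∧
    ((∀ a c, xiForm L x (fun b => 3 * L.sw x * ((pd b L.conf x : ℝ) : ℂ) + L.conf x * pd b L.sw x)
        a c - φ * (Y * L.normal x a + y a) * (Y * L.normal x c + y c) = 0) ↔
      (Y ^ 2 = L.lapseSq x φ ∧ (∀ c, y c = L.shift x φ Y c) ∧
        ∀ a b, y a * y b = L.tensorQ x φ a b / (L.conf x : ℂ) ^ 4)) := by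
  obtain ⟨P, Q, s, hf⟩ := h.exists_adaptedFrame hx
  obtain ⟨E, hE, htr, hW⟩ := hf.selfDual_eq (h.isWeylTensor_resWeyl hx)
  choose F hF _ hN using fun e => hf.selfDual_eq (h.isWeylTensor_nablaResWeyl hx e)
  have hs : ∀ {M : Matrix (Fin 3) (Fin 3) ℂ}, Mᵀ = M →
      ((sdBiv Q s)ᵀ * M * sdBiv Q s)ᵀ = (sdBiv Q s)ᵀ * M * sdBiv Q s := fun hM => by
    simp only [Matrix.transpose_mul, Matrix.transpose_transpose, hM, Matrix.mul_assoc]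
  have hsA := fun e => pd_scalarA h.volume h.pair.metric hx (h.diff_resWeyl hx) e
    (by rw [hW, hs hE]) (by rw [hN, hs (hF e)])
  have hsB := fun e => pd_scalarB h.volume h.pair.metric hx (h.diff_resWeyl hx) e
  have hda : DifferentiableAt ℝ L.sa x := (hsA 0).1
  have hdb : DifferentiableAt ℝ L.sb x := (hsB 0).1
  have hsa : ∀ e, pd e L.sa x = 32 * (F e * E).trace := fun e => by
    refine (hsA e).2.trans ?_
    rw [hW, hN, invBiv, trace_sdBiv_mul hf.orth]
    ring
  have hsb : ∀ e, pd e L.sb x = -192 * (F e * (E * E)).trace := fun e => by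
    refine (hsB e).2.trans ?_
    rw [hW, hN, invBiv, ← Matrix.mul_assoc ((sdBiv Q s)ᵀ * E * sdBiv Q s * _)
      ((sdBiv Q s)ᵀ * E * sdBiv Q s), sdBiv_mul_mul hf.orth, trace_sdBiv_mul hf.orth,
      Matrix.mul_smul, Matrix.trace_smul, smul_eq_mul]
    ring
  have hdw : DifferentiableAt ℝ L.sw x := by
    have : L.sw = fun y => -L.sb y * (2 * L.sa y)⁻¹ := funext fun y => div_eq_mul_inv _ _
    rw [this]
    exact hdb.fun_neg.fun_mul ((hda.const_mul 2).fun_inv (mul_ne_zero two_ne_zero ha))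
  have hsw : ∀ e, pd e L.sw x
      = (L.sb x * pd e L.sa x - L.sa x * pd e L.sb x) / (2 * L.sa x ^ 2) := by
    intro e
    have h1 : pd e (fun y => 2 * L.sa y * L.sw y) x = -pd e L.sb x := by
      rw [← pd_neg]
      have hne : ∀ᶠ y in nhds x, L.sa y ≠ 0 := hda.continuousAt.eventually_ne ha
      refine pd_congr (hne.mono fun y hy => ?_)
      change 2 * L.sa y * (-L.sb y / (2 * L.sa y)) = -L.sb y
      field_simp
    rw [pd_mul (hda.const_mul 2) hdw, pd_const_mul _ hda] at h1
    have h2 : L.sw x = -L.sb x / (2 * L.sa x) := rfl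
    rw [h2] at h1
    field_simp at h1 ⊢
    linear_combination h1
  set B : Fin 4 → Fin 4 → ℂ := fun e p => ((pd e (fun y => L.nUp y p) x
    + ∑ f, christoffel L.metric x p e f * L.nUp x f : ℝ) : ℂ) with hB
  have hpar := hf.wPar_eq hE htr hW hF hN (hf.div_selfDual (h.isWeylTensor_nablaResWeyl hx)
    (h.div_resWeyl hx)) hsa hsb (B := B)
    (fun e b d => by simp only [hf.timelike, hB]; exact h.nablaE_eq hx e b d)
    (fun e => by
      have h1 := congrArg Complex.ofReal (h.normal_nablaUp hx e)
      simp only [Complex.ofReal_sum, Complex.ofReal_mul, hf.normal_eq, neg_mul,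
        Finset.sum_neg_distrib, Complex.ofReal_zero, neg_eq_zero] at h1
      exact h1)
    (fun c d => by
      rw [← h.pair.metric.lower_nabla hx (u := fun k y => L.normal y k)
        (V := fun d y => L.nUp y d) (h.diff_nUp hx) (fun y hy k => h.lower_normal hy k) c d]
      rw [Complex.ofReal_sum]
      exact Finset.sum_congr rfl fun p _ => Complex.ofReal_mul _ _) ha
  simp only [← hsw] at hpar
  refine ⟨hdw, ?_⟩
  rw [← hf.xiForm_eq_iff hE htr hW hf.sigLow_eq (hf.wPerp_eq hsw) hφ hY (h.pair.ne_zero x hx) y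
    (by simpa only [hf.timelike] using hy)]
  simp only [← hf.grad_eq hpar]

end VacuumFields

/-! ### The physical quantities in terms of the unphysical ones -/

lemma raiseLast_smul {G Gt : Matrix (Fin 4) (Fin 4) ℝ} {t : ℝ} (hG : Gt⁻¹ = t ^ 2 • G⁻¹) (k : ℂ)
    (W : Tensor4) :
    raiseLast Gt (fun a b c d => k * W a b c d)
      = fun a b c d => t ^ 4 * k * raiseLast G W a b c d := by
  funext a b c d
  simp only [raiseLast, hG, Matrix.smul_apply, smul_eq_mul, Finset.mul_sum]
  push_cast
  exact Finset.sum_congr rfl fun p _ => Finset.sum_congr rfl fun q _ => by ring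

lemma raiseFirst_smul {G Gt : Matrix (Fin 4) (Fin 4) ℝ} {t : ℝ} (hG : Gt⁻¹ = t ^ 2 • G⁻¹) (k : ℂ)
    (W : Tensor4) :
    raiseFirst Gt (fun a b c d => k * W a b c d)
      = fun a b c d => t ^ 4 * k * raiseFirst G W a b c d := by
  funext a b c d
  simp only [raiseFirst, hG, Matrix.smul_apply, smul_eq_mul, Finset.mul_sum]
  push_cast
  exact Finset.sum_congr rfl fun p _ => Finset.sum_congr rfl fun q _ => by ring

/-- The behaviour of `w` under a conformal change of the metric. -/
lemma scalarW_smul {G Gt : Matrix (Fin 4) (Fin 4) ℝ} {t : ℝ} (hG : Gt⁻¹ = t ^ 2 • G⁻¹) {k : ℂ}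
    (hk : k ≠ 0) (ht : t ≠ 0) (W : Tensor4) :
    scalarW Gt (fun a b c d => k * W a b c d) = t ^ 4 * k * scalarW G W := by
  have hA : scalarA Gt (fun a b c d => k * W a b c d) = (t ^ 4 * k) ^ 2 * scalarA G W := by
    simp only [scalarA, raiseLast_smul hG, raiseFirst_smul hG, Finset.mul_sum]
    exact Finset.sum_congr rfl fun a _ => Finset.sum_congr rfl fun b _ =>
      Finset.sum_congr rfl fun c _ => Finset.sum_congr rfl fun d _ => by ring
  have hB : scalarB Gt (fun a b c d => k * W a b c d) = (t ^ 4 * k) ^ 3 * scalarB G W := by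
    simp only [scalarB, raiseLast_smul hG, Finset.mul_sum]
    exact Finset.sum_congr rfl fun a _ => Finset.sum_congr rfl fun b _ =>
      Finset.sum_congr rfl fun c _ => Finset.sum_congr rfl fun d _ =>
      Finset.sum_congr rfl fun p _ => Finset.sum_congr rfl fun q _ => by ring
  have h0 : (t : ℂ) ^ 4 * k ≠ 0 := mul_ne_zero (pow_ne_zero _ (by exact_mod_cast ht)) hk
  rw [scalarW, scalarW, hA, hB]
  field_simp

namespace VacuumFields

variable {U : Set R4} {L : LocalFields} {Gt : R4 → Matrix (Fin 4) (Fin 4) ℝ} {lam : ℝ} {v : R4 → ℝ}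
  {volt : R4 → Fin 4 → Fin 4 → Fin 4 → Fin 4 → ℝ} {x : R4}

/-- Up to a power of `Θ`, the self-dual Weyl tensor of the physical metric is `𝔡`. -/
lemma physWeyl_eq (h : VacuumFields U L Gt lam v)
    (hvolt : ∀ y ∈ U, ∀ a b c d, volt y a b c d = (L.conf y ^ 4)⁻¹ * L.vol y a b c d) (hx : x ∈ U) :
    physWeyl Gt volt x = fun a b c d => (L.conf x : ℂ)⁻¹ * L.frakd x a b c d := by
  have h0 := h.pair.ne_zero x hx
  have hw : ∀ a b c d, weyl Gt x a b c d = (L.conf x)⁻¹ * L.resWeyl x a b c d := by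
    intro a b c d
    rw [LocalFields.resWeyl, h.pair.weyl_eq hx]
    field_simp
  have hd : ∀ a b c d, rightDual (Gt x) (volt x) (weyl Gt x) a b c d
      = (L.conf x)⁻¹ * rightDual (L.metric x) (L.vol x) (L.resWeyl x) a b c d := by
    intro a b c d
    simp only [rightDual]
    rw [mul_left_comm]
    simp only [Finset.mul_sum, hw, hvolt x hx, h.pair.inv_eq hx, Matrix.smul_apply, smul_eq_mul]
    refine Finset.sum_congr rfl fun e _ => Finset.sum_congr rfl fun f _ =>
      Finset.sum_congr rfl fun p _ => Finset.sum_congr rfl fun q _ => ?_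
    field_simp
  funext a b c d
  simp only [physWeyl, LocalFields.frakd, selfDual, hw, hd]
  push_cast
  ring

/-- The scalar `w` of the physical metric is `Θ³ w`. -/
lemma physW_eq (h : VacuumFields U L Gt lam v)
    (hvolt : ∀ y ∈ U, ∀ a b c d, volt y a b c d = (L.conf y ^ 4)⁻¹ * L.vol y a b c d) (hx : x ∈ U) :
    physW Gt volt x = (L.conf x : ℂ) ^ 3 * L.sw x := by
  have h0 := h.pair.ne_zero x hx
  have h0' : (L.conf x : ℂ) ≠ 0 := by exact_mod_cast h0
  rw [physW, h.physWeyl_eq hvolt hx, scalarW_smul (h.pair.inv_eq hx) (inv_ne_zero h0') h0,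
    LocalFields.sw]
  field_simp

/-- The tensor `Ξ` of the physical metric in terms of the unphysical fields.  The gradient of
`Θ³ w` contributes `Θ²` twice, the two inverse metrics `Θ⁴` and the self-dual tensors `Θ⁻¹`. -/
lemma physXi_eq (h : VacuumFields U L Gt lam v)
    (hvolt : ∀ y ∈ U, ∀ a b c d, volt y a b c d = (L.conf y ^ 4)⁻¹ * L.vol y a b c d) (hx : x ∈ U)
    (hw : DifferentiableAt ℝ L.sw x) (a c : Fin 4) :
    physXi Gt volt x a c = (L.conf x : ℂ) ^ 7 * xiForm L x
      (fun b => 3 * L.sw x * ((pd b L.conf x : ℝ) : ℂ) + L.conf x * pd b L.sw x) a c := by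
  have h0 := h.pair.ne_zero x hx
  have h0' : (L.conf x : ℂ) ≠ 0 := by exact_mod_cast h0
  have hθ := differentiableAt_ofReal (h.pair.diff_conf hx)
  have hd : ∀ b, pd b (physW Gt volt) x = (L.conf x : ℂ) ^ 2 *
      (3 * L.sw x * ((pd b L.conf x : ℝ) : ℂ) + L.conf x * pd b L.sw x) := by
    intro b
    rw [pd_congr (g := fun y => (L.conf y : ℂ) * ((L.conf y : ℂ) * (L.conf y : ℂ)) * L.sw y)
      (Filter.eventuallyEq_of_mem (h.pair.metric.isOpen.mem_nhds hx) fun y hy => by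
        rw [h.physW_eq hvolt hy]; ring), pd_mul (hθ.fun_mul (hθ.fun_mul hθ)) hw,
      pd_mul hθ (hθ.fun_mul hθ), pd_mul hθ hθ, pd_ofReal (h.pair.diff_conf hx)]
    ring
  have hG : ∀ a b c d, calG (Gt x) (volt x) a b c d
      = ((L.conf x : ℂ) ^ 4)⁻¹ * calG (L.metric x) (L.vol x) a b c d := by
    intro a b c d
    simp only [calG, hvolt x hx, h.pair.eq x hx, Matrix.smul_apply, smul_eq_mul]
    push_cast
    field_simp
  rw [physXi, xiForm]
  simp only [Finset.mul_sum]
  refine Finset.sum_congr rfl fun b _ => Finset.sum_congr rfl fun d _ =>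
    Finset.sum_congr rfl fun p _ => Finset.sum_congr rfl fun q _ => ?_
  rw [h.physWeyl_eq hvolt hx, h.physW_eq hvolt hx, hd, hd, hG, h.pair.inv_eq hx]
  simp only [Matrix.smul_apply, smul_eq_mul]
  push_cast
  field_simp

/-- The equation `Ξ = φ η ⊗ η` for the physical metric at a point, in terms of the orthogonal
splitting of `η`. -/
lemma physXi_eq_iff (h : VacuumFields U L Gt lam v)
    (hvolt : ∀ y ∈ U, ∀ a b c d, volt y a b c d = (L.conf y ^ 4)⁻¹ * L.vol y a b c d) (hx : x ∈ U)
    (ha : L.sa x ≠ 0) {r Y : ℂ} (hr : r ≠ 0) (hY : Y ≠ 0) (y : Fin 4 → ℂ)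
    (hy : ∑ a, (L.nUp x a : ℂ) * y a = 0) {η : Fin 4 → ℂ}
    (hη : ∀ a, η a = Y / (L.conf x : ℂ) ^ 2 * L.normal x a + y a / (L.conf x : ℂ) ^ 2) :
    (∀ a c, physXi Gt volt x a c - phiOfRoot (L.conf x * r) * η a * η c = 0) ↔
      (Y ^ 2 = L.lapseSq x (phiOfRoot r) ∧ (∀ c, y c = L.shift x (phiOfRoot r) Y c) ∧
        ∀ a b, y a * y b = L.tensorQ x (phiOfRoot r) a b / (L.conf x : ℂ) ^ 4) := by
  have h0' : (L.conf x : ℂ) ≠ 0 := by exact_mod_cast h.pair.ne_zero x hx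
  have hφ : phiOfRoot r ≠ 0 := mul_ne_zero (by norm_num) (pow_ne_zero _ hr)
  obtain ⟨hw, hiff⟩ := h.xiForm_eq_iff hx ha hφ hY y hy
  rw [← hiff]
  refine forall_congr' fun a => forall_congr' fun c => ?_
  have h1 : physXi Gt volt x a c - phiOfRoot (L.conf x * r) * η a * η c
      = (L.conf x : ℂ) ^ 7 * (xiForm L x
        (fun b => 3 * L.sw x * ((pd b L.conf x : ℝ) : ℂ) + L.conf x * pd b L.sw x) a c
        - phiOfRoot r * (Y * L.normal x a + y a) * (Y * L.normal x c + y c)) := by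
    rw [h.physXi_eq hvolt hx hw, hη, hη, phiOfRoot, phiOfRoot]
    field_simp
  rw [h1, mul_eq_zero, or_iff_right (pow_ne_zero _ h0')]

end VacuumFields

/-! ### From fields on the manifold to their components -/

section Charts

variable {M : Type*} [TopologicalSpace M] [ChartedSpace R4 M] {p : M} {x : R4} {U : Set M}

lemma isOpen_chartDomain (hU : IsOpen U) (p : M) : IsOpen (chartDomain U p) :=
  (continuousOn_extChartAt_symm p).isOpen_inter_preimage (isOpen_extChartAt_target p) hU

lemma pt_coord (p : M) : pt p (coord p) = p := extChartAt_to_inv p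

lemma coord_mem_chartDomain (hp : p ∈ U) : coord p ∈ chartDomain U p :=
  ⟨mem_extChartAt_target p, by rw [Set.mem_preimage, pt_coord]; exact hp⟩

lemma chartDomain_mono {V : Set M} (h : U ⊆ V) (p : M) : chartDomain U p ⊆ chartDomain V p :=
  fun _ hx => ⟨hx.1, h hx.2⟩

lemma contDiffOn_pt [IsManifold (𝓡 4) ∞ M] {f : M → ℝ} (hf : ContMDiff (𝓡 4) 𝓘(ℝ, ℝ) ∞ f) (p : M) :
    ContDiffOn ℝ ∞ (fun x => f (pt p x)) (extChartAt (𝓡 4) p).target :=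
  (hf.comp_contMDiffOn (contMDiffOn_extChartAt_symm p)).contDiffOn

/-- The coordinate vector fields form a basis of each tangent space. -/
lemma exists_basis_frame [IsManifold (𝓡 4) ∞ M] (hx : x ∈ (extChartAt (𝓡 4) p).target) :
    ∃ b : Module.Basis (Fin 4) ℝ (TangentSpace (𝓡 4) (pt p x)), ∀ i, b i = frame p x i := by
  have : IsManifold (𝓡 4) 1 M := IsManifold.of_le (n := ∞) (by simp)
  have h1 : (mfderiv 𝓘(ℝ, R4) (𝓡 4) (pt p) x).IsInvertible := by
    have := isInvertible_mfderivWithin_extChartAt_symm (I := 𝓡 4) hx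
    rwa [modelWithCornersSelf_coe, Set.range_id, mfderivWithin_univ] at this
  obtain ⟨e, he⟩ := h1
  let b0 : Module.Basis (Fin 4) ℝ R4 := (EuclideanSpace.basisFun (Fin 4) ℝ).toBasis
  refine ⟨b0.map ((NormedSpace.fromTangentSpace (𝕜 := ℝ) x).symm.toLinearEquiv.trans
    e.toLinearEquiv), fun i => ?_⟩
  rw [frame, ← he, Module.Basis.map_apply]
  simp [b0]

/-- The components of a Lorentzian metric; they are nondegenerate because an orthonormal basis exists. -/
lemma smoothMetric_metricComp [IsManifold (𝓡 4) ∞ M] (hU : IsOpen U) {g : BilinField M}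
    (hg : IsLorentzMetricOn U g) (p : M) : SmoothMetric (chartDomain U p) (metricComp g p) where
  isOpen := isOpen_chartDomain hU p
  smooth := hg.smooth p
  symm y hy := by
    ext i j
    exact hg.symm _ hy.2 _ _
  det y hy := by
    obtain ⟨b, hb⟩ := exists_basis_frame hy.1
    obtain ⟨e, he⟩ := hg.signature _ hy.2
    rw [isUnit_iff_ne_zero]
    intro h0
    obtain ⟨c, hc, hMc⟩ := Matrix.exists_mulVec_eq_zero_iff.mpr h0
    set u : TangentSpace (𝓡 4) (pt p y) := ∑ j, c j • b j with hu
    have h1 : ∀ i, g (pt p y) (b i) u = 0 := fun i => by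
      have := congrFun hMc i
      simp only [Matrix.mulVec, dotProduct, metricComp, Matrix.of_apply, Pi.zero_apply,
        ← hb] at this
      simp only [hu, map_sum, map_smul, smul_eq_mul, ← this, mul_comm]
    have h2 : (g (pt p y)).flip u = 0 := b.ext h1
    have h3 : ∀ i, e.repr u i = 0 := fun i => by
      have h4 : g (pt p y) (e i) u = 0 := congrArg (fun f => f (e i)) h2
      rw [← e.sum_repr u] at h4
      simp only [map_sum, map_smul, he, smul_eq_mul, mul_ite, mul_one, mul_zero,
        Finset.sum_ite_eq, Finset.mem_univ, if_true] at h4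
      split_ifs at h4 <;> linarith
    have h5 : u = 0 := e.ext_elem fun i => by rw [h3]; simp
    exact hc (funext fun i => Fintype.linearIndependent_iff.mp b.linearIndependent c h5 i)

lemma smoothVolume_volComp {g : BilinField M} {vol : FourForm M}
    (hvol : IsVolumeElementOn U g vol) (p : M) :
    SmoothVolume (chartDomain U p) (metricComp g p) (volComp vol p)
      (fun y => vol (pt p y) (frame p y)) where
  eq y _ a b c d := by
    rw [volComp, alternating_eq_lc4 (vol (pt p y)) (frame p y), zsmul_eq_mul, mul_comm]
  smooth := by
    refine (hvol.smooth p 0 1 2 3).congr fun y _ => ?_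
    rw [volComp, alternating_eq_lc4 (vol (pt p y)) (frame p y), show lc4 0 1 2 3 = 1 by decide,
      one_smul]
  sq y hy := hvol.sq _ hy.2 _

lemma conformalPair_metricComp [IsManifold (𝓡 4) ∞ M] (hU : IsOpen U) {g gphys : BilinField M}
    (hg : IsLorentzMetricOn U g) (hgphys : IsLorentzMetricOn U gphys) {Θ : M → ℝ}
    (hΘ : ContMDiff (𝓡 4) 𝓘(ℝ, ℝ) ∞ Θ) (hΘ_ne : ∀ x ∈ U, Θ x ≠ 0)
    (hconf : ∀ x ∈ U, ∀ u v, g x u v = Θ x ^ 2 * gphys x u v) (p : M) :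
    ConformalPair (chartDomain U p) (metricComp g p) (metricComp gphys p) (fun y => Θ (pt p y)) where
  metric := smoothMetric_metricComp hU hg p
  phys := smoothMetric_metricComp hU hgphys p
  smooth := (contDiffOn_pt hΘ p).mono Set.inter_subset_left
  ne_zero y hy := hΘ_ne _ hy.2
  eq y hy := by
    ext i j
    exact hconf _ hy.2 _ _

/-- The volume elements of conformally related metrics, with the same orientation. -/
lemma volume_conformal {g gphys : BilinField M} {vol volphys : FourForm M} {Θ : M → ℝ} {q : M}
    (hΘ : Θ q ≠ 0) (hconf : ∀ u v, g q u v = Θ q ^ 2 * gphys q u v)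
    (v : Fin 4 → TangentSpace (𝓡 4) q)
    (hvol : vol q v ^ 2 = -(Matrix.of fun i j => g q (v i) (v j)).det)
    (hvolphys : volphys q v ^ 2 = -(Matrix.of fun i j => gphys q (v i) (v j)).det)
    (horient : 0 ≤ vol q v * volphys q v) : volphys q v = (Θ q ^ 4)⁻¹ * vol q v := by
  have h1 : (Matrix.of fun i j => g q (v i) (v j))
      = Θ q ^ 2 • Matrix.of fun i j => gphys q (v i) (v j) := by
    ext i j
    exact hconf _ _
  rw [h1, Matrix.det_smul, Fintype.card_fin] at hvol
  have h2 : vol q v ^ 2 = (Θ q ^ 4 * volphys q v) ^ 2 := by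
    rw [hvol, mul_pow, hvolphys]; ring
  have h4 : 0 < Θ q ^ 4 := by positivity
  rw [eq_inv_mul_iff_mul_eq₀ h4.ne']
  rcases sq_eq_sq_iff_eq_or_eq_neg.mp h2 with h3 | h3
  · exact h3.symm
  · -- opposite signs are compatible with the orientations only if both forms vanish
    have h5 : volphys q v = 0 := by
      rw [h3] at horient
      have : Θ q ^ 4 * volphys q v ^ 2 ≤ 0 := by linarith
      exact pow_eq_zero_iff two_ne_zero |>.mp
        (le_antisymm (nonpos_of_mul_nonpos_right this h4) (sq_nonneg _))
    rw [h3, h5]; simp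

/-- Expansion of the unit normal in the coordinate vector fields. -/
lemma sum_nUp_frame [IsManifold (𝓡 4) ∞ M] (hU : IsOpen U) {g : BilinField M}
    (hg : IsLorentzMetricOn U g) (vol : FourForm M) (Θ : M → ℝ) (n : VecField M) {p : M} {y : R4}
    (hy : y ∈ chartDomain U p) :
    ∑ a, (localFields g vol Θ n p).nUp y a • frame p y a = n (pt p y) := by
  obtain ⟨b, hb⟩ := exists_basis_frame hy.1
  have hG := smoothMetric_metricComp hU hg p
  have h1 : ∀ i, normalComp g n p y i
      = ∑ j, metricComp g p y i j * b.repr (n (pt p y)) j := by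
    intro i
    rw [normalComp]
    conv_lhs => rw [← b.sum_repr (n (pt p y))]
    simp only [map_sum, map_smul, LinearMap.sum_apply, LinearMap.smul_apply, smul_eq_mul, hb,
      metricComp, Matrix.of_apply]
    exact Finset.sum_congr rfl fun j _ => by rw [hg.symm _ hy.2, mul_comm]
  have h2 : ∀ i j, ∑ k, (metricComp g p y)⁻¹ i k * metricComp g p y k j = if i = j then 1 else 0 :=
    fun i j => by rw [← Matrix.mul_apply, hG.inv_mul hy, Matrix.one_apply]
  have h3 : ∀ a, (localFields g vol Θ n p).nUp y a = b.repr (n (pt p y)) a := by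
    intro a
    simp only [LocalFields.nUp, localFields, h1, Finset.mul_sum, ← mul_assoc]
    rw [Finset.sum_comm]
    simp [← Finset.sum_mul, h2]
  simp only [h3, ← hb, b.sum_repr]

end Charts

end TypeDData

open TypeDData
theorem mainTheorem8 {M : Type*} [TopologicalSpace M] [ChartedSpace R4 M] [IsManifold (𝓡 4) ∞ M]
    -- the unphysical space-time, its volume element and the conformal factor
    (g : BilinField M) (hg : IsLorentzMetricOn Set.univ g)
    (vol : FourForm M) (hvol : IsVolumeElementOn Set.univ g vol)
    (Θ : M → ℝ) (hΘ : ContMDiff (𝓡 4) 𝓘(ℝ, ℝ) ∞ Θ)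
    -- the physical space-time, identified with an open subset of the unphysical one
    (Mphys : Set M) (hMphys : IsOpen Mphys) (hΘ_ne : ∀ x ∈ Mphys, Θ x ≠ 0)
    (gphys : BilinField M) (hgphys : IsLorentzMetricOn Mphys gphys)
    (hconf : ∀ x ∈ Mphys, ∀ u v, g x u v = Θ x ^ 2 * gphys x u v)
    (lam : ℝ) (hvac : IsEinsteinOn Mphys gphys lam)
    (volphys : FourForm M) (hvolphys : IsVolumeElementOn Mphys gphys volphys)
    (horient : ∀ x ∈ Mphys, ∀ v, 0 ≤ vol x v * volphys x v)
    -- the foliation with unit normal `n`, its leaf `{τ = 0}` and the part of it in `Mphys`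
    (τ : M → ℝ) (n : VecField M) (hn : IsFoliationNormal g τ n)
    (Sphys : Set M) (hSphys : ∀ p ∈ Sphys, p ∈ Mphys ∧ τ p = 0)
    -- a covector field and its orthogonal splitting
    (ηphys : CovecField M) (Y : M → ℂ) (Ysp : CovecField M)
    (hspatial : ∀ p ∈ Sphys, Ysp p (n p) = 0)
    (hsplit : ∀ p ∈ Sphys, ∀ v,
      ηphys p v = Y p / (Θ p : ℂ) ^ 2 * (g p (n p) v : ℂ) + Ysp p v / (Θ p : ℂ) ^ 2)
    -- compatible cube roots of `w` and of its physical counterpart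
    (r rphys : M → ℂ)
    (hr : ∀ p ∈ Sphys, r p ^ 3 = (localFields g vol Θ n p).sw (coord p))
    (hrphys : ∀ p ∈ Sphys,
      rphys p ^ 3 = physW (metricComp gphys p) (volComp volphys p) (coord p))
    (hroots : ∀ p ∈ Sphys, rphys p = (Θ p : ℂ) * r p)
    -- the denominators in the formulas do not vanish
    (ha : ∀ p ∈ Sphys, (localFields g vol Θ n p).sa (coord p) ≠ 0)
    (hw : ∀ p ∈ Sphys, (localFields g vol Θ n p).sw (coord p) ≠ 0)
    (hY : ∀ p ∈ Sphys, Y p ≠ 0) :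
    (∀ p ∈ Sphys, ∀ a c : Fin 4,
      physXi (metricComp gphys p) (volComp volphys p) (coord p) a c
        - phiOfRoot (rphys p) * covecComp ηphys p a * covecComp ηphys p c = 0)
    ↔
    (∀ p ∈ Sphys,
      Y p ^ 2 = (localFields g vol Θ n p).lapseSq (coord p) (phiOfRoot (r p)) ∧
      (∀ c : Fin 4,
        covecComp Ysp p c
          = (localFields g vol Θ n p).shift (coord p) (phiOfRoot (r p)) (Y p) c) ∧
      (∀ a b : Fin 4,
        covecComp Ysp p a * covecComp Ysp p b
          = (localFields g vol Θ n p).tensorQ (coord p) (phiOfRoot (r p)) a b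
              / (Θ p : ℂ) ^ 4)) := by
  have hsub : ∀ p, ∀ y ∈ chartDomain Mphys p, y ∈ chartDomain Set.univ p := fun p =>
    chartDomain_mono (Set.subset_univ _) p
  have hg' : IsLorentzMetricOn Mphys g :=
    ⟨fun x _ => hg.symm x trivial, fun x _ => hg.signature x trivial,
      fun p i j => (hg.smooth p i j).mono (hsub p)⟩
  have hvol' : IsVolumeElementOn Mphys g vol :=
    ⟨fun x _ => hvol.sq x trivial, fun p i j k l => (hvol.smooth p i j k l).mono (hsub p)⟩
  refine forall₂_congr fun p hp => ?_
  have hpM := (hSphys p hp).1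
  have hx : coord p ∈ chartDomain Mphys p := coord_mem_chartDomain hpM
  have hexp : ∀ y ∈ chartDomain Mphys p,
      ∑ a, (localFields g vol Θ n p).nUp y a • frame p y a = n (pt p y) := fun y hy =>
    sum_nUp_frame hMphys hg' vol Θ n hy
  have hvac' : VacuumFields (chartDomain Mphys p) (localFields g vol Θ n p) (metricComp gphys p) lam
      (fun y => vol (pt p y) (frame p y)) :=
    { pair := conformalPair_metricComp hMphys hg' hgphys hΘ hΘ_ne hconf p
      einstein := hvac p
      volume := smoothVolume_volComp hvol' p
      smooth_normal := fun i => (hn.smooth p i).mono (hsub p)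
      unit := fun y hy => by
        rw [← hn.unit (pt p y)]
        conv_rhs => enter [2]; rw [← hexp y hy]
        simp only [map_sum, map_smul, smul_eq_mul]
        exact Finset.sum_congr rfl fun a _ => mul_comm _ _ }
  have hvolt : ∀ y ∈ chartDomain Mphys p, ∀ a b c d, volComp volphys p y a b c d
      = ((localFields g vol Θ n p).conf y ^ 4)⁻¹ * (localFields g vol Θ n p).vol y a b c d :=
    fun y hy a b c d => volume_conformal (hΘ_ne _ hy.2) (hconf _ hy.2) _ (hvol'.sq _ hy.2 _)
      (hvolphys.sq _ hy.2 _) (horient _ hy.2 _)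
  have hcf : (localFields g vol Θ n p).conf (coord p) = Θ p := congrArg Θ (pt_coord p)
  -- the conditions on the splitting, moved from `p` to the point with the coordinates of `p`
  have hsp : ∀ q, q = p → Ysp q (n q) = 0 := by
    rintro q rfl; exact hspatial q hp
  have hspl : ∀ q, q = p → ∀ v, ηphys q v
      = Y p / (Θ p : ℂ) ^ 2 * (g q (n q) v : ℂ) + Ysp q v / (Θ p : ℂ) ^ 2 := by
    rintro q rfl; exact hsplit q hp
  have hr0 : r p ≠ 0 := fun h0 => hw p hp (by rw [← hr p hp, h0]; simp)
  have hy : ∑ a, ((localFields g vol Θ n p).nUp (coord p) a : ℂ) * covecComp Ysp p a = 0 := by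
    rw [← hsp _ (pt_coord p), ← hexp _ hx]
    simp [covecComp]
  have hiff := hvac'.physXi_eq_iff hvolt hx (ha p hp) hr0 (hY p hp) (covecComp Ysp p) hy
    (η := covecComp ηphys p) (fun a => by rw [hcf]; exact hspl _ (pt_coord p) _)
  rw [hcf, ← hroots p hp] at hiff
  exact hiff
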